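/- Let $(\epsilon_t)_{t\in\mathbb Z}$ be i.i.d. real random variables with mean zero, variance $\sigma_\epsilon^2>0$ and finite fourth moment. For $-\tfrac12\le d'<\tfrac12$, a (mean-zero) linear process with memory parameter $d'$ is $Y_t=\sum_{j\ge0}a_j\epsilon_{t-j}$ (convergence in $L^2$), where the real coefficients $(a_j)$ satisfy: - if $d'=0$: $\sum_j|a_j|<\infty$ and $\sum_j a_j\ne0$; - if $0<d'<\tfrac12$: $a_j\sim c(d')\,j^{d'-1}$ as $j\to\infty$, with $c(d')\neq0$; - if $-\tfrac12\le d'<0$: $\sum_j a_j=0$ and $a_j=c(d')\,j^{d'-1}(1+O(j^{-1}))$, with $c(d')\neq0$. Put $\delta(-\tfrac12)=8\sigma_\epsilon^2c(-\tfrac12)^2$, $\delta(0)=\sigma_\epsilon^2\bigl(\sum_j a_j\bigr)^2$ and, for $0<|d'|<\tfrac12$, $$\delta(d')=\frac{\sigma_\epsilon^2\,c(d')^2\,B(d',1-2d')}{d'(2d'+1)},\qquad B(x,y)=\frac{\Gamma(x)\Gamma(y)}{\Gamma(x+y)}.$$ Let $\tfrac12\le d<\tfrac32$ and let $(X_t)_{t\ge0}$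 be an integrated process with memory parameter $d$, i.e. $X_0$ is an arbitrary random variable and the differences $Y_t=X_t-X_{t-1}$, $t\ge1$, form a linear process as above with memory parameter $d-1$. Let $\bar X_n=\frac1n\sum_{k=1}^nX_k$. All limits are as $n\to\infty$. **Part A.** Let $d_n=\sqrt{\log n}$ if $d=\tfrac12$ and $d_n=n^{d-1/2}$ if $\tfrac12<d<\tfrac32$. Then $$\frac{\bar X_n}{d_n}\xrightarrow{d}\mathcal N\Bigl(0,\tfrac{1}{2d+1}\,\delta(d-1)\Bigr).$$ **Part B.** Assume $d=\tfrac12$. 1. We have $$\frac1{n\log n}\sum_{k=1}^n(X_k-\bar X_n)^2\xrightarrow{L^2}\tfrac12\delta(-\tfrac12),\qquad \frac1{n\log n}\sum_{k=1}^nX_k^2\xrightarrow{d}\tfrac12\delta(-\tfrac12)\bigl(1+\chi^2(1)\bigr),$$ $$\frac{\bar X_n^2}{\frac1n\sum_{k=1}^n(X_k-\bar X_n)^2}\xrightarrow{d}\chi^2(1).$$ 2. Let $m=\lfloor\sqrt n\rfloor$ and $D_n=\frac1m\bigl(\sum_{i=1}^mX_i-\sum_{i=n-m+1}^nX_i\bigr)$.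 Then $$\frac{D_n}{\sqrt{\log n}}\xrightarrow{d}\mathcal N\bigl(0,\tfrac12\delta(-\tfrac12)\bigr),\qquad \frac{D_n^2}{\frac1n\sum_{k=1}^n(X_k-\bar X_n)^2}\xrightarrow{d}\chi^2(1).$$ 3. For fixed $s\ge1$ let $\lambda_j=2\pi j/n$ and let $Z_n(s,\tfrac12)\in\mathbb R^{2s}$ be the vector with entries $\frac1n\sum_{k=1}^n\cos(k\lambda_j)X_k$ and $\frac1n\sum_{k=1}^n\sin(k\lambda_j)X_k$, $1\le j\le s$. Then the pair $A_n=\bigl(\bar X_n/\sqrt{\log n},\,D_n/\sqrt{\log n}\bigr)$ is asymptotically independent of $Z_n(s,\tfrac12)$ (in particular each of its two components is): for every bounded continuous $h:\mathbb R^2\times\mathbb R^{2s}\to\mathbb R$, $$\mathbb E\,h\bigl(A_n,Z_n(s,\tfrac12)\bigr)-\mathbb E\,h\bigl(A_n,Z_n'\bigr)\to0,$$ where $Z_n'$ is a copy of $Z_n(s,\tfrac12)$ independent of $A_n$. -/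

import Mathlib

open MeasureTheory ProbabilityTheory Filter Topology Asymptotics
open scoped NNReal ENNReal

noncomputable section

namespace LongMemory

/-- The innovations: real random variables `ε t`, `t ∈ ℤ`, independent and identically distributed,
centred, with finite fourth moment and positive variance. -/
structure IsInnovation {Ω : Type*} [MeasurableSpace Ω] (P : Measure Ω) (ε : ℤ → Ω → ℝ) : Prop where
  measurable : ∀ t, Measurable (ε t)
  indep : iIndepFun ε P
  identDistrib : ∀ t, IdentDistrib (ε t) (ε 0) P P
  mean_zero : ∫ ω, ε 0 ω ∂P = 0
  fourth_moment : MemLp (ε 0) 4 P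
  variance_pos : 0 < ∫ ω, (ε 0 ω) ^ 2 ∂P

/-- The variance `σ_ε²` of the (centred) innovations. -/
def innovationVariance {Ω : Type*} [MeasurableSpace Ω] (P : Measure Ω) (ε : ℤ → Ω → ℝ) : ℝ :=
  ∫ ω, (ε 0 ω) ^ 2 ∂P

/-- The conditions on the coefficients `(a_j)` of a linear process with memory parameter
`d ∈ [-1/2, 1/2)`; `c` is the constant `c(d)` (it plays no role when `d = 0`). In the last case
the bound says that `a_j = c j^{d-1} (1 + O(j⁻¹))`. -/
def HasMemory (d c : ℝ) (a : ℕ → ℝ) : Prop :=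
  (d = 0 ∧ Summable (fun j => |a j|) ∧ ∑' j, a j ≠ 0) ∨
  (0 < d ∧ d < 1 / 2 ∧ c ≠ 0 ∧ a ~[atTop] fun j : ℕ => c * (j : ℝ) ^ (d - 1)) ∨
  (-(1 / 2) ≤ d ∧ d < 0 ∧ c ≠ 0 ∧ HasSum a 0 ∧
    (fun j : ℕ => a j - c * (j : ℝ) ^ (d - 1)) =O[atTop] fun j : ℕ => (j : ℝ) ^ (d - 1) * (j : ℝ)⁻¹)

/-- `Y` is the value at time `t` of the linear process with coefficients `a`, innovations `ε` and
mean zero: `Y = ∑_{j ≥ 0} a_j ε_{t-j}`, the series being the limit in `L²` of its partial sums. -/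
def IsLinearAt {Ω : Type*} [MeasurableSpace Ω] (P : Measure Ω) (a : ℕ → ℝ) (ε : ℤ → Ω → ℝ)
    (t : ℤ) (Y : Ω → ℝ) : Prop :=
  Tendsto (fun N : ℕ => eLpNorm (fun ω => Y ω - ∑ j ∈ Finset.range N, a j * ε (t - (j : ℤ)) ω) 2 P)
    atTop (𝓝 0)

/-- `X` is an integrated process with memory parameter `d ∈ [1/2, 3/2)`: its first differences
`X_t - X_{t-1}`, `t ≥ 1`, form a mean zero linear process with memory parameter `d - 1`.
The initial value `X_0` is an arbitrary random variable. -/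
structure IsIntegrated {Ω : Type*} [MeasurableSpace Ω] (P : Measure Ω) (d c : ℝ) (a : ℕ → ℝ)
    (ε : ℤ → Ω → ℝ) (X : ℕ → Ω → ℝ) : Prop where
  le_memory : 1 / 2 ≤ d
  memory_lt : d < 3 / 2
  innovation : IsInnovation P ε
  coeff : HasMemory (d - 1) c a
  measurable : ∀ t, Measurable (X t)
  diff_linear : ∀ t : ℕ, 1 ≤ t → IsLinearAt P a ε (t : ℤ) (fun ω => X t ω - X (t - 1) ω)

/-- The constant `δ(d)`, `-1/2 ≤ d < 1/2`. Here `beta x y = Γ(x) Γ(y) / Γ(x + y)`, which is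
the beta function extended to negative non-integer arguments. -/
def delta (d σ2 c : ℝ) (a : ℕ → ℝ) : ℝ :=
  if d = -(1 / 2) then 8 * σ2 * c ^ 2
  else if d = 0 then σ2 * (∑' j, a j) ^ 2
  else σ2 * c ^ 2 * beta d (1 - 2 * d) / (d * (2 * d + 1))

/-- `δ(d)` is positive, so it may be used as a variance. -/
theorem delta_pos {d σ2 c : ℝ} {a : ℕ → ℝ} (hσ : 0 < σ2) (h : HasMemory d c a) :
    0 < delta d σ2 c a := by
  have key : ∀ d : ℝ, -(1 / 2) < d → d < 1 / 2 → d ≠ 0 → c ≠ 0 →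
      0 < σ2 * c ^ 2 * beta d (1 - 2 * d) / (d * (2 * d + 1)) := by
    intro d h1 h2 h0 hc
    have g1 : 0 < Real.Gamma (d + 1) := Real.Gamma_pos_of_pos (by linarith)
    have g2 : 0 < Real.Gamma (1 - 2 * d) := Real.Gamma_pos_of_pos (by linarith)
    have g3 : 0 < Real.Gamma (d + (1 - 2 * d)) := Real.Gamma_pos_of_pos (by linarith)
    have g4 : Real.Gamma d = Real.Gamma (d + 1) / d := by
      rw [Real.Gamma_add_one h0]; field_simp
    have h3 : 0 < 2 * d + 1 := by linarith
    have e : σ2 * c ^ 2 * beta d (1 - 2 * d) / (d * (2 * d + 1)) =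
        σ2 * c ^ 2 * Real.Gamma (d + 1) * Real.Gamma (1 - 2 * d) /
          (Real.Gamma (d + (1 - 2 * d)) * d ^ 2 * (2 * d + 1)) := by
      rw [beta, g4]; field_simp
    rw [e]
    positivity
  unfold delta
  rcases h with ⟨h0, -, hs⟩ | ⟨h0, h1, hc, -⟩ | ⟨h0, h1, hc, -⟩
  · subst h0
    norm_num
    positivity
  · rw [if_neg (by linarith), if_neg h0.ne']
    exact key d (by linarith) h1 h0.ne' hc
  · by_cases hd : d = -(1 / 2)
    · rw [if_pos hd]; positivity
    · rw [if_neg hd, if_neg h1.ne]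
      exact key d (lt_of_le_of_ne h0 (Ne.symm hd)) (by linarith) h1.ne hc

/-- The law `χ²(1)`: the law of the square of a standard normal variable. -/
def chiSqOne : Measure ℝ := (gaussianReal 0 1).map (fun x => x ^ 2)

instance : IsProbabilityMeasure chiSqOne :=
  Measure.isProbabilityMeasure_map (by fun_prop)

/-- The sample mean `(x_1 + ⋯ + x_n) / n`. -/
def sampleMean (x : ℕ → ℝ) (n : ℕ) : ℝ := (∑ k ∈ Finset.Icc 1 n, x k) / n

/-- The sum of squared deviations from the sample mean, `∑_{k=1}^n (x_k - x̄_n)²`. -/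
def sumSqDev (x : ℕ → ℝ) (n : ℕ) : ℝ := ∑ k ∈ Finset.Icc 1 n, (x k - sampleMean x n) ^ 2

/-- With `m = ⌊√n⌋`, the mean of the first `m` minus the mean of the last `m` of `x_1, …, x_n`. -/
def meanDiff (x : ℕ → ℝ) (n : ℕ) : ℝ :=
  (∑ i ∈ Finset.Icc 1 n.sqrt, x i - ∑ i ∈ Finset.Icc (n - n.sqrt + 1) n, x i) / n.sqrt

/-- The normalization `d_n` of the sample mean. -/
def meanNorm (d : ℝ) (n : ℕ) : ℝ :=
  if d = 1 / 2 then √(Real.log n) else (n : ℝ) ^ (d - 1 / 2)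

/-- The `j`-th Fourier frequency `2πj/n`. -/
def fourierFreq (n j : ℕ) : ℝ := 2 * Real.pi * j / n

/-- The vector `Z_n(s, d)`: the first block holds the cosine sums and the second block the sine sums
at the frequencies `λ_1, …, λ_s` (the index `j : Fin s` stands for `λ_{j+1}`). -/
def dftVec (d : ℝ) (s : ℕ) (x : ℕ → ℝ) (n : ℕ) : Fin s ⊕ Fin s → ℝ :=
  Sum.elim
    (fun j => (∑ k ∈ Finset.Icc 1 n, Real.cos (k * fourierFreq n (j + 1)) * x k) /
      (n : ℝ) ^ (1 / 2 + d))
    (fun j => (∑ k ∈ Finset.Icc 1 n, Real.sin (k * fourierFreq n (j + 1)) * x k) /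
      (n : ℝ) ^ (1 / 2 + d))

/-- `A n` and `B n` are asymptotically independent: the joint law of `(A n, B n)` and the product
of the laws of `A n` and `B n` merge, when tested against bounded continuous functions.
(Under `P.prod P` the two coordinates are independent copies of `ω`.) -/
def AsymptoticallyIndep {Ω E F : Type*} [MeasurableSpace Ω] [TopologicalSpace E]
    [TopologicalSpace F] (P : Measure Ω) (A : ℕ → Ω → E) (B : ℕ → Ω → F) : Prop :=
  ∀ h : BoundedContinuousFunction (E × F) ℝ,
    Tendsto (fun n => (∫ ω, h (A n ω, B n ω) ∂P) - ∫ p, h (A n p.1, B n p.2) ∂(P.prod P))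
      atTop (𝓝 0)

end LongMemory

end

namespace LongMemory

/-! ### Moments of finite linear forms in the innovations -/

/-! Let S(m) be the sum of the `a j` with j ≤ m, and let s_k ∈ ℓ²(ℤ) have entries S(k-i) - S(-i).
Then X_k - X_0 is the L² linear form with coefficients s_k, and covariances are σ_ε² times inner
products. The sample mean minus X_0, the difference D_n and the Fourier sums are therefore linear
forms too; X_0 cancels in the last two, and in the first X_0/d_n tends to 0 at every point, so
neither its law nor its dependence on the innovations matters.

Limit laws. The characteristic function of a linear form is a product over the innovations. If all
coefficients of x are small, it lies within η‖x‖² of exp(-σ_ε²‖x‖²/2). Asymptotic normality thus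
needs only the limit of ‖x_n‖² and uniform smallness of the coefficients
(`tendstoInDistribution_gaussian`). If moreover ⟨x_n, y_n⟩ → 0, the joint characteristic function
factorises asymptotically, and with tightness this gives asymptotic independence
(`asymptoticallyIndep_of_charFunDual`), even when one of the two has no limit law.

Case d > 1/2. Stationarity of the increments gives the exact identity ‖s_1 + ⋯ + s_n‖² = ∑ k‖s_k‖²
(`norm_sum_increment`). With e = d - 1 ≠ 0, S(m) ~ (c/e) m^e turns ‖s_k‖² into a sum and a Riemann
sum of order k^(2e+1), whose constant is a beta integral; for e = 0 the past contributes only o(k).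
Summation by Stolz-Cesàro produces the factor 1/(2d+1).

Case d = 1/2. Now S(m)² ~ 4c²/m, so squares sum to 4c² log n while a window of n absolute values
sums to O(√n). Let w_k be the sequence S run backwards from time k and cut off at time -n. Up to
bounded errors in ℓ², s_k is w_k - w_0, and an average of w_1, ..., w_n with bounded weights is
negligible by the √n bound. So the sample mean is -w_0, of squared norm ~ 4c² log n, and X_k minus
the mean is w_k. In D_n two nearly orthogonal pieces remain, each cut at √n and so keeping half of
the logarithm. Fourier weights sum to zero, so w_0 drops out: these vectors are bounded, with
entries O(n^(-1/2)), and their inner products with the means are bounded, hence vanish after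
division by √(log n). For the sample variance, the fourth moment bounds the covariances of the
squares (`IsInnovation.integral_centered_sq_mul_le`), and the double sum is O(n² log n), negligible
against (n log n)². -/

theorem integrable_mul_pow_of_memLp_four {Ω : Type*} [MeasurableSpace Ω] {P : Measure Ω}
    [IsFiniteMeasure P] {U V W : Ω → ℝ} (hU : MemLp U 4 P) (hV : MemLp V 4 P) (hW : MemLp W 4 P)
    {p q r : ℕ} (h : p + q + r ≤ 4) :
    Integrable (fun ω => U ω ^ p * V ω ^ q * W ω ^ r) P := by
  have i4 : ∀ {T : Ω → ℝ}, MemLp T 4 P → Integrable (fun ω => T ω ^ 4) P := by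
    intro T hT
    have := hT.integrable_norm_pow (p := 4) (by norm_num)
    refine this.congr (ae_of_all _ fun ω => ?_)
    simp only [Real.norm_eq_abs]
    rw [show (4 : ℕ) = 2 * 2 by norm_num, pow_mul, sq_abs, ← pow_mul]
  have hb : Integrable (fun ω => 1 + U ω ^ 4 + V ω ^ 4 + W ω ^ 4) P :=
    (((integrable_const _).add (i4 hU)).add (i4 hV)).add (i4 hW)
  refine hb.mono' (by
    have := hU.1; have := hV.1; have := hW.1
    fun_prop) (ae_of_all _ fun ω => ?_)
  -- The 1 in the maximum allows the total degree to be raised to exactly 4; the fourth power of M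
  -- is one of the four terms of the majorant.
  set M := max 1 (max |U ω| (max |V ω| |W ω|)) with hM
  have h1 : 1 ≤ M := le_max_left _ _
  have hu : |U ω| ≤ M := by simp [hM]
  have hv : |V ω| ≤ M := by simp [hM]
  have hw : |W ω| ≤ M := by simp [hM]
  have e4 : ∀ x : ℝ, |x| ^ 4 = x ^ 4 := fun x => by
    rw [show (4 : ℕ) = 2 * 2 by norm_num, pow_mul, sq_abs, ← pow_mul]
  have h4 : M ^ 4 ≤ 1 + U ω ^ 4 + V ω ^ 4 + W ω ^ 4 := by
    have := e4 (U ω); have := e4 (V ω); have := e4 (W ω)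
    have := pow_nonneg (abs_nonneg (U ω)) 4
    have := pow_nonneg (abs_nonneg (V ω)) 4
    have := pow_nonneg (abs_nonneg (W ω)) 4
    rcases max_choice 1 (max |U ω| (max |V ω| |W ω|)) with e | e
    · rw [hM, e]; linarith
    · rcases max_choice |U ω| (max |V ω| |W ω|) with e' | e'
      · rw [hM, e, e']; linarith
      · rcases max_choice |V ω| |W ω| with e'' | e''
        · rw [hM, e, e', e'']; linarith
        · rw [hM, e, e', e'']; linarith
  calc ‖U ω ^ p * V ω ^ q * W ω ^ r‖ = |U ω| ^ p * |V ω| ^ q * |W ω| ^ r := by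
        simp
    _ ≤ M ^ p * M ^ q * M ^ r := by gcongr
    _ = M ^ (p + q + r) := by ring
    _ ≤ M ^ 4 := pow_le_pow_right₀ h1 h
    _ ≤ _ := h4

variable {Ω : Type*} [MeasurableSpace Ω] {P : Measure Ω} {ε : ℤ → Ω → ℝ}

namespace IsInnovation

theorem memLp_four (h : IsInnovation P ε) (t : ℤ) : MemLp (ε t) 4 P :=
  (h.identDistrib t).memLp_iff.2 h.fourth_moment

theorem memLp_two [IsFiniteMeasure P] (h : IsInnovation P ε) (t : ℤ) : MemLp (ε t) 2 P :=
  (h.memLp_four t).mono_exponent (by norm_num)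

theorem integral_pow (h : IsInnovation P ε) (t : ℤ) (k : ℕ) :
    ∫ ω, ε t ω ^ k ∂P = ∫ ω, ε 0 ω ^ k ∂P :=
  ((h.identDistrib t).comp (u := fun x => x ^ k) (by fun_prop)).integral_eq

theorem integral_eq_zero (h : IsInnovation P ε) (t : ℤ) : ∫ ω, ε t ω ∂P = 0 := by
  have := h.integral_pow t 1
  simpa [h.mean_zero] using this

theorem integral_sq (h : IsInnovation P ε) (t : ℤ) :
    ∫ ω, ε t ω ^ 2 ∂P = innovationVariance P ε := h.integral_pow t 2

end IsInnovation

/-- The finite linear form `∑_{i ∈ F} f_i ε_i`. -/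
def linSum {Ω : Type*} (ε : ℤ → Ω → ℝ) (f : ℤ → ℝ) (F : Finset ℤ) (ω : Ω) : ℝ :=
  ∑ i ∈ F, f i * ε i ω

theorem linSum_measurable (h : IsInnovation P ε) (f : ℤ → ℝ) (F : Finset ℤ) :
    Measurable (linSum ε f F) := by
  unfold linSum
  exact Finset.measurable_sum _ fun i _ => (h.measurable i).const_mul _

theorem linSum_memLp_four (h : IsInnovation P ε) (f : ℤ → ℝ) (F : Finset ℤ) :
    MemLp (linSum ε f F) 4 P := by
  unfold linSum
  exact memLp_finsetSum _ fun i _ => (h.memLp_four i).const_mul _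

theorem linSum_memLp_two [IsFiniteMeasure P] (h : IsInnovation P ε) (f : ℤ → ℝ) (F : Finset ℤ) :
    MemLp (linSum ε f F) 2 P := (linSum_memLp_four h f F).mono_exponent (by norm_num)

/-- Two forms over the same index set are treated as a pair, so that their mixed moments can be
built up one innovation at a time. -/
theorem linSum_indep (h : IsInnovation P ε) (f g : ℤ → ℝ) {F : Finset ℤ} {a : ℤ} (ha : a ∉ F) :
    IndepFun (fun ω => (linSum ε f F ω, linSum ε g F ω)) (ε a) P := by
  have := h.indep.indepFun_finset F {a} (by simpa using ha) h.measurable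
  have hψ : Measurable fun x : ({a} : Finset ℤ) → ℝ => x ⟨a, by simp⟩ := measurable_pi_apply _
  have h2 := this.comp
    (φ := fun x : F → ℝ => (∑ i : F, f i * x i, ∑ i : F, g i * x i)) (by fun_prop) hψ
  have e : (fun ω => (linSum ε f F ω, linSum ε g F ω)) =
      (fun x : F → ℝ => (∑ i : F, f i * x i, ∑ i : F, g i * x i)) ∘ fun ω i => ε i ω := by
    funext ω
    simp only [linSum, Function.comp]
    rw [← Finset.sum_coe_sort, ← Finset.sum_coe_sort F]
  rw [e]
  exact h2

theorem integral_linSum_mul_pow [IsProbabilityMeasure P] (h : IsInnovation P ε) (f g : ℤ → ℝ)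
    {F : Finset ℤ} {a : ℤ} (ha : a ∉ F) (p q r : ℕ) :
    ∫ ω, linSum ε f F ω ^ p * linSum ε g F ω ^ q * ε a ω ^ r ∂P =
      (∫ ω, linSum ε f F ω ^ p * linSum ε g F ω ^ q ∂P) * ∫ ω, ε 0 ω ^ r ∂P := by
  have := (linSum_indep h f g ha).comp (φ := fun x : ℝ × ℝ => x.1 ^ p * x.2 ^ q)
    (ψ := fun x : ℝ => x ^ r) (by fun_prop) (by fun_prop)
  have m1 := (linSum_measurable h f F)
  have m2 := (linSum_measurable h g F)
  have m3 := h.measurable a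
  have e := this.integral_fun_mul_eq_mul_integral (by
    simp only [Function.comp_def]; fun_prop) (by simp only [Function.comp_def]; fun_prop)
  simp only [Function.comp] at e
  rw [e, h.integral_pow]

theorem linSum_insert {Ω : Type*} {ε : ℤ → Ω → ℝ} (f : ℤ → ℝ) {F : Finset ℤ} {a : ℤ} (ha : a ∉ F)
    (ω : Ω) :
    linSum ε f (insert a F) ω = linSum ε f F ω + f a * ε a ω := by
  simp [linSum, Finset.sum_insert ha, add_comm]

/-- Binomial expansion in the new innovation, followed by independence. The restriction to total
degree 4 is what the moment hypothesis pays for. -/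
theorem integral_linSum_pow_insert [IsProbabilityMeasure P] (h : IsInnovation P ε) (f g : ℤ → ℝ)
    {F : Finset ℤ} {a : ℤ} (ha : a ∉ F) {p q : ℕ} (hpq : p + q ≤ 4) :
    ∫ ω, linSum ε f (insert a F) ω ^ p * linSum ε g (insert a F) ω ^ q ∂P =
      ∑ i ∈ Finset.range (p + 1), ∑ j ∈ Finset.range (q + 1),
        (f a ^ (p - i) * p.choose i * (g a ^ (q - j) * q.choose j)) *
        ((∫ ω, linSum ε f F ω ^ i * linSum ε g F ω ^ j ∂P) *
          ∫ ω, ε 0 ω ^ (p - i + (q - j)) ∂P) := by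
  have hint : ∀ i ∈ Finset.range (p + 1), ∀ j ∈ Finset.range (q + 1),
      Integrable (fun ω => (f a ^ (p - i) * p.choose i * (g a ^ (q - j) * q.choose j)) *
        (linSum ε f F ω ^ i * linSum ε g F ω ^ j * ε a ω ^ (p - i + (q - j)))) P := by
    intro i hi j hj
    rw [Finset.mem_range] at hi hj
    exact (integrable_mul_pow_of_memLp_four (linSum_memLp_four h f F) (linSum_memLp_four h g F)
      (h.memLp_four a) (by omega)).const_mul _
  calc _ = ∫ ω, ∑ i ∈ Finset.range (p + 1), ∑ j ∈ Finset.range (q + 1),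
        (f a ^ (p - i) * p.choose i * (g a ^ (q - j) * q.choose j)) *
        (linSum ε f F ω ^ i * linSum ε g F ω ^ j * ε a ω ^ (p - i + (q - j))) ∂P := by
        refine integral_congr_ae (ae_of_all _ fun ω => ?_)
        simp only [linSum_insert _ ha]
        rw [add_pow, add_pow, Finset.sum_mul_sum]
        refine Finset.sum_congr rfl fun i _ => Finset.sum_congr rfl fun j _ => ?_
        rw [mul_pow, mul_pow, pow_add]; ring
    _ = _ := by
        rw [integral_finsetSum _ fun i hi => integrable_finsetSum _ (hint i hi)]
        refine Finset.sum_congr rfl fun i hi => ?_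
        rw [integral_finsetSum _ (hint i hi)]
        refine Finset.sum_congr rfl fun j hj => ?_
        rw [integral_const_mul, integral_linSum_mul_pow h f g ha]

theorem integral_linSum [IsProbabilityMeasure P] (h : IsInnovation P ε) (f : ℤ → ℝ)
    (F : Finset ℤ) : ∫ ω, linSum ε f F ω ∂P = 0 := by
  unfold linSum
  rw [integral_finsetSum _ fun i _ => ((h.memLp_two i).integrable one_le_two).const_mul _]
  simp [integral_const_mul, h.integral_eq_zero]

theorem integral_linSum_mul [IsProbabilityMeasure P] (h : IsInnovation P ε) (f g : ℤ → ℝ)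
    (F : Finset ℤ) :
    ∫ ω, linSum ε f F ω * linSum ε g F ω ∂P = innovationVariance P ε * ∑ i ∈ F, f i * g i := by
  induction F using Finset.induction_on with
  | empty => simp [linSum]
  | insert a F ha ih =>
    have := integral_linSum_pow_insert h f g ha (p := 1) (q := 1) (by norm_num)
    simp only [pow_one] at this
    rw [this, Finset.sum_insert ha]
    simp [Finset.sum_range_succ, integral_linSum h, h.mean_zero, ih, h.integral_sq]
    ring

theorem integral_linSum_sq [IsProbabilityMeasure P] (h : IsInnovation P ε) (f : ℤ → ℝ)
    (F : Finset ℤ) :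
    ∫ ω, linSum ε f F ω ^ 2 ∂P = innovationVariance P ε * ∑ i ∈ F, f i ^ 2 := by
  simpa [sq] using integral_linSum_mul h f f F

/-- The fourth cumulant of the innovations. -/
noncomputable def innovationCumulant (P : Measure Ω) (ε : ℤ → Ω → ℝ) : ℝ :=
  (∫ ω, (ε 0 ω) ^ 4 ∂P) - 3 * innovationVariance P ε ^ 2

/-- Wick's formula with a fourth cumulant correction. Induction on the index set replaces the
enumeration of pairings: the recursion in one innovation reproduces both sides. -/
theorem integral_linSum_sq_mul_sq [IsProbabilityMeasure P] (h : IsInnovation P ε) (f g : ℤ → ℝ)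
    (F : Finset ℤ) :
    ∫ ω, linSum ε f F ω ^ 2 * linSum ε g F ω ^ 2 ∂P =
      innovationVariance P ε ^ 2 * ((∑ i ∈ F, f i ^ 2) * (∑ i ∈ F, g i ^ 2) +
        2 * (∑ i ∈ F, f i * g i) ^ 2) +
      innovationCumulant P ε * ∑ i ∈ F, f i ^ 2 * g i ^ 2 := by
  induction F using Finset.induction_on with
  | empty => simp [linSum]
  | insert a F ha ih =>
    rw [integral_linSum_pow_insert h f g ha (p := 2) (q := 2) (by norm_num)]
    simp only [Finset.sum_insert ha]
    simp only [Finset.sum_range_succ, Finset.range_zero, Finset.sum_empty, ih]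
    simp [integral_linSum h, integral_linSum_sq h, integral_linSum_mul h, h.mean_zero,
      h.integral_sq]
    have e : ∫ ω, (ε 0 ω) ^ 4 ∂P = innovationCumulant P ε + 3 * innovationVariance P ε ^ 2 := by
      simp [innovationCumulant]
    rw [e]
    ring

/-- The case f = g of the mixed moment, with ∑ f⁴ ≤ (∑ f²)². The constant does not depend on the
form, so fourth moments of linear forms are controlled by their variances. -/
theorem integral_linSum_pow_four_le [IsProbabilityMeasure P] (h : IsInnovation P ε) (f : ℤ → ℝ)
    (F : Finset ℤ) :
    ∫ ω, linSum ε f F ω ^ 4 ∂P ≤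
      (3 * innovationVariance P ε ^ 2 + |innovationCumulant P ε|) * (∑ i ∈ F, f i ^ 2) ^ 2 := by
  have e : ∫ ω, linSum ε f F ω ^ 4 ∂P = ∫ ω, linSum ε f F ω ^ 2 * linSum ε f F ω ^ 2 ∂P := by
    congr 1; ext ω; ring
  rw [e, integral_linSum_sq_mul_sq h]
  have h1 : ∑ i ∈ F, f i ^ 2 * f i ^ 2 ≤ (∑ i ∈ F, f i ^ 2) ^ 2 := by
    rw [sq (∑ i ∈ F, f i ^ 2), Finset.sum_mul]
    refine Finset.sum_le_sum fun i hi => ?_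
    exact mul_le_mul_of_nonneg_left (Finset.single_le_sum (f := fun i => f i ^ 2)
      (fun i _ => sq_nonneg _) hi) (sq_nonneg _)
  have h0 : 0 ≤ ∑ i ∈ F, f i ^ 2 * f i ^ 2 := Finset.sum_nonneg fun i _ => by positivity
  have h2 : innovationCumulant P ε * ∑ i ∈ F, f i ^ 2 * f i ^ 2 ≤
      |innovationCumulant P ε| * (∑ i ∈ F, f i ^ 2) ^ 2 :=
    (mul_le_mul_of_nonneg_right (le_abs_self _) h0).trans
      (mul_le_mul_of_nonneg_left h1 (abs_nonneg _))
  have h3 : ∑ i ∈ F, f i * f i = ∑ i ∈ F, f i ^ 2 := by simp [sq]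
  rw [h3]
  linarith [h2]

end LongMemory

namespace LongMemory

/-! ### Infinite linear forms in the innovations -/

theorem eLpNorm_two_eq {Ω : Type*} [MeasurableSpace Ω] {P : Measure Ω} {W : Ω → ℝ}
    (hW : MemLp W 2 P) : eLpNorm W 2 P = ENNReal.ofReal (√(∫ ω, W ω ^ 2 ∂P)) := by
  rw [hW.eLpNorm_eq_integral_rpow_norm (by norm_num) (by norm_num), Real.sqrt_eq_rpow]
  simp

theorem eLpNorm_four_eq {Ω : Type*} [MeasurableSpace Ω] {P : Measure Ω} {W : Ω → ℝ}
    (hW : MemLp W 4 P) : eLpNorm W 4 P = ENNReal.ofReal ((∫ ω, W ω ^ 4 ∂P) ^ (1 / 4 : ℝ)) := by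
  rw [hW.eLpNorm_eq_integral_rpow_norm (by norm_num) (by norm_num)]
  have : ∀ x : ℝ, |x| ^ (4 : ℕ) = x ^ 4 := fun x => by
    rw [show (4 : ℕ) = 2 * 2 by norm_num, pow_mul, sq_abs, ← pow_mul]
  norm_num [this]

/-- The Hilbert space of square summable real families indexed by `ℤ`. -/
abbrev L2Z : Type := lp (fun _ : ℤ => ℝ) 2

theorem L2Z.hasSum_sq (x : L2Z) : HasSum (fun i => x i ^ 2) (‖x‖ ^ 2) := by
  simpa using lp.hasSum_norm (p := 2) (by norm_num) x

theorem L2Z.exists_eq {f : ℤ → ℝ} (hf : Summable fun i => f i ^ 2) : ∃ x : L2Z, ⇑x = f :=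
  ⟨⟨f, memℓp_gen (by simpa using hf)⟩, rfl⟩

variable {Ω : Type*} [MeasurableSpace Ω] {P : Measure Ω} {ε : ℤ → Ω → ℝ}

/-- `W` is the `L²` limit `∑_{i ∈ ℤ} f_i ε_i`. -/
def IsLin (P : Measure Ω) (ε : ℤ → Ω → ℝ) (f : ℤ → ℝ) (W : Ω → ℝ) : Prop :=
  MemLp W 2 P ∧
    Tendsto (fun F : Finset ℤ => eLpNorm (fun ω => W ω - linSum ε f F ω) 2 P) atTop (𝓝 0)

theorem eLpNorm_linSum [IsProbabilityMeasure P] (h : IsInnovation P ε) (f : ℤ → ℝ)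
    (F : Finset ℤ) : eLpNorm (linSum ε f F) 2 P =
      ENNReal.ofReal (√(innovationVariance P ε * ∑ i ∈ F, f i ^ 2)) := by
  rw [eLpNorm_two_eq (linSum_memLp_two h f F), integral_linSum_sq h]

namespace IsLin

theorem add {f g : ℤ → ℝ} {V W : Ω → ℝ} [IsProbabilityMeasure P] (h : IsInnovation P ε)
    (hV : IsLin P ε f V) (hW : IsLin P ε g W) :
    IsLin P ε (fun i => f i + g i) (fun ω => V ω + W ω) := by
  refine ⟨hV.1.add hW.1, ?_⟩
  have := hV.2.add hW.2
  rw [add_zero] at this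
  refine tendsto_of_tendsto_of_tendsto_of_le_of_le tendsto_const_nhds this
    (fun _ => zero_le) fun F => ?_
  have e : (fun ω => V ω + W ω - linSum ε (fun i => f i + g i) F ω) =
      (fun ω => V ω - linSum ε f F ω) + fun ω => W ω - linSum ε g F ω := by
    ext ω
    simp only [linSum, Pi.add_apply, add_mul, Finset.sum_add_distrib]
    ring
  rw [e]
  exact eLpNorm_add_le (hV.1.sub (linSum_memLp_two h f F)).1 (hW.1.sub (linSum_memLp_two h g F)).1
    one_le_two

theorem const_mul {f : ℤ → ℝ} {W : Ω → ℝ} (c : ℝ) (hW : IsLin P ε f W) :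
    IsLin P ε (fun i => c * f i) (fun ω => c * W ω) := by
  refine ⟨hW.1.const_mul c, ?_⟩
  have e : ∀ F : Finset ℤ, eLpNorm (fun ω => c * W ω - linSum ε (fun i => c * f i) F ω) 2 P =
      ‖c‖ₑ * eLpNorm (fun ω => W ω - linSum ε f F ω) 2 P := by
    intro F
    rw [← eLpNorm_const_smul]
    congr 1
    ext ω
    simp only [linSum, Pi.smul_apply, smul_eq_mul, mul_sub, Finset.mul_sum, mul_assoc]
  simp_rw [e]
  have := ENNReal.Tendsto.const_mul (a := ‖c‖ₑ) hW.2 (Or.inr (by simp))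
  simpa using this

theorem sub {f g : ℤ → ℝ} {V W : Ω → ℝ} [IsProbabilityMeasure P] (h : IsInnovation P ε)
    (hV : IsLin P ε f V) (hW : IsLin P ε g W) :
    IsLin P ε (fun i => f i - g i) (fun ω => V ω - W ω) := by
  have := hV.add h (hW.const_mul (-1))
  simpa [sub_eq_add_neg] using this

theorem finsetSum {ι : Type*} {f : ι → ℤ → ℝ} {W : ι → Ω → ℝ} [IsProbabilityMeasure P]
    (h : IsInnovation P ε) (s : Finset ι) (hW : ∀ k ∈ s, IsLin P ε (f k) (W k)) :
    IsLin P ε (fun i => ∑ k ∈ s, f k i) (fun ω => ∑ k ∈ s, W k ω) := by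
  classical
  induction s using Finset.induction_on with
  | empty => simp [IsLin, linSum]
  | insert a s ha ih =>
    have := (hW a (by simp)).add h (ih fun k hk => hW k (Finset.mem_insert_of_mem hk))
    simpa [Finset.sum_insert ha] using this

theorem of_finset [IsProbabilityMeasure P] (h : IsInnovation P ε) {f : ℤ → ℝ} {F : Finset ℤ}
    (hf : ∀ i ∉ F, f i = 0) : IsLin P ε f (linSum ε f F) := by
  refine ⟨linSum_memLp_two h f F, tendsto_const_nhds.congr' ?_⟩
  filter_upwards [eventually_ge_atTop F] with G hG
  have : ∀ ω, linSum ε f F ω - linSum ε f G ω = 0 := by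
    intro ω
    rw [sub_eq_zero]
    exact Finset.sum_subset hG fun i _ hi => by simp [hf i hi]
  simp [this]

theorem tendsto_integral_sq [IsProbabilityMeasure P] (h : IsInnovation P ε) {f : ℤ → ℝ}
    {W : Ω → ℝ} (hW : IsLin P ε f W) :
    Tendsto (fun F : Finset ℤ => ∫ ω, linSum ε f F ω ^ 2 ∂P) atTop (𝓝 (∫ ω, W ω ^ 2 ∂P)) := by
  have h1 : Tendsto (fun F : Finset ℤ => (linSum_memLp_two h f F).toLp) atTop
      (𝓝 hW.1.toLp) := by
    rw [Lp.tendsto_Lp_iff_tendsto_eLpNorm'']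
    refine hW.2.congr fun F => ?_
    rw [← eLpNorm_neg]
    congr 1
    ext ω
    simp
  have h2 := h1.norm.pow 2
  have e : ∀ {V : Ω → ℝ} (hV : MemLp V 2 P), ‖hV.toLp‖ ^ 2 = ∫ ω, V ω ^ 2 ∂P := by
    intro V hV
    rw [Lp.norm_toLp, eLpNorm_two_eq hV, ENNReal.toReal_ofReal (Real.sqrt_nonneg _), Real.sq_sqrt]
    exact integral_nonneg fun ω => sq_nonneg _
  simpa only [e] using h2

/-- Square summability is not assumed: convergence of the second moments of the finite forms forces
it. -/
theorem hasSum_sq [IsProbabilityMeasure P] (h : IsInnovation P ε) {f : ℤ → ℝ} {W : Ω → ℝ}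
    (hW : IsLin P ε f W) :
    HasSum (fun i => f i ^ 2) ((∫ ω, W ω ^ 2 ∂P) / innovationVariance P ε) := by
  have h0 : innovationVariance P ε ≠ 0 := h.variance_pos.ne'
  have := (hW.tendsto_integral_sq h).div_const (innovationVariance P ε)
  simp only [integral_linSum_sq h] at this
  refine this.congr fun F => ?_
  field_simp

theorem integral_sq_eq [IsProbabilityMeasure P] (h : IsInnovation P ε) {x : L2Z} {W : Ω → ℝ}
    (hW : IsLin P ε x W) : ∫ ω, W ω ^ 2 ∂P = innovationVariance P ε * ‖x‖ ^ 2 := by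
  have h0 : innovationVariance P ε ≠ 0 := h.variance_pos.ne'
  have := (hW.hasSum_sq h).unique x.hasSum_sq
  field_simp at this
  exact this

theorem eLpNorm_eq [IsProbabilityMeasure P] (h : IsInnovation P ε) {x : L2Z} {W : Ω → ℝ}
    (hW : IsLin P ε x W) : eLpNorm W 2 P = ENNReal.ofReal (√(innovationVariance P ε) * ‖x‖) := by
  rw [eLpNorm_two_eq hW.1, hW.integral_sq_eq h, Real.sqrt_mul (x := innovationVariance P ε) h.variance_pos.le,
    Real.sqrt_sq (norm_nonneg _)]

/-- A linear process is given by an infinite linear form. -/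
theorem of_isLinearAt [IsProbabilityMeasure P] (h : IsInnovation P ε) {a : ℕ → ℝ} {t : ℤ}
    {Y : Ω → ℝ} (hY : IsLinearAt P a ε t Y) (hm : Measurable Y) (ha : Summable fun j => a j ^ 2) :
    IsLin P ε (fun i => if i ≤ t then a (t - i).toNat else 0) Y := by
  set f : ℤ → ℝ := fun i => if i ≤ t then a (t - i).toNat else 0 with hf
  let em : ℕ ↪ ℤ := ⟨fun j => t - j, fun x y hxy => by simpa using hxy⟩
  have hem : ∀ j : ℕ, em j = t - j := fun _ => rfl
  have hfem : ∀ j : ℕ, f (em j) = a j := fun j => by simp [hf, hem]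
  have hf0 : ∀ i ∉ Set.range em, f i = 0 := by
    intro i hi
    simp only [hf]
    rw [if_neg]
    intro hit
    exact hi ⟨(t - i).toNat, by rw [hem]; omega⟩
  have hsum : Summable fun i => f i ^ 2 := by
    rw [← em.injective.summable_iff (fun i hi => by simp [hf0 i hi])]
    simpa [Function.comp_def, hfem] using ha
  let FN : ℕ → Finset ℤ := fun N => (Finset.range N).map em
  have hFN : ∀ N ω, linSum ε f (FN N) ω = ∑ j ∈ Finset.range N, a j * ε (t - (j : ℤ)) ω := by
    intro N ω
    simp only [linSum, FN, Finset.sum_map, hfem]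
    rfl
  have hY' : Tendsto (fun N : ℕ => eLpNorm (fun ω => Y ω - linSum ε f (FN N) ω) 2 P) atTop
      (𝓝 0) := by
    simp only [hFN]
    exact hY
  have hmem : MemLp Y 2 P := by
    obtain ⟨N, hN⟩ := (hY'.eventually_lt_const ENNReal.zero_lt_top).exists
    have h1 : MemLp (fun ω => Y ω - linSum ε f (FN N) ω) 2 P :=
      ⟨(hm.sub (linSum_measurable h f _)).aestronglyMeasurable, hN⟩
    have := h1.add (linSum_memLp_two h f (FN N))
    refine this.ae_eq (ae_of_all _ fun ω => ?_)
    simp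
  refine ⟨hmem, ENNReal.tendsto_nhds_zero.2 fun δ hδ => ?_⟩
  obtain ⟨δ', hδ'0, hδ'⟩ : ∃ r : ℝ, 0 < r ∧ ENNReal.ofReal r ≤ δ / 2 := by
    have : 0 < δ / 2 := ENNReal.half_pos hδ.ne'
    obtain ⟨r, hr0, hr⟩ := ENNReal.lt_iff_exists_nnreal_btwn.1 this
    exact ⟨r, by simpa using hr0, by simpa using hr.le⟩
  have hσ := h.variance_pos
  obtain ⟨s, hs⟩ := summable_iff_vanishing_norm.1 hsum (δ' ^ 2 / innovationVariance P ε)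
    (by have : 0 < innovationVariance P ε := hσ
        positivity)
  -- The defining series converges along initial segments, whereas `IsLin` asks for the net of all
  -- finite sets. The finite set `s` captures the tail of the squares, and its indices up to time t
  -- are eventually among the summed ones.
  have hev : ∀ᶠ N in atTop, s ∩ (s.filter fun i => i ≤ t) ⊆ FN N := by
    filter_upwards [eventually_ge_atTop ((s.sup fun i => (t - i).toNat) + 1)] with N hN i hi
    simp only [Finset.mem_inter, Finset.mem_filter] at hi
    have := Finset.le_sup (f := fun i : ℤ => (t - i).toNat) hi.1
    simp only [FN, Finset.mem_map, Finset.mem_range]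
    refine ⟨(t - i).toNat, by omega, ?_⟩
    rw [hem]
    omega
  obtain ⟨N, hN1, hN2⟩ := ((hY'.eventually_le_const (ENNReal.half_pos hδ.ne')).and hev).exists
  filter_upwards [eventually_ge_atTop (FN N)] with F hF
  have e : (fun ω => Y ω - linSum ε f F ω) =
      (fun ω => Y ω - linSum ε f (FN N) ω) - linSum ε f (F \ FN N) := by
    ext ω
    have : linSum ε f F ω = linSum ε f (F \ FN N) ω + linSum ε f (FN N) ω :=
      (Finset.sum_sdiff hF).symm
    simp only [Pi.sub_apply]
    linarith
  rw [e]
  refine (eLpNorm_sub_le (hmem.sub (linSum_memLp_two h f _)).1 (linSum_memLp_two h f _).1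
    one_le_two).trans ?_
  rw [← ENNReal.add_halves δ]
  refine add_le_add hN1 (le_trans ?_ hδ')
  rw [eLpNorm_linSum h]
  refine ENNReal.ofReal_le_ofReal ?_
  -- Indices of `s` that are not in the segment lie after time t, where the coefficient is zero.
  have h1 : ∑ i ∈ F \ FN N, f i ^ 2 = ∑ i ∈ (F \ FN N) \ s, f i ^ 2 := by
    symm
    refine Finset.sum_subset Finset.sdiff_subset fun i hi hi' => ?_
    simp only [Finset.mem_sdiff] at hi hi'
    have hit : ¬ i ≤ t := fun hit =>
      hi.2 (hN2 (by simp only [Finset.mem_inter, Finset.mem_filter]; tauto))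
    simp [hf, hit]
  rw [h1]
  have h2 := hs _ (Finset.sdiff_disjoint (s := s) (t := F \ FN N))
  rw [Real.norm_eq_abs] at h2
  have h3 := (le_abs_self _).trans h2.le
  have hσ' : 0 < innovationVariance P ε := hσ
  rw [le_div_iff₀ hσ'] at h3
  exact Real.sqrt_le_iff.2 ⟨hδ'0.le, by linarith⟩

/-- The uniform fourth moment bound survives the L² limit by Fatou's lemma along an almost
everywhere convergent subsequence. In particular every infinite form is in L⁴. -/
theorem eLpNorm_four_le [IsProbabilityMeasure P] (h : IsInnovation P ε) :
    ∃ K : ℝ, 0 ≤ K ∧ ∀ (x : L2Z) (W : Ω → ℝ), IsLin P ε x W →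
      eLpNorm W 4 P ≤ ENNReal.ofReal (K * ‖x‖) := by
  set M := 3 * innovationVariance P ε ^ 2 + |innovationCumulant P ε| with hM
  have hM0 : 0 ≤ M := by positivity
  refine ⟨M ^ (1 / 4 : ℝ), by positivity, fun x W hW => ?_⟩
  let FN : ℕ → Finset ℤ := fun N => Finset.Icc (-(N : ℤ)) N
  have hFN : Tendsto FN atTop atTop := by
    refine tendsto_atTop_finset_of_monotone (fun m n hmn => ?_) fun i => ⟨i.natAbs, ?_⟩
    · exact Finset.Icc_subset_Icc (by omega) (by omega)
    · simp only [FN, Finset.mem_Icc]; omega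
  have h1 := hW.2.comp hFN
  have h2 : TendstoInMeasure P (fun N => linSum ε x (FN N)) atTop W := by
    refine tendstoInMeasure_of_tendsto_eLpNorm (p := 2) (by norm_num)
      (fun N => (linSum_memLp_two h _ _).1) hW.1.1 (h1.congr fun N => ?_)
    rw [← eLpNorm_neg]
    simp only [Function.comp]
    congr 1
    ext ω
    simp
  obtain ⟨ns, -, hns⟩ := h2.exists_seq_tendsto_ae
  refine (Lp.eLpNorm_lim_le_liminf_eLpNorm (p := 4)
    (fun n => (linSum_memLp_two h x (FN (ns n))).1) W hns).trans ?_
  refine liminf_le_of_le (by isBoundedDefault) fun b hb => ?_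
  obtain ⟨n, hn⟩ := hb.exists
  refine hn.trans ?_
  rw [eLpNorm_four_eq (linSum_memLp_four h _ _)]
  refine ENNReal.ofReal_le_ofReal ?_
  have h3 := integral_linSum_pow_four_le h x (FN (ns n))
  have h4 : ∑ i ∈ FN (ns n), x i ^ 2 ≤ ‖x‖ ^ 2 :=
    sum_le_hasSum _ (fun i _ => sq_nonneg _) x.hasSum_sq
  have h5 : (0 : ℝ) ≤ ∑ i ∈ FN (ns n), x i ^ 2 := Finset.sum_nonneg fun i _ => sq_nonneg _
  have h6 : ∫ ω, linSum ε x (FN (ns n)) ω ^ 4 ∂P ≤ M * ‖x‖ ^ 4 := by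
    refine h3.trans (mul_le_mul_of_nonneg_left ?_ hM0)
    calc _ ≤ (‖x‖ ^ 2) ^ 2 := by gcongr
      _ = ‖x‖ ^ 4 := by ring
  have h7 : 0 ≤ ∫ ω, linSum ε x (FN (ns n)) ω ^ 4 ∂P :=
    integral_nonneg fun ω => by positivity
  calc _ ≤ (M * ‖x‖ ^ 4) ^ (1 / 4 : ℝ) := by gcongr
    _ = _ := by
      rw [Real.mul_rpow hM0 (by positivity), ← Real.rpow_natCast, ← Real.rpow_mul (norm_nonneg _)]
      norm_num

end IsLin

end LongMemory

namespace LongMemory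

/-! ### Characteristic functions of linear forms -/

theorem norm_prod_sub_prod_le {ι : Type*} (s : Finset ι) (z w : ι → ℂ)
    (hz : ∀ i ∈ s, ‖z i‖ ≤ 1) (hw : ∀ i ∈ s, ‖w i‖ ≤ 1) :
    ‖∏ i ∈ s, z i - ∏ i ∈ s, w i‖ ≤ ∑ i ∈ s, ‖z i - w i‖ := by
  classical
  induction s using Finset.induction_on with
  | empty => simp
  | insert a s ha ih =>
    rw [Finset.prod_insert ha, Finset.prod_insert ha, Finset.sum_insert ha]
    have ih' := ih (fun i hi => hz i (Finset.mem_insert_of_mem hi))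
      fun i hi => hw i (Finset.mem_insert_of_mem hi)
    have h1 : ‖∏ i ∈ s, z i‖ ≤ 1 := by
      rw [norm_prod]
      exact Finset.prod_le_one (fun _ _ => norm_nonneg _)
        fun i hi => hz i (Finset.mem_insert_of_mem hi)
    have h2 := hw a (Finset.mem_insert_self _ _)
    calc _ = ‖(z a - w a) * ∏ i ∈ s, z i + w a * (∏ i ∈ s, z i - ∏ i ∈ s, w i)‖ := by ring_nf
      _ ≤ ‖z a - w a‖ * ‖∏ i ∈ s, z i‖ + ‖w a‖ * ‖∏ i ∈ s, z i - ∏ i ∈ s, w i‖ := by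
        refine (norm_add_le _ _).trans ?_
        rw [norm_mul, norm_mul]
      _ ≤ ‖z a - w a‖ * 1 + 1 * ‖∏ i ∈ s, z i - ∏ i ∈ s, w i‖ := by gcongr
      _ ≤ _ := by linarith

variable {Ω : Type*} [MeasurableSpace Ω] {P : Measure Ω} {ε : ℤ → Ω → ℝ}

/-- Second order Taylor expansion of the characteristic function, applied after scaling to unit
variance, compared with the first order expansion of the exponential. -/
theorem IsInnovation.charFun_isLittleO [IsProbabilityMeasure P] (h : IsInnovation P ε) :
    (fun x : ℝ => charFun (P.map (ε 0)) x -
      Complex.exp (-(innovationVariance P ε * x ^ 2 / 2 : ℝ))) =o[𝓝 0] fun x : ℝ => x ^ 2 := by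
  set v := innovationVariance P ε with hv
  have hv0 : 0 < v := h.variance_pos
  have hσ : 0 < √v := Real.sqrt_pos.2 hv0
  have m0 := h.measurable 0
  have t := taylor_charFun_two (P := P) (X := fun ω => (√v)⁻¹ * ε 0 ω) (by fun_prop)
    (by rw [integral_const_mul, h.mean_zero, mul_zero]) (by
      have : ∀ ω, ((fun ω => (√v)⁻¹ * ε 0 ω) ^ 2) ω = v⁻¹ * ε 0 ω ^ 2 := by
        intro ω
        simp only [Pi.pow_apply, mul_pow, inv_pow, Real.sq_sqrt hv0.le]
      simp_rw [this]
      rw [integral_const_mul, h.integral_sq, inv_mul_cancel₀ hv0.ne'])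
  have hlim : Tendsto (fun x : ℝ => √v * x) (𝓝 0) (𝓝 0) := by
    have : Continuous fun x : ℝ => √v * x := by fun_prop
    simpa using this.tendsto 0
  have t2 := t.comp_tendsto hlim
  have t3 : (fun x : ℝ => charFun (P.map (ε 0)) x - (1 - (v * x ^ 2 / 2 : ℝ))) =o[𝓝 0]
      fun x : ℝ => x ^ 2 := by
    have : ((fun t : ℝ => t ^ 2) ∘ fun x => √v * x) = fun x => v * x ^ 2 := by
      ext x; simp [mul_pow, Real.sq_sqrt hv0.le]
    rw [this] at t2
    refine ((isLittleO_const_mul_right_iff hv0.ne').1 t2).congr_left fun x => ?_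
    simp only [Function.comp]
    rw [charFun_map_mul_comp m0.aemeasurable, ← mul_assoc, inv_mul_cancel₀ hσ.ne', one_mul]
    congr 2
    rw [← Complex.ofReal_pow, mul_pow, Real.sq_sqrt hv0.le]
    push_cast; ring
  have t4 : (fun x : ℝ => ((1 : ℂ) - (v * x ^ 2 / 2 : ℝ)) - Complex.exp (-(v * x ^ 2 / 2 : ℝ)))
      =o[𝓝 0] fun x : ℝ => x ^ 2 := by
    have d : HasDerivAt (fun y : ℝ => Real.exp (-y)) (-1) 0 := by
      simpa using (hasDerivAt_neg (0 : ℝ)).exp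
    have d1 := d.isLittleO
    have hl2 : Tendsto (fun x : ℝ => v * x ^ 2 / 2) (𝓝 0) (𝓝 0) := by
      have : Continuous fun x : ℝ => v * x ^ 2 / 2 := by fun_prop
      simpa using this.tendsto 0
    have d2 := d1.comp_tendsto hl2
    have d3 : (fun x : ℝ => Real.exp (-(v * x ^ 2 / 2)) - (1 - v * x ^ 2 / 2)) =o[𝓝 0]
        fun x : ℝ => x ^ 2 := by
      have e2 : ((fun x' : ℝ => x' - 0) ∘ fun x => v * x ^ 2 / 2) = fun x => (v / 2) * x ^ 2 := by
        ext x; simp only [Function.comp]; ring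
      rw [e2] at d2
      refine ((isLittleO_const_mul_right_iff (by positivity)).1 d2).congr_left fun x => ?_
      simp
      ring
    rw [← isLittleO_norm_left] at d3 ⊢
    refine d3.congr_left fun x => ?_
    rw [← Complex.ofReal_neg, ← Complex.ofReal_exp, ← Complex.ofReal_one, ← Complex.ofReal_sub,
      ← Complex.ofReal_sub, Complex.norm_real, norm_sub_rev]
  simpa using t3.add t4

theorem charFun_linSum (h : IsInnovation P ε) (f : ℤ → ℝ) (F : Finset ℤ) :
    charFun (P.map (linSum ε f F)) 1 = ∏ i ∈ F, charFun (P.map (ε 0)) (f i) := by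
  have h1 : iIndepFun (fun i ω => f i * ε i ω) P :=
    h.indep.comp (fun i x => f i * x) fun i => by fun_prop
  have h2 := (h1.restrict F).charFun_map_fun_finsetSum_eq_prod (s := F)
    fun i _ => ((h.measurable i).const_mul _).aemeasurable
  unfold linSum
  rw [h2, Finset.prod_apply]
  refine Finset.prod_congr rfl fun i _ => ?_
  rw [charFun_map_mul_comp (h.measurable i).aemeasurable, (h.identDistrib i).map_eq, mul_one]

theorem charFun_map_one_eq {W : Ω → ℝ} (hW : AEMeasurable W P) :
    charFun (P.map W) 1 = ∫ ω, Complex.exp (W ω * Complex.I) ∂P := by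
  rw [charFun_apply_real, integral_map hW (by fun_prop)]
  simp

/-- The function exp(ix) is 1-Lipschitz and the L¹ norm is at most the L² norm. -/
theorem norm_integral_exp_sub_le [IsProbabilityMeasure P] {V W : Ω → ℝ} (hV : MemLp V 2 P)
    (hW : MemLp W 2 P) :
    ENNReal.ofReal ‖(∫ ω, Complex.exp (V ω * Complex.I) ∂P) -
      ∫ ω, Complex.exp (W ω * Complex.I) ∂P‖ ≤ eLpNorm (fun ω => V ω - W ω) 2 P := by
  have hi : ∀ {U : Ω → ℝ}, MemLp U 2 P →
      Integrable (fun ω => Complex.exp (U ω * Complex.I)) P := by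
    intro U hU
    have := hU.1.aemeasurable
    exact Integrable.of_bound (by
      have : AEMeasurable (fun ω => Complex.exp (U ω * Complex.I)) P := by fun_prop
      exact this.aestronglyMeasurable) 1
      (ae_of_all _ fun ω => by rw [Complex.norm_exp_ofReal_mul_I])
  rw [← integral_sub (hi hV) (hi hW), ofReal_norm]
  refine (enorm_integral_le_lintegral_enorm _).trans ?_
  have h1 : eLpNorm (fun ω => V ω - W ω) 1 P ≤ eLpNorm (fun ω => V ω - W ω) 2 P :=
    eLpNorm_le_eLpNorm_of_exponent_le one_le_two (hV.sub hW).1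
  refine le_trans ?_ h1
  rw [eLpNorm_one_eq_lintegral_enorm]
  refine lintegral_mono fun ω => ?_
  rw [← ofReal_norm, ← ofReal_norm]
  refine ENNReal.ofReal_le_ofReal ?_
  have e : Complex.exp (V ω * Complex.I) - Complex.exp (W ω * Complex.I) =
      Complex.exp (W ω * Complex.I) * (Complex.exp (Complex.I * ((V ω - W ω : ℝ) : ℂ)) - 1) := by
    rw [mul_sub, ← Complex.exp_add]
    push_cast
    ring_nf
  rw [e, norm_mul, Complex.norm_exp_ofReal_mul_I, one_mul]
  exact Real.norm_exp_I_mul_ofReal_sub_one_le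

/-- A Lindeberg-type estimate: each factor differs from its Gaussian counterpart by at most η x_i²,
and differences of products of numbers in the unit disc are bounded by sums of differences. The
threshold depends only on η, not on the form or its norm. -/
theorem IsLin.charFun_near_gaussian [IsProbabilityMeasure P] (h : IsInnovation P ε) {η : ℝ}
    (hη : 0 < η) : ∃ ρ : ℝ, 0 < ρ ∧ ∀ (x : L2Z) (W : Ω → ℝ), IsLin P ε x W → (∀ i, |x i| ≤ ρ) →
      ‖(∫ ω, Complex.exp (W ω * Complex.I) ∂P) -
        Complex.exp (-(innovationVariance P ε * ‖x‖ ^ 2 / 2 : ℝ))‖ ≤ η * ‖x‖ ^ 2 := by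
  have h1 := h.charFun_isLittleO.bound hη
  obtain ⟨ρ, hρ, h2⟩ := Metric.eventually_nhds_iff.1 h1
  have hv : 0 < innovationVariance P ε := h.variance_pos
  -- Half the radius, because the neighbourhood is open while the bound on the coefficients is not
  -- strict.
  refine ⟨ρ / 2, by positivity, fun x W hW hx => ?_⟩
  have hfin : ∀ F : Finset ℤ, ‖(∫ ω, Complex.exp (linSum ε x F ω * Complex.I) ∂P) -
      Complex.exp (-(innovationVariance P ε * (∑ i ∈ F, x i ^ 2) / 2 : ℝ))‖ ≤ η * ‖x‖ ^ 2 := by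
    intro F
    rw [← charFun_map_one_eq (linSum_measurable h x F).aemeasurable, charFun_linSum h]
    have e : Complex.exp (-(innovationVariance P ε * (∑ i ∈ F, x i ^ 2) / 2 : ℝ)) =
        ∏ i ∈ F, Complex.exp (-(innovationVariance P ε * x i ^ 2 / 2 : ℝ)) := by
      rw [← Complex.exp_sum]
      congr 1
      push_cast
      rw [Finset.mul_sum, Finset.sum_div, Finset.sum_neg_distrib]
    rw [e]
    have : IsProbabilityMeasure (P.map (ε 0)) :=
      Measure.isProbabilityMeasure_map (h.measurable 0).aemeasurable
    refine (norm_prod_sub_prod_le F _ _ (fun i _ => norm_charFun_le_one _) fun i _ => ?_).trans ?_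
    · rw [← Complex.ofReal_neg, ← Complex.ofReal_exp, Complex.norm_real, Real.norm_eq_abs,
        abs_of_pos (Real.exp_pos _), Real.exp_le_one_iff]
      have : 0 ≤ innovationVariance P ε * x i ^ 2 / 2 := by positivity
      linarith
    · calc _ ≤ ∑ i ∈ F, η * x i ^ 2 := by
            refine Finset.sum_le_sum fun i _ => ?_
            have := h2 (y := x i) (by
              rw [dist_zero_right, Real.norm_eq_abs]
              linarith [hx i])
            simpa using this
        _ = η * ∑ i ∈ F, x i ^ 2 := by rw [Finset.mul_sum]
        _ ≤ _ := by
          gcongr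
          exact sum_le_hasSum _ (fun i _ => sq_nonneg _) x.hasSum_sq
  have l1 : Tendsto (fun F : Finset ℤ => ∫ ω, Complex.exp (linSum ε x F ω * Complex.I) ∂P) atTop
      (𝓝 (∫ ω, Complex.exp (W ω * Complex.I) ∂P)) := by
    rw [tendsto_iff_norm_sub_tendsto_zero]
    have : Tendsto (fun F : Finset ℤ => ENNReal.ofReal
        ‖(∫ ω, Complex.exp (linSum ε x F ω * Complex.I) ∂P) -
          ∫ ω, Complex.exp (W ω * Complex.I) ∂P‖) atTop (𝓝 0) := by
      refine tendsto_of_tendsto_of_tendsto_of_le_of_le tendsto_const_nhds hW.2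
        (fun _ => zero_le) fun F => ?_
      simp only
      rw [norm_sub_rev]
      exact norm_integral_exp_sub_le hW.1 (linSum_memLp_two h x F)
    have := (ENNReal.tendsto_toReal ENNReal.zero_ne_top).comp this
    simpa [Function.comp_def, ENNReal.toReal_ofReal] using this
  have l2 : Tendsto (fun F : Finset ℤ =>
      Complex.exp (-(innovationVariance P ε * (∑ i ∈ F, x i ^ 2) / 2 : ℝ))) atTop
      (𝓝 (Complex.exp (-(innovationVariance P ε * ‖x‖ ^ 2 / 2 : ℝ)))) := by
    have hc : Continuous fun s : ℝ => Complex.exp (-(innovationVariance P ε * s / 2 : ℝ)) := by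
      fun_prop
    exact (hc.tendsto _).comp x.hasSum_sq
  exact le_of_tendsto (l1.sub l2).norm (Eventually.of_forall hfin)

end LongMemory

namespace LongMemory

/-! ### Central limit theorem and asymptotic independence for linear forms -/

section AsymptoticIndependence

variable {Ω E F : Type*} [MeasurableSpace Ω] {P : Measure Ω} [IsProbabilityMeasure P]
  [NormedAddCommGroup E] [NormedSpace ℝ E] [CompleteSpace E] [SecondCountableTopology E]
  [MeasurableSpace E] [BorelSpace E]
  [NormedAddCommGroup F] [NormedSpace ℝ F] [CompleteSpace F] [SecondCountableTopology F]
  [MeasurableSpace F] [BorelSpace F]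

/-- By Prokhorov every subsequence has a further one along which the joint laws converge, and then
so do the marginals and their products. The hypothesis identifies the characteristic functions of
the two limits, so both integrals have the same limit. No convergence in law of either sequence is
needed. -/
theorem asymptoticallyIndep_of_charFunDual {A : ℕ → Ω → E} {B : ℕ → Ω → F}
    (hA : ∀ n, Measurable (A n)) (hB : ∀ n, Measurable (B n))
    (tA : IsTightMeasureSet (Set.range fun n => P.map (A n)))
    (tB : IsTightMeasureSet (Set.range fun n => P.map (B n)))
    (hchar : ∀ L : StrongDual ℝ (E × F), Tendsto (fun n =>
      (∫ ω, Complex.exp (L (A n ω, B n ω) * Complex.I) ∂P) -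
        (∫ ω, Complex.exp (L (A n ω, 0) * Complex.I) ∂P) *
          ∫ ω, Complex.exp (L (0, B n ω) * Complex.I) ∂P) atTop (𝓝 0)) :
    AsymptoticallyIndep P A B := by
  intro h
  have hAB : ∀ n, Measurable fun ω => (A n ω, B n ω) := fun n => (hA n).prodMk (hB n)
  let μ : ℕ → ProbabilityMeasure (E × F) := fun n =>
    ⟨P.map fun ω => (A n ω, B n ω), Measure.isProbabilityMeasure_map (hAB n).aemeasurable⟩
  let μA : ℕ → ProbabilityMeasure E := fun n =>
    ⟨P.map (A n), Measure.isProbabilityMeasure_map (hA n).aemeasurable⟩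
  let μB : ℕ → ProbabilityMeasure F := fun n =>
    ⟨P.map (B n), Measure.isProbabilityMeasure_map (hB n).aemeasurable⟩
  have hfst : ∀ n, (μ n).map measurable_fst.aemeasurable = μA n := by
    intro n
    refine Subtype.ext ?_
    change Measure.map Prod.fst (P.map fun ω => (A n ω, B n ω)) = P.map (A n)
    rw [Measure.map_map measurable_fst (hAB n)]
    rfl
  have hsnd : ∀ n, (μ n).map measurable_snd.aemeasurable = μB n := by
    intro n
    refine Subtype.ext ?_
    change Measure.map Prod.snd (P.map fun ω => (A n ω, B n ω)) = P.map (B n)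
    rw [Measure.map_map measurable_snd (hAB n)]
    rfl
  have tight : IsTightMeasureSet
      {((ν : ProbabilityMeasure (E × F)) : Measure (E × F)) | ν ∈ Set.range μ} := by
    refine IsTightMeasureSet.prodMk (tA.subset ?_) (tB.subset ?_)
    · rintro _ ⟨_, ⟨_, ⟨n, rfl⟩, rfl⟩, rfl⟩
      exact ⟨n, congrArg Subtype.val (hfst n).symm⟩
    · rintro _ ⟨_, ⟨_, ⟨n, rfl⟩, rfl⟩, rfl⟩
      exact ⟨n, congrArg Subtype.val (hsnd n).symm⟩
  have hcomp := isCompact_closure_of_isTightMeasureSet tight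
  refine tendsto_of_subseq_tendsto fun ns hns => ?_
  obtain ⟨ν, -, φ, hφ, hlim⟩ := hcomp.tendsto_subseq
    (fun k => subset_closure (Set.mem_range_self (f := μ) (ns k)))
  have hlA : Tendsto (fun k => μA (ns (φ k))) atTop (𝓝 (ν.map measurable_fst.aemeasurable)) := by
    have := ProbabilityMeasure.tendsto_map_of_tendsto_of_continuous _ _ hlim continuous_fst
    exact this.congr fun k => hfst _
  have hlB : Tendsto (fun k => μB (ns (φ k))) atTop (𝓝 (ν.map measurable_snd.aemeasurable)) := by
    have := ProbabilityMeasure.tendsto_map_of_tendsto_of_continuous _ _ hlim continuous_snd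
    exact this.congr fun k => hsnd _
  set νA : ProbabilityMeasure E := ν.map measurable_fst.aemeasurable
  set νB : ProbabilityMeasure F := ν.map measurable_snd.aemeasurable
  have hlP : Tendsto (fun k => (μA (ns (φ k))).prod (μB (ns (φ k)))) atTop (𝓝 (νA.prod νB)) :=
    (ProbabilityMeasure.continuous_prod.tendsto (νA, νB)).comp (hlA.prodMk_nhds hlB)
  have hns' : Tendsto (fun k => ns (φ k)) atTop atTop := hns.comp hφ.tendsto_atTop
  have hchar' : ∀ {G : Type _} [NormedAddCommGroup G] [NormedSpace ℝ G] [MeasurableSpace G]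
      [BorelSpace G] {κ : ℕ → ProbabilityMeasure G} {κ₀ : ProbabilityMeasure G},
      Tendsto κ atTop (𝓝 κ₀) → ∀ L : StrongDual ℝ G,
      Tendsto (fun k => charFunDual (κ k : Measure G) L) atTop
        (𝓝 (charFunDual (κ₀ : Measure G) L)) := by
    intro G _ _ _ _ κ κ₀ hκ L
    rw [ProbabilityMeasure.tendsto_iff_forall_integral_rclike_tendsto ℂ] at hκ
    exact hκ (BoundedContinuousFunction.ofNormedAddCommGroup
      (fun v => Complex.exp (L v * Complex.I)) (by fun_prop) 1
      fun v => by rw [Complex.norm_exp_ofReal_mul_I])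
  have heq : ν = νA.prod νB := by
    have i1 : IsFiniteMeasure (ν : Measure (E × F)) := by
      have : IsProbabilityMeasure (ν : Measure (E × F)) := ν.2
      infer_instance
    have i2 : IsFiniteMeasure (νA.prod νB : Measure (E × F)) := by
      have : IsProbabilityMeasure (νA.prod νB : Measure (E × F)) := (νA.prod νB).2
      infer_instance
    refine Subtype.ext (@Measure.ext_of_charFunDual _ _ _ _ _ _ _ _ _ i1 i2 (funext fun L => ?_))
    have l1 := hchar' hlim L
    have l2 := hchar' hlP L
    have l3 := (hchar L).comp hns'
    have e : ∀ n, charFunDual (μ n : Measure (E × F)) L -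
        charFunDual ((μA n).prod (μB n) : Measure (E × F)) L =
        (∫ ω, Complex.exp (L (A n ω, B n ω) * Complex.I) ∂P) -
        (∫ ω, Complex.exp (L (A n ω, 0) * Complex.I) ∂P) *
          ∫ ω, Complex.exp (L (0, B n ω) * Complex.I) ∂P := by
      intro n
      rw [ProbabilityMeasure.toMeasure_prod, charFunDual_prod]
      simp only [charFunDual_apply]
      change (∫ v, _ ∂(P.map fun ω => (A n ω, B n ω))) -
        (∫ v, _ ∂(P.map (A n))) * (∫ v, _ ∂(P.map (B n))) = _
      rw [integral_map (hAB n).aemeasurable (by fun_prop),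
        integral_map (hA n).aemeasurable (by fun_prop),
        integral_map (hB n).aemeasurable (by fun_prop)]
      simp
    have l4 := tendsto_nhds_unique (l1.sub l2) (l3.congr fun k => (e (ns (φ k))).symm)
    exact sub_eq_zero.1 l4
  refine ⟨φ, ?_⟩
  rw [ProbabilityMeasure.tendsto_iff_forall_integral_tendsto] at hlim hlP
  have l5 := (hlim h).sub (hlP h)
  rw [← heq, sub_self] at l5
  refine l5.congr fun k => ?_
  congr 1
  · change (∫ v, h v ∂(P.map fun ω => (A _ ω, B _ ω))) = _
    rw [integral_map (hAB _).aemeasurable h.continuous.aestronglyMeasurable]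
  · rw [ProbabilityMeasure.toMeasure_prod]
    change (∫ v, h v ∂((P.map (A _)).prod (P.map (B _)))) = _
    rw [Measure.map_prod_map _ _ (hA _) (hB _),
      integral_map ((hA _).prodMap (hB _)).aemeasurable h.continuous.aestronglyMeasurable]
    rfl

theorem isTightMeasureSet_of_tendstoInDistribution {Ω' : Type*} [MeasurableSpace Ω']
    {Q : Measure Ω'} [IsProbabilityMeasure Q] {W : ℕ → Ω → ℝ} {Z : Ω' → ℝ}
    (h : TendstoInDistribution W atTop Z (fun _ => P) Q) :
    IsTightMeasureSet (Set.range fun n => P.map (W n)) := by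
  have := fun n => Measure.isProbabilityMeasure_map (μ := P) (h.forall_aemeasurable n)
  have := Measure.isProbabilityMeasure_map (μ := Q) h.aemeasurable_limit
  exact isTightMeasureSet_of_tendsto_charFun (f := charFun (Q.map Z)) (by fun_prop)
    (ProbabilityMeasure.tendsto_iff_tendsto_charFun.1 h.tendsto)

/-- Chebyshev's inequality in each coordinate. -/
theorem isTightMeasureSet_of_eLpNorm_le {ι : Type*} [Fintype ι] {Z : ℕ → Ω → ι → ℝ}
    (hZ : ∀ n, Measurable (Z n)) {C : ℝ≥0}
    (hC : ∀ᶠ n in atTop, ∀ j, eLpNorm (fun ω => Z n ω j) 2 P ≤ C) :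
    IsTightMeasureSet (Set.range fun n => P.map (Z n)) := by
  have := fun n => Measure.isProbabilityMeasure_map (μ := P) (hZ n).aemeasurable
  refine isTightMeasureSet_range_of_tendsto_limsup_measure_norm_gt ?_
  have hb : ∀ r : ℝ, 0 < r → limsup (fun n => P.map (Z n) {x | r < ‖x‖}) atTop ≤
      ENNReal.ofReal (Fintype.card ι * ((C : ℝ) ^ 2 / r ^ 2)) := by
    intro r hr
    refine limsup_le_of_le (by isBoundedDefault) ?_
    filter_upwards [hC] with n hn
    rw [Measure.map_apply (hZ n) (measurableSet_lt measurable_const measurable_norm)]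
    calc P (Z n ⁻¹' {x | r < ‖x‖}) ≤ P (⋃ j, {ω | ENNReal.ofReal r ≤ ‖Z n ω j‖ₑ}) := by
          refine measure_mono fun ω hω => ?_
          simp only [Set.mem_preimage, Set.mem_ofPred_eq] at hω
          by_contra hcon
          simp only [Set.mem_iUnion, Set.mem_ofPred_eq, not_exists, not_le] at hcon
          refine absurd hω (not_lt.2 ((pi_norm_le_iff_of_nonneg hr.le).2 fun j => ?_))
          have := hcon j
          rw [← ofReal_norm, ENNReal.ofReal_lt_ofReal_iff hr] at this
          exact this.le
      _ ≤ ∑ j, P {ω | ENNReal.ofReal r ≤ ‖Z n ω j‖ₑ} := measure_iUnion_fintype_le _ _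
      _ ≤ ∑ _j : ι, ENNReal.ofReal ((C : ℝ) ^ 2 / r ^ 2) := by
          refine Finset.sum_le_sum fun j _ => ?_
          have h1 := meas_ge_le_mul_pow_eLpNorm_enorm P (p := 2) (by norm_num) (by norm_num)
            (f := fun ω => Z n ω j) (by
              have := hZ n
              fun_prop) (ε := ENNReal.ofReal r) (by simpa using hr) (by simp)
          refine h1.trans ?_
          rw [ENNReal.toReal_ofNat, ENNReal.rpow_ofNat, ENNReal.rpow_ofNat, div_eq_mul_inv, mul_comm,
            ENNReal.ofReal_mul (by positivity), ENNReal.ofReal_pow (by positivity),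
            ENNReal.ofReal_inv_of_pos (by positivity), ENNReal.ofReal_pow hr.le,
            ENNReal.ofReal_coe_nnreal, ENNReal.inv_pow]
          gcongr
          exact hn j
      _ = _ := by
          rw [Finset.sum_const, Finset.card_univ, nsmul_eq_mul,
            ENNReal.ofReal_mul (by positivity), ENNReal.ofReal_natCast]
  have hlim : Tendsto (fun r : ℝ => ENNReal.ofReal (Fintype.card ι * ((C : ℝ) ^ 2 / r ^ 2))) atTop
      (𝓝 0) := by
    have : Tendsto (fun r : ℝ => Fintype.card ι * ((C : ℝ) ^ 2 / r ^ 2)) atTop (𝓝 0) := by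
      have := (tendsto_const_nhds (x := (C : ℝ) ^ 2)).div_atTop
        (tendsto_pow_atTop (α := ℝ) (n := 2) (by norm_num))
      simpa using this.const_mul (Fintype.card ι : ℝ)
    simpa using ENNReal.tendsto_ofReal this
  refine tendsto_of_tendsto_of_tendsto_of_le_of_le' tendsto_const_nhds hlim
    (Eventually.of_forall fun _ => zero_le) ?_
  filter_upwards [eventually_gt_atTop 0] with r hr using hb r hr

end AsymptoticIndependence

variable {Ω : Type*} [MeasurableSpace Ω] {P : Measure Ω} [IsProbabilityMeasure P] {ε : ℤ → Ω → ℝ}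

/-- The norms need only stay bounded, which is why the conclusion compares with a moving Gaussian;
the Fourier vectors require this form. -/
theorem tendsto_charFun_sub_gaussian (h : IsInnovation P ε) {x : ℕ → L2Z} {W : ℕ → Ω → ℝ}
    {ρ : ℕ → ℝ} {K : ℝ} (hW : ∀ᶠ n in atTop, IsLin P ε (x n) (W n))
    (hK : ∀ᶠ n in atTop, ‖x n‖ ≤ K) (hρ : Tendsto ρ atTop (𝓝 0))
    (hx : ∀ᶠ n in atTop, ∀ i, |x n i| ≤ ρ n) :
    Tendsto (fun n => (∫ ω, Complex.exp (W n ω * Complex.I) ∂P) -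
      Complex.exp (-(innovationVariance P ε * ‖x n‖ ^ 2 / 2 : ℝ))) atTop (𝓝 0) := by
  rw [Metric.tendsto_nhds]
  intro δ hδ
  -- The added 1 keeps the denominator positive when K = 0.
  obtain ⟨r, hr, hr'⟩ := IsLin.charFun_near_gaussian h (η := δ / (2 * (K ^ 2 + 1))) (by positivity)
  filter_upwards [hW, hK, hx, hρ.eventually_le_const hr] with n h1 h2 h3 h4
  rw [dist_zero_right]
  refine (hr' _ _ h1 fun i => (h3 i).trans h4).trans_lt ?_
  have h5 : ‖x n‖ ^ 2 ≤ K ^ 2 := by gcongr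
  calc δ / (2 * (K ^ 2 + 1)) * ‖x n‖ ^ 2 ≤ δ / (2 * (K ^ 2 + 1)) * (K ^ 2 + 1) := by
        gcongr; linarith
    _ = δ / 2 := by field_simp
    _ < δ := by linarith

theorem norm_integral_exp_le_one (W : Ω → ℝ) :
    ‖∫ ω, Complex.exp (W ω * Complex.I) ∂P‖ ≤ 1 := by
  refine (norm_integral_le_of_norm_le_const (C := 1)
    (ae_of_all _ fun ω => by rw [Complex.norm_exp_ofReal_mul_I])).trans ?_
  simp

/-- Dominated convergence, with no independence between the two terms. It removes the contribution
of the initial value X_0. -/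
theorem tendsto_integral_exp_add_sub {W R : ℕ → Ω → ℝ} (hW : ∀ n, Measurable (W n))
    (hR : ∀ n, Measurable (R n)) (hlim : ∀ ω, Tendsto (fun n => R n ω) atTop (𝓝 0)) :
    Tendsto (fun n => (∫ ω, Complex.exp ((W n ω + R n ω : ℝ) * Complex.I) ∂P) -
      ∫ ω, Complex.exp (W n ω * Complex.I) ∂P) atTop (𝓝 0) := by
  have hi : ∀ {U : Ω → ℝ}, Measurable U →
      Integrable (fun ω => Complex.exp (U ω * Complex.I)) P := by
    intro U hU
    exact Integrable.of_bound (by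
      have : Measurable (fun ω => Complex.exp (U ω * Complex.I)) := by fun_prop
      exact this.aestronglyMeasurable) 1
      (ae_of_all _ fun ω => by rw [Complex.norm_exp_ofReal_mul_I])
  have e : ∀ n, (∫ ω, Complex.exp ((W n ω + R n ω : ℝ) * Complex.I) ∂P) -
      ∫ ω, Complex.exp (W n ω * Complex.I) ∂P =
      ∫ ω, (Complex.exp (W n ω * Complex.I) * (Complex.exp (R n ω * Complex.I) - 1)) ∂P := by
    intro n
    rw [← integral_sub (hi (U := fun ω => W n ω + R n ω) ((hW n).add (hR n))) (hi (hW n))]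
    refine integral_congr_ae (ae_of_all _ fun ω => ?_)
    simp only
    rw [mul_sub, ← Complex.exp_add, mul_one]
    push_cast
    ring_nf
  simp_rw [e]
  have := tendsto_integral_of_dominated_convergence (μ := P) (F := fun n ω =>
    Complex.exp (W n ω * Complex.I) * (Complex.exp (R n ω * Complex.I) - 1)) (f := fun _ => 0)
    (fun _ => 2) (fun n => by
      have := hW n; have := hR n
      have : Measurable fun ω =>
        Complex.exp (W n ω * Complex.I) * (Complex.exp (R n ω * Complex.I) - 1) := by fun_prop
      exact this.aestronglyMeasurable) (integrable_const _) (fun n => ae_of_all _ fun ω => by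
      rw [norm_mul, Complex.norm_exp_ofReal_mul_I, one_mul]
      refine (norm_sub_le _ _).trans ?_
      rw [Complex.norm_exp_ofReal_mul_I]
      norm_num) (ae_of_all _ fun ω => by
      rw [tendsto_zero_iff_norm_tendsto_zero]
      simp only [norm_mul, Complex.norm_exp_ofReal_mul_I, one_mul]
      have hc : Continuous fun r : ℝ => ‖Complex.exp (r * Complex.I) - 1‖ := by fun_prop
      simpa [Function.comp_def] using (hc.tendsto 0).comp (hlim ω))
  simpa using this

/-- The Gaussian approximation of the sum has variance proportional to ‖x‖² + ‖y‖² + 2⟨x, y⟩, so it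
splits into a product exactly when the inner product is negligible. All three characteristic
functions are replaced by their Gaussian approximations. -/
theorem tendsto_charFun_add_sub_mul (h : IsInnovation P ε) {x y : ℕ → L2Z} {V W : ℕ → Ω → ℝ}
    {ρ ρ' : ℕ → ℝ} {K K' : ℝ} (hV : ∀ᶠ n in atTop, IsLin P ε (x n) (V n))
    (hW : ∀ᶠ n in atTop, IsLin P ε (y n) (W n))
    (hK : ∀ᶠ n in atTop, ‖x n‖ ≤ K) (hK' : ∀ᶠ n in atTop, ‖y n‖ ≤ K')
    (hρ : Tendsto ρ atTop (𝓝 0)) (hρ' : Tendsto ρ' atTop (𝓝 0))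
    (hx : ∀ᶠ n in atTop, ∀ i, |x n i| ≤ ρ n) (hy : ∀ᶠ n in atTop, ∀ i, |y n i| ≤ ρ' n)
    (hxy : Tendsto (fun n => inner ℝ (x n) (y n)) atTop (𝓝 0)) :
    Tendsto (fun n => (∫ ω, Complex.exp ((V n ω + W n ω : ℝ) * Complex.I) ∂P) -
      (∫ ω, Complex.exp (V n ω * Complex.I) ∂P) * ∫ ω, Complex.exp (W n ω * Complex.I) ∂P)
      atTop (𝓝 0) := by
  set v := innovationVariance P ε
  have c1 := tendsto_charFun_sub_gaussian h hV hK hρ hx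
  have c2 := tendsto_charFun_sub_gaussian h hW hK' hρ' hy
  have c3 := tendsto_charFun_sub_gaussian h (x := fun n => x n + y n)
    (W := fun n ω => V n ω + W n ω) (ρ := fun n => ρ n + ρ' n) (K := K + K')
    (by filter_upwards [hV, hW] with n h1 h2 using h1.add h h2)
    (by filter_upwards [hK, hK'] with n h1 h2 using (norm_add_le _ _).trans (add_le_add h1 h2))
    (by simpa using hρ.add hρ')
    (by filter_upwards [hx, hy] with n h1 h2 i
        exact (abs_add_le _ _).trans (add_le_add (h1 i) (h2 i)))
  have ereal : ∀ s : ℝ, Complex.exp (-(s : ℝ)) = (Real.exp (-s) : ℝ) := by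
    intro s; push_cast; rfl
  have c4 : Tendsto (fun n => Complex.exp (-(v * ‖x n + y n‖ ^ 2 / 2 : ℝ)) -
      Complex.exp (-(v * ‖x n‖ ^ 2 / 2 : ℝ)) * Complex.exp (-(v * ‖y n‖ ^ 2 / 2 : ℝ)))
      atTop (𝓝 0) := by
    have hc : Continuous fun s : ℝ => |Real.exp (-(v * s)) - 1| := by fun_prop
    have l : Tendsto (fun n => |Real.exp (-(v * inner ℝ (x n) (y n))) - 1|) atTop (𝓝 0) := by
      simpa [Function.comp_def] using (hc.tendsto 0).comp hxy
    rw [tendsto_zero_iff_norm_tendsto_zero]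
    refine squeeze_zero (fun _ => norm_nonneg _) (fun n => ?_) l
    rw [ereal, ereal, ereal, ← Complex.ofReal_mul, ← Complex.ofReal_sub, Complex.norm_real,
      Real.norm_eq_abs, ← Real.exp_add]
    have hn := norm_add_sq_real (x n) (y n)
    have e : Real.exp (-(v * ‖x n + y n‖ ^ 2 / 2)) =
        Real.exp (-(v * ‖x n‖ ^ 2 / 2) + -(v * ‖y n‖ ^ 2 / 2)) *
          Real.exp (-(v * inner ℝ (x n) (y n))) := by
      rw [← Real.exp_add, hn]
      congr 1
      ring
    rw [e, ← mul_sub_one, abs_mul, Real.abs_exp]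
    refine mul_le_of_le_one_left (abs_nonneg _) (Real.exp_le_one_iff.2 ?_)
    have hv : 0 ≤ v := h.variance_pos.le
    have h1 : 0 ≤ v * ‖x n‖ ^ 2 / 2 := by positivity
    have h2 : 0 ≤ v * ‖y n‖ ^ 2 / 2 := by positivity
    linarith
  have c5 : Tendsto (fun n => ((∫ ω, Complex.exp (V n ω * Complex.I) ∂P) -
        Complex.exp (-(v * ‖x n‖ ^ 2 / 2 : ℝ))) * ∫ ω, Complex.exp (W n ω * Complex.I) ∂P)
      atTop (𝓝 0) := by
    rw [tendsto_zero_iff_norm_tendsto_zero] at c1 ⊢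
    refine squeeze_zero (fun _ => norm_nonneg _) (fun n => ?_) c1
    rw [norm_mul]
    exact mul_le_of_le_one_right (norm_nonneg _) (norm_integral_exp_le_one _)
  have c6 : Tendsto (fun n => Complex.exp (-(v * ‖x n‖ ^ 2 / 2 : ℝ)) *
      ((∫ ω, Complex.exp (W n ω * Complex.I) ∂P) -
        Complex.exp (-(v * ‖y n‖ ^ 2 / 2 : ℝ)))) atTop (𝓝 0) := by
    rw [tendsto_zero_iff_norm_tendsto_zero] at c2 ⊢
    refine squeeze_zero (fun _ => norm_nonneg _) (fun n => ?_) c2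
    rw [norm_mul]
    refine mul_le_of_le_one_left (norm_nonneg _) ?_
    rw [ereal, Complex.norm_real, Real.norm_eq_abs, Real.abs_exp, Real.exp_le_one_iff]
    have hv : 0 ≤ v := h.variance_pos.le
    have h1 : 0 ≤ v * ‖x n‖ ^ 2 / 2 := by positivity
    linarith
  have := ((c3.add c4).sub c5).sub c6
  simp only [add_zero, sub_zero] at this
  refine this.congr fun n => ?_
  push_cast
  ring

theorem tendstoInDistribution_gaussian (h : IsInnovation P ε) {x : ℕ → L2Z} {W R : ℕ → Ω → ℝ}
    {ρ : ℕ → ℝ} {v : ℝ} (hW : ∀ᶠ n in atTop, IsLin P ε (x n) (W n)) (hm : ∀ n, Measurable (W n))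
    (hv : Tendsto (fun n => ‖x n‖ ^ 2) atTop (𝓝 v)) (hρ : Tendsto ρ atTop (𝓝 0))
    (hx : ∀ᶠ n in atTop, ∀ i, |x n i| ≤ ρ n) (hR : ∀ n, Measurable (R n))
    (hlim : ∀ ω, Tendsto (fun n => R n ω) atTop (𝓝 0)) :
    TendstoInDistribution (fun n ω => W n ω + R n ω) atTop id (fun _ => P)
      (gaussianReal 0 (innovationVariance P ε * v).toNNReal) := by
  have hmWR : ∀ n, Measurable fun ω => W n ω + R n ω := fun n => (hm n).add (hR n)
  refine ⟨fun n => (hmWR n).aemeasurable, aemeasurable_id, ?_⟩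
  refine ProbabilityMeasure.tendsto_iff_tendsto_charFun.2 fun t => ?_
  have hv0 : 0 ≤ v := ge_of_tendsto' hv fun n => sq_nonneg _
  have hσ : 0 ≤ innovationVariance P ε := h.variance_pos.le
  -- The characteristic function at t is that of the scaled vector t • x at 1.
  have c1 := tendsto_charFun_sub_gaussian h (x := fun n => t • x n) (W := fun n ω => t * W n ω)
    (ρ := fun n => |t| * ρ n) (K := |t| * √(v + 1))
    (by filter_upwards [hW] with n hn using hn.const_mul t)
    (by
      filter_upwards [hv.eventually_le_const (lt_add_one v)] with n hn
      rw [norm_smul, Real.norm_eq_abs]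
      gcongr
      exact Real.le_sqrt_of_sq_le hn)
    (by simpa using hρ.const_mul |t|)
    (by
      filter_upwards [hx] with n hn i
      change |t * x n i| ≤ _
      rw [abs_mul]
      exact mul_le_mul_of_nonneg_left (hn i) (abs_nonneg _))
  have c2 := tendsto_integral_exp_add_sub (P := P) (W := fun n ω => t * W n ω)
    (R := fun n ω => t * R n ω) (fun n => (hm n).const_mul _) (fun n => (hR n).const_mul _)
    fun ω => by simpa using (hlim ω).const_mul t
  have hc : Continuous fun s : ℝ => Complex.exp (-(innovationVariance P ε * (t ^ 2 * s) / 2 : ℝ)) := by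
    fun_prop
  have c3 := (hc.tendsto v).comp hv
  have c4 := (c2.add c1).add c3
  simp only [zero_add, add_zero] at c4
  have e0 : charFun ((gaussianReal 0 (innovationVariance P ε * v).toNNReal).map id) t =
      Complex.exp (-(innovationVariance P ε * (t ^ 2 * v) / 2 : ℝ)) := by
    rw [Measure.map_id, charFun_gaussianReal]
    congr 1
    have : (((innovationVariance P ε * v).toNNReal : ℝ) : ℂ) =
        ((innovationVariance P ε * v : ℝ) : ℂ) := by
      rw [Real.coe_toNNReal _ (mul_nonneg hσ hv0)]
    rw [this]
    push_cast
    ring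
  simp only [ProbabilityMeasure.coe_mk]
  rw [e0]
  refine c4.congr fun n => ?_
  simp only [Function.comp]
  rw [charFun_apply_real, integral_map (hmWR n).aemeasurable (by fun_prop)]
  rw [norm_smul, mul_pow, Real.norm_eq_abs, sq_abs, sub_add_sub_cancel, sub_add_cancel]
  congr 1
  ext ω
  push_cast
  ring_nf

end LongMemory

namespace LongMemory

/-! ### Coefficients of integrated processes -/

/-- The coefficients `a_j`, extended by zero to negative indices. -/
noncomputable def coeffZ (a : ℕ → ℝ) (m : ℤ) : ℝ := if 0 ≤ m then a m.toNat else 0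

/-- The partial sums `∑_{j ≤ m} a_j`, extended by zero to negative indices. -/
noncomputable def partialSumZ (a : ℕ → ℝ) (m : ℤ) : ℝ := ∑ j ∈ Finset.range (m + 1).toNat, a j

theorem partialSumZ_of_neg (a : ℕ → ℝ) {m : ℤ} (hm : m < 0) : partialSumZ a m = 0 := by
  have : (m + 1).toNat = 0 := by omega
  simp [partialSumZ, this]

theorem partialSumZ_natCast (a : ℕ → ℝ) (m : ℕ) :
    partialSumZ a m = ∑ j ∈ Finset.range (m + 1), a j := rfl

theorem partialSumZ_sub_pred (a : ℕ → ℝ) (m : ℤ) :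
    partialSumZ a m - partialSumZ a (m - 1) = coeffZ a m := by
  unfold partialSumZ coeffZ
  split_ifs with h
  · have e1 : (m + 1).toNat = m.toNat + 1 := by omega
    have e2 : (m - 1 + 1).toNat = m.toNat := by omega
    rw [e1, e2, Finset.sum_range_succ]; ring
  · have e1 : (m + 1).toNat = 0 := by omega
    have e2 : (m - 1 + 1).toNat = 0 := by omega
    rw [e1, e2]; simp

theorem partialSumZ_add_sub (a : ℕ → ℝ) (m : ℤ) (k : ℕ) :
    partialSumZ a (m + k) - partialSumZ a m = ∑ t ∈ Finset.range k, coeffZ a (m + t + 1) := by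
  induction k with
  | zero => simp
  | succ k ih =>
    rw [Finset.sum_range_succ, ← ih, ← partialSumZ_sub_pred]
    push_cast
    ring_nf

theorem coeffZ_hasSum {a : ℕ → ℝ} {g : ℝ → ℝ} (hg : g 0 = 0) {s : ℝ}
    (ha : HasSum (fun j => g (a j)) s) (t : ℤ) : HasSum (fun i => g (coeffZ a (t - i))) s := by
  have h1 : HasSum (fun i : ℤ => g (coeffZ a i)) s := by
    have hinj : Function.Injective (Nat.cast : ℕ → ℤ) := Nat.cast_injective
    rw [← hinj.hasSum_iff (f := fun i : ℤ => g (coeffZ a i))]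
    · simpa [Function.comp_def, coeffZ] using ha
    · intro i hi
      have : ¬ 0 ≤ i := fun h => hi ⟨i.toNat, by omega⟩
      simp [coeffZ, this, hg]
  have h2 := ((Equiv.subLeft t).hasSum_iff (f := fun i : ℤ => g (coeffZ a i)) (a := s)).2 h1
  simpa only [Function.comp_def, Equiv.subLeft_apply] using h2

/-- The sequence S itself need not be square summable, but its k-step increment is a sum of k
translates of the coefficients, which are. -/
theorem exists_increment {a : ℕ → ℝ} (ha : Summable fun j => a j ^ 2) :
    ∃ s : ℕ → L2Z, ∀ k i, s k i = partialSumZ a (k - i) - partialSumZ a (-i) := by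
  have h1 : ∀ t : ℤ, ∃ x : L2Z, ⇑x = fun i => coeffZ a (t - i) := fun t =>
    L2Z.exists_eq (coeffZ_hasSum (g := fun x => x ^ 2) (by norm_num) ha.hasSum t).summable
  choose x hx using h1
  refine ⟨fun k => ∑ t ∈ Finset.range k, x (t + 1), fun k i => ?_⟩
  rw [lp.coeFn_sum, Finset.sum_apply, show (k : ℤ) - i = -i + k by ring, partialSumZ_add_sub]
  refine Finset.sum_congr rfl fun t _ => ?_
  rw [hx]
  ring_nf

theorem isLin_increment {Ω : Type*} [MeasurableSpace Ω] {P : Measure Ω} [IsProbabilityMeasure P]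
    {ε : ℤ → Ω → ℝ} {X : ℕ → Ω → ℝ} {d c : ℝ} {a : ℕ → ℝ} (hX : IsIntegrated P d c a ε X)
    (ha : Summable fun j => a j ^ 2) (k : ℕ) :
    IsLin P ε (fun i => partialSumZ a (k - i) - partialSumZ a (-i)) (fun ω => X k ω - X 0 ω) := by
  induction k with
  | zero => simp [IsLin, linSum]
  | succ k ih =>
    have h1 := IsLin.of_isLinearAt hX.innovation (hX.diff_linear (k + 1) (by omega))
      ((hX.measurable _).sub (hX.measurable _)) ha
    have h2 := ih.add hX.innovation h1
    convert h2 using 1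
    · ext i
      have := partialSumZ_sub_pred a ((k + 1 : ℕ) - i)
      have e : ((k + 1 : ℕ) : ℤ) - i - 1 = k - i := by push_cast; ring
      rw [e] at this
      unfold coeffZ at this
      simp only [sub_nonneg] at this
      linarith
    · ext ω
      simp

section Increment

variable {a : ℕ → ℝ} {s : ℕ → L2Z}

/-- Stationarity of the increments: s_k - s_l is s_{k-l} translated by l. -/
theorem norm_increment_sub (hs : ∀ k i, s k i = partialSumZ a (k - i) - partialSumZ a (-i))
    {k l : ℕ} (h : l ≤ k) : ‖s k - s l‖ ^ 2 = ‖s (k - l)‖ ^ 2 := by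
  have h1 := (s k - s l).hasSum_sq
  have h2 := (Equiv.subRight (l : ℤ)).hasSum_iff.2 (s (k - l)).hasSum_sq
  refine h1.unique (h2.congr_fun fun i => ?_)
  simp only [Function.comp, Equiv.subRight_apply, lp.coeFn_sub, Pi.sub_apply, hs]
  push_cast [h]
  ring_nf

/-- By polarisation, ⟨s_k, s_l⟩ = (‖s_k‖² + ‖s_l‖² - ‖s_{k-l}‖²)/2 for l ≤ k. When the vector of
index n + 1 is added, the norms of the lower indices cancel against the same norms in reversed
order, leaving n + 1 copies of the new norm. The variance of the mean thus depends only on the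
single norms. -/
theorem norm_sum_increment (hs : ∀ k i, s k i = partialSumZ a (k - i) - partialSumZ a (-i))
    (n : ℕ) : ‖∑ k ∈ Finset.range n, s (k + 1)‖ ^ 2 =
      ∑ k ∈ Finset.range n, ((k : ℝ) + 1) * ‖s (k + 1)‖ ^ 2 := by
  induction n with
  | zero => simp
  | succ n ih =>
    rw [Finset.sum_range_succ, Finset.sum_range_succ, norm_add_sq_real, ih, sum_inner]
    have h1 : ∀ k ∈ Finset.range n, inner ℝ (s (k + 1)) (s (n + 1)) =
        (‖s (k + 1)‖ ^ 2 + ‖s (n + 1)‖ ^ 2 - ‖s (n - 1 - k + 1)‖ ^ 2) / 2 := by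
      intro k hk
      rw [Finset.mem_range] at hk
      have := norm_increment_sub hs (show k + 1 ≤ n + 1 by omega)
      rw [norm_sub_sq_real, real_inner_comm, show n + 1 - (k + 1) = n - 1 - k + 1 by omega] at this
      linarith
    rw [Finset.sum_congr rfl h1, ← Finset.sum_div, Finset.sum_sub_distrib, Finset.sum_add_distrib,
      Finset.sum_range_reflect (fun k => ‖s (k + 1)‖ ^ 2)]
    simp
    ring

end Increment

theorem summable_sq_of_summable_abs {a : ℕ → ℝ} (h : Summable fun j => |a j|) :
    Summable fun j => a j ^ 2 := by
  refine summable_of_isBigO_nat h ?_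
  have h0 : Tendsto a atTop (𝓝 0) := (summable_abs_iff.1 h).tendsto_atTop_zero
  have : (fun j => a j ^ 2) =O[atTop] fun j => 1 * |a j| := by
    have h1 : a =O[atTop] fun _ => (1 : ℝ) := h0.isBigO_one ℝ
    have := h1.mul (isBigO_refl (fun j => |a j|) atTop)
    refine (IsBigO.of_bound 1 (Eventually.of_forall fun j => ?_)).trans this
    simp [sq]
  simpa using this

theorem HasMemory.isBigO {e c : ℝ} {a : ℕ → ℝ} (h : HasMemory e c a) (he : e ≠ 0) :
    a =O[atTop] fun j : ℕ => (j : ℝ) ^ (e - 1) := by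
  rcases h with ⟨h0, -⟩ | ⟨-, -, -, h⟩ | ⟨-, -, -, -, h⟩
  · exact absurd h0 he
  · exact h.isBigO.trans (isBigO_const_mul_self _ _ _)
  · have h1 : (fun j : ℕ => (j : ℝ) ^ (e - 1) * (j : ℝ)⁻¹) =O[atTop]
        fun j : ℕ => (j : ℝ) ^ (e - 1) * 1 :=
      (isBigO_refl (fun j : ℕ => (j : ℝ) ^ (e - 1)) atTop).mul
        ((tendsto_inv_atTop_nhds_zero_nat (𝕜 := ℝ)).isBigO_one ℝ)
    simp only [mul_one] at h1
    have h2 := (h.trans h1).add (isBigO_const_mul_self c (fun j : ℕ => (j : ℝ) ^ (e - 1)) atTop)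
    simpa using h2

theorem HasMemory.tendsto_div {e c : ℝ} {a : ℕ → ℝ} (h : HasMemory e c a) (he : e ≠ 0) :
    Tendsto (fun j : ℕ => a j / (j : ℝ) ^ (e - 1)) atTop (𝓝 c) := by
  have key : (fun j : ℕ => a j - c * (j : ℝ) ^ (e - 1)) =o[atTop]
      fun j : ℕ => (j : ℝ) ^ (e - 1) := by
    rcases h with ⟨h0, -⟩ | ⟨-, -, -, h⟩ | ⟨-, -, -, -, h⟩
    · exact absurd h0 he
    · exact h.isLittleO.trans_isBigO (isBigO_const_mul_self _ _ _)
    · refine h.trans_isLittleO ?_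
      have := (isBigO_refl (fun j : ℕ => (j : ℝ) ^ (e - 1)) atTop).mul_isLittleO
        ((isLittleO_one_iff ℝ).2 (tendsto_inv_atTop_nhds_zero_nat (𝕜 := ℝ)))
      simpa using this
  have h2 := key.tendsto_div_nhds_zero.add_const c
  rw [zero_add] at h2
  refine h2.congr' ?_
  filter_upwards [eventually_gt_atTop 0] with j hj
  have : (0 : ℝ) < (j : ℝ) ^ (e - 1) := Real.rpow_pos_of_pos (by positivity) _
  field_simp
  ring

theorem HasMemory.summable_abs {e c : ℝ} {a : ℕ → ℝ} (h : HasMemory e c a) (he : e ≤ 0) :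
    Summable fun j => |a j| := by
  by_cases h0 : e = 0
  · rcases h with ⟨-, h, -⟩ | ⟨h, -⟩ | ⟨-, h, -⟩
    · exact h
    · linarith
    · linarith
  · refine summable_of_isBigO_nat (g := fun j : ℕ => (j : ℝ) ^ (e - 1)) ?_ (h.isBigO h0).norm_left
    exact Real.summable_nat_rpow.2 (by linarith [lt_of_le_of_ne he h0])

theorem HasMemory.summable_sq {e c : ℝ} {a : ℕ → ℝ} (h : HasMemory e c a) :
    Summable fun j => a j ^ 2 := by
  rcases le_or_gt e 0 with he | he
  · exact summable_sq_of_summable_abs (h.summable_abs he)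
  · have he2 : e < 1 / 2 := by
      rcases h with ⟨h, -⟩ | ⟨-, h, -⟩ | ⟨-, h, -⟩ <;> linarith
    refine summable_of_isBigO_nat (g := fun j : ℕ => ((j : ℝ) ^ (e - 1)) ^ 2) ?_
      ((h.isBigO he.ne').pow 2)
    have : ∀ j : ℕ, ((j : ℝ) ^ (e - 1)) ^ 2 = (j : ℝ) ^ (2 * (e - 1)) := by
      intro j
      rw [← Real.rpow_natCast, ← Real.rpow_mul (by positivity)]
      ring_nf
    simp_rw [this]
    exact Real.summable_nat_rpow.2 (by linarith)

theorem abs_increment_le_of_summable_abs {a : ℕ → ℝ} (h : Summable fun j => |a j|) (m : ℤ)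
    (k : ℕ) : |partialSumZ a (m + k) - partialSumZ a m| ≤ ∑' j, |a j| := by
  rw [partialSumZ_add_sub]
  have h1 := coeffZ_hasSum (g := fun x => |x|) (by simp) h.hasSum 0
  have hinj : Function.Injective fun t : ℕ => -(m + t + 1) := fun x y hxy => by
    have : -(m + (x : ℤ) + 1) = -(m + y + 1) := hxy
    omega
  calc _ ≤ ∑ t ∈ Finset.range k, |coeffZ a (m + t + 1)| := Finset.abs_sum_le_sum_abs _ _
    _ = ∑ i ∈ (Finset.range k).map ⟨_, hinj⟩, |coeffZ a (0 - i)| := by simp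
    _ ≤ _ := sum_le_hasSum _ (fun _ _ => abs_nonneg _) h1

theorem sq_increment_le_of_summable_sq {a : ℕ → ℝ} (h : Summable fun j => a j ^ 2) (m : ℤ)
    (k : ℕ) : (partialSumZ a (m + k) - partialSumZ a m) ^ 2 ≤ k * ∑' j, a j ^ 2 := by
  rw [partialSumZ_add_sub]
  have h1 := coeffZ_hasSum (g := fun x => x ^ 2) (by simp) h.hasSum 0
  have hinj : Function.Injective fun t : ℕ => -(m + t + 1) := fun x y hxy => by
    have : -(m + (x : ℤ) + 1) = -(m + y + 1) := hxy
    omega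
  calc _ ≤ k * ∑ t ∈ Finset.range k, coeffZ a (m + t + 1) ^ 2 := by
        simpa using sq_sum_le_card_mul_sum_sq (s := Finset.range k)
          (f := fun t => coeffZ a (m + t + 1))
    _ = k * ∑ i ∈ (Finset.range k).map ⟨_, hinj⟩, coeffZ a (0 - i) ^ 2 := by simp
    _ ≤ _ := by
      gcongr
      exact sum_le_hasSum _ (fun _ _ => sq_nonneg _) h1

theorem tendsto_meanNorm {d : ℝ} (hd : 1 / 2 ≤ d) : Tendsto (meanNorm d) atTop atTop := by
  unfold meanNorm
  split_ifs with h
  · exact Real.tendsto_sqrt_atTop.comp (Real.tendsto_log_atTop.comp tendsto_natCast_atTop_atTop)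
  · exact (tendsto_rpow_atTop (by linarith [lt_of_le_of_ne hd (Ne.symm h)])).comp
      tendsto_natCast_atTop_atTop

/-- Supplies the uniform smallness of coefficients for the central limit theorem. For d ≤ 1 the
coefficients are absolutely summable and M is constant; for d > 1 Cauchy-Schwarz gives M of order
√n, which is o(n^(d-1/2)). -/
theorem HasMemory.exists_increment_bound {d c : ℝ} {a : ℕ → ℝ} (hd : 1 / 2 ≤ d)
    (h : HasMemory (d - 1) c a) : ∃ M : ℕ → ℝ,
      (∀ (n k : ℕ) (i : ℤ), k ≤ n → |partialSumZ a (k - i) - partialSumZ a (-i)| ≤ M n) ∧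
      Tendsto (fun n => M n / meanNorm d n) atTop (𝓝 0) := by
  rcases le_or_gt (d - 1) 0 with he | he
  · refine ⟨fun _ => ∑' j, |a j|, fun n k i _ => ?_, (tendsto_meanNorm hd).const_div_atTop _⟩
    have := abs_increment_le_of_summable_abs (h.summable_abs he) (-i) k
    rwa [show -i + (k : ℤ) = k - i by ring] at this
  · refine ⟨fun n => √(n * ∑' j, a j ^ 2), fun n k i hk => ?_, ?_⟩
    · have := sq_increment_le_of_summable_sq h.summable_sq (-i) k
      rw [show -i + (k : ℤ) = k - i by ring] at this
      refine Real.abs_le_sqrt (this.trans ?_)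
      have : (0 : ℝ) ≤ ∑' j, a j ^ 2 := tsum_nonneg fun _ => sq_nonneg _
      gcongr
    · have h1 : Tendsto (fun n : ℕ => √(∑' j, a j ^ 2) * (n : ℝ) ^ (-(d - 1))) atTop
          (𝓝 (√(∑' j, a j ^ 2) * 0)) :=
        ((tendsto_rpow_neg_atTop he).comp tendsto_natCast_atTop_atTop).const_mul _
      rw [mul_zero] at h1
      refine h1.congr' ?_
      filter_upwards [eventually_gt_atTop 0] with n hn
      have hn' : (0 : ℝ) < n := by exact_mod_cast hn
      rw [meanNorm, if_neg (by linarith), Real.sqrt_mul hn'.le, Real.sqrt_eq_rpow (n : ℝ), mul_comm,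
        mul_div_right_comm, ← Real.rpow_sub hn']
      ring_nf

end LongMemory

namespace LongMemory

/-! ### Asymptotics of sums -/

/-- Stolz-Cesàro, with the increments of g known only up to asymptotic equivalence with l h. -/
theorem tendsto_sum_div_of_increment {f g h : ℕ → ℝ} {κ l : ℝ} (hg : Monotone g)
    (hlim : Tendsto g atTop atTop) (hh : ∀ᶠ n in atTop, 0 < h n)
    (hgh : Tendsto (fun n => (g (n + 1) - g n) / h n) atTop (𝓝 l)) (hl : l ≠ 0)
    (hf : Tendsto (fun n => f n / h n) atTop (𝓝 κ)) :
    Tendsto (fun n => (∑ j ∈ Finset.range n, f j) / g n) atTop (𝓝 (κ / l)) := by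
  have h1 : (fun n => f n - κ / l * (g (n + 1) - g n)) =o[atTop] fun n => g (n + 1) - g n := by
    have l1 : Tendsto (fun n => f n / h n - κ / l * ((g (n + 1) - g n) / h n)) atTop (𝓝 0) := by
      have := hf.sub (hgh.const_mul (κ / l))
      rwa [div_mul_cancel₀ _ hl, sub_self] at this
    have l2 := l1.div hgh hl
    rw [zero_div] at l2
    have hne : ∀ᶠ n in atTop, (g (n + 1) - g n) / h n ≠ 0 := hgh.eventually_ne hl
    refine (isLittleO_iff_tendsto' ?_).2 (l2.congr' ?_)
    · filter_upwards [hne] with n hn h0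
      simp [h0] at hn
    · filter_upwards [hh, hne] with n hn hn'
      have : g (n + 1) - g n ≠ 0 := fun h0 => by simp [h0] at hn'
      simp only [Pi.div_apply]
      field_simp
  have h2 : Tendsto (fun n => ∑ j ∈ Finset.range n, (g (j + 1) - g j)) atTop atTop := by
    simp_rw [Finset.sum_range_sub]
    exact tendsto_atTop_add_const_right _ _ hlim
  have h3 := h1.sum_range (fun n => sub_nonneg.2 (hg n.le_succ)) h2
  simp only [Finset.sum_range_sub] at h3
  simp_rw [Finset.sum_sub_distrib (f := f), ← Finset.mul_sum, Finset.sum_range_sub] at h3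
  have h4 : (fun n => g n - g 0) =O[atTop] g := by
    have : (fun _ : ℕ => g 0) =O[atTop] g :=
      (isLittleO_const_left.2 (Or.inr (tendsto_norm_atTop_atTop.comp hlim))).isBigO
    exact (isBigO_refl _ _).sub this
  have h5 := (h3.trans_isBigO h4).tendsto_div_nhds_zero
  have h6 : Tendsto (fun n => κ / l * (1 - g 0 / g n)) atTop (𝓝 (κ / l * (1 - 0))) :=
    ((tendsto_const_nhds (x := (1 : ℝ))).sub (hlim.const_div_atTop (g 0))).const_mul (κ / l)
  have h7 := h5.add h6
  simp only [zero_add, sub_zero, mul_one] at h7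
  refine h7.congr' ?_
  filter_upwards [hlim.eventually_gt_atTop 0] with n hn
  field_simp
  ring

theorem tendsto_rpow_increment (q : ℝ) :
    Tendsto (fun n : ℕ => (((n + 1 : ℕ) : ℝ) ^ q - (n : ℝ) ^ q) / (n : ℝ) ^ (q - 1)) atTop
      (𝓝 q) := by
  have d : HasDerivAt (fun x : ℝ => (1 + x) ^ q) q 0 := by
    have h0 : HasDerivAt (fun x : ℝ => 1 + x) 1 0 := (hasDerivAt_id 0).const_add 1
    simpa using h0.rpow_const (p := q) (Or.inl (by norm_num))
  have h1 := (hasDerivAt_iff_tendsto_slope_zero.1 d)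
  have h2 : Tendsto (fun n : ℕ => (n : ℝ)⁻¹) atTop (𝓝[≠] 0) := by
    refine tendsto_nhdsWithin_iff.2 ⟨tendsto_inv_atTop_nhds_zero_nat, ?_⟩
    filter_upwards [eventually_gt_atTop 0] with n hn
    simp [hn.ne']
  refine (h1.comp h2).congr' ?_
  filter_upwards [eventually_gt_atTop 0] with n hn
  have hn' : (0 : ℝ) < n := by exact_mod_cast hn
  simp only [Function.comp, zero_add, inv_inv, add_zero, Real.one_rpow, smul_eq_mul]
  have e1 : ((n + 1 : ℕ) : ℝ) ^ q = (n : ℝ) ^ q * (1 + (n : ℝ)⁻¹) ^ q := by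
    rw [← Real.mul_rpow hn'.le (by positivity)]
    push_cast
    congr 1
    field_simp
  have : (0 : ℝ) < (n : ℝ) ^ q := Real.rpow_pos_of_pos hn' _
  rw [e1, Real.rpow_sub_one hn'.ne']
  field_simp

theorem tendsto_log_increment :
    Tendsto (fun n : ℕ => (Real.log (n + 1 : ℕ) - Real.log n) / (n : ℝ)⁻¹) atTop (𝓝 1) := by
  have d : HasDerivAt (fun x : ℝ => Real.log (1 + x)) 1 0 := by
    have h0 : HasDerivAt (fun x : ℝ => 1 + x) 1 0 := (hasDerivAt_id 0).const_add 1
    simpa using h0.log (by norm_num)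
  have h1 := (hasDerivAt_iff_tendsto_slope_zero.1 d)
  have h2 : Tendsto (fun n : ℕ => (n : ℝ)⁻¹) atTop (𝓝[≠] 0) := by
    refine tendsto_nhdsWithin_iff.2 ⟨tendsto_inv_atTop_nhds_zero_nat, ?_⟩
    filter_upwards [eventually_gt_atTop 0] with n hn
    simp [hn.ne']
  refine (h1.comp h2).congr' ?_
  filter_upwards [eventually_gt_atTop 0] with n hn
  have hn' : (0 : ℝ) < n := by exact_mod_cast hn
  simp only [Function.comp, zero_add, inv_inv, add_zero, Real.log_one, sub_zero, smul_eq_mul]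
  rw [← Real.log_div (by positivity) hn'.ne', div_inv_eq_mul, mul_comm]
  congr 2
  push_cast
  field_simp

theorem tendsto_natCast_add_div_rpow (l : ℕ) (q : ℝ) :
    Tendsto (fun n : ℕ => ((n + l : ℕ) : ℝ) ^ q / (n : ℝ) ^ q) atTop (𝓝 1) := by
  have h1 : Tendsto (fun n : ℕ => 1 + (l : ℝ) * (n : ℝ)⁻¹) atTop (𝓝 1) := by
    simpa using (tendsto_inv_atTop_nhds_zero_nat (𝕜 := ℝ)).const_mul (l : ℝ) |>.const_add 1
  have h2 := h1.rpow_const (p := q) (Or.inl one_ne_zero)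
  rw [Real.one_rpow] at h2
  refine h2.congr' ?_
  filter_upwards [eventually_gt_atTop 0] with n hn
  have hn' : (0 : ℝ) < n := by exact_mod_cast hn
  rw [← Real.div_rpow (by positivity) hn'.le]
  congr 1
  push_cast
  field_simp

theorem tendsto_sum_div_rpow {f : ℕ → ℝ} {κ q : ℝ} (hq : 0 < q)
    (hf : Tendsto (fun n : ℕ => f n / (n : ℝ) ^ (q - 1)) atTop (𝓝 κ)) :
    Tendsto (fun n : ℕ => (∑ j ∈ Finset.range n, f j) / (n : ℝ) ^ q) atTop (𝓝 (κ / q)) := by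
  refine tendsto_sum_div_of_increment (g := fun n : ℕ => (n : ℝ) ^ q)
    (h := fun n : ℕ => (n : ℝ) ^ (q - 1)) (fun m n hmn => ?_)
    ((tendsto_rpow_atTop hq).comp tendsto_natCast_atTop_atTop) ?_ (tendsto_rpow_increment q)
    hq.ne' hf
  · exact Real.rpow_le_rpow (by positivity) (by exact_mod_cast hmn) hq.le
  · filter_upwards [eventually_gt_atTop 0] with n hn
    exact Real.rpow_pos_of_pos (by exact_mod_cast hn) _

theorem tendsto_sum_div_log {f : ℕ → ℝ} {κ : ℝ}
    (hf : Tendsto (fun n : ℕ => f n / (n : ℝ)⁻¹) atTop (𝓝 κ)) :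
    Tendsto (fun n : ℕ => (∑ j ∈ Finset.range n, f j) / Real.log n) atTop (𝓝 κ) := by
  have := tendsto_sum_div_of_increment (g := fun n : ℕ => Real.log n)
    (h := fun n : ℕ => (n : ℝ)⁻¹) (fun m n hmn => ?_)
    (Real.tendsto_log_atTop.comp tendsto_natCast_atTop_atTop) ?_ tendsto_log_increment
    one_ne_zero hf
  · simpa using this
  · rcases Nat.eq_zero_or_pos m with rfl | hm
    · simpa using Real.log_natCast_nonneg n
    · exact Real.log_le_log (by exact_mod_cast hm) (by exact_mod_cast hmn)
  · filter_upwards [eventually_gt_atTop 0] with n hn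
    have : (0 : ℝ) < n := by exact_mod_cast hn
    positivity

/-- The counterpart for tails: f is compared with the telescoping terms n^q - (n+1)^q, whose tails
are exactly n^q. -/
theorem tendsto_tail_div_rpow {f : ℕ → ℝ} {κ q : ℝ} (hq : q < 0) (hs : Summable f)
    (hf : Tendsto (fun n : ℕ => f n / (n : ℝ) ^ (q - 1)) atTop (𝓝 κ)) :
    Tendsto (fun n : ℕ => (∑' j, f (j + n)) / (n : ℝ) ^ q) atTop (𝓝 (-(κ / q))) := by
  set D : ℕ → ℝ := fun n => (n : ℝ) ^ q - ((n + 1 : ℕ) : ℝ) ^ q with hD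
  have hDpos : ∀ n : ℕ, 0 < n → 0 < D n := by
    intro n hn
    rw [hD]
    simp only [sub_pos]
    exact Real.rpow_lt_rpow_of_neg (by exact_mod_cast hn) (by push_cast; linarith) hq
  have hD0 : Tendsto (fun n : ℕ => (n : ℝ) ^ q) atTop (𝓝 0) := by
    have := (tendsto_rpow_neg_atTop (y := -q) (by linarith)).comp
      (tendsto_natCast_atTop_atTop (R := ℝ))
    simpa [Function.comp_def] using this
  have hDsum : ∀ n : ℕ, 0 < n → HasSum (fun j => D (j + n)) ((n : ℝ) ^ q) := by
    intro n hn
    rw [hasSum_iff_tendsto_nat_of_nonneg (fun j => (hDpos _ (by omega)).le)]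
    have e : ∀ N, ∑ j ∈ Finset.range N, D (j + n) = (n : ℝ) ^ q - ((N + n : ℕ) : ℝ) ^ q := by
      intro N
      have := Finset.sum_range_sub' (fun j => ((j + n : ℕ) : ℝ) ^ q) N
      rw [zero_add] at this
      rw [← this]
      refine Finset.sum_congr rfl fun j _ => ?_
      rw [hD]
      simp only
      rw [show j + n + 1 = j + 1 + n by ring]
    simp_rw [e]
    have := (hD0.comp (tendsto_add_atTop_nat n)).const_sub ((n : ℝ) ^ q)
    simpa [Function.comp_def] using this
  have hl : Tendsto (fun n => f n / D n) atTop (𝓝 (-(κ / q))) := by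
    have h1 := hf.div (tendsto_rpow_increment q).neg (by linarith)
    rw [show κ / -q = -(κ / q) by rw [div_neg]] at h1
    refine h1.congr' ?_
    filter_upwards [eventually_gt_atTop 0] with n hn
    have h2 : (0 : ℝ) < (n : ℝ) ^ (q - 1) := Real.rpow_pos_of_pos (by exact_mod_cast hn) _
    have h3 := hDpos n hn
    simp only [Pi.div_apply]
    rw [← neg_div, neg_sub, div_div_div_cancel_right₀ h2.ne']
  set l := -(κ / q)
  rw [Metric.tendsto_atTop] at hl ⊢
  intro η hη
  obtain ⟨N, hN⟩ := hl (η / 2) (by positivity)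
  -- Index 0 is avoided, since 0 raised to a negative exponent is 0 here and the telescoping would
  -- fail.
  refine ⟨N + 1, fun n hn => ?_⟩
  have hn0 : 0 < n := by omega
  have hnq : (0 : ℝ) < (n : ℝ) ^ q := Real.rpow_pos_of_pos (by exact_mod_cast hn0) _
  have hDs := hDsum n hn0
  have hfs : Summable fun j => f (j + n) := (summable_nat_add_iff n).2 hs
  have h1 : ∀ j, |f (j + n) - l * D (j + n)| ≤ η / 2 * D (j + n) := by
    intro j
    have h2 := hN (j + n) (by omega)
    have h3 := hDpos (j + n) (by omega)
    rw [Real.dist_eq] at h2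
    have : f (j + n) - l * D (j + n) = (f (j + n) / D (j + n) - l) * D (j + n) := by
      field_simp
    rw [this, abs_mul, abs_of_pos h3]
    exact mul_le_mul_of_nonneg_right h2.le h3.le
  have h4 := hfs.hasSum.sub (hDs.mul_left l)
  have h5 := hDs.mul_left (η / 2)
  have h6 : |(∑' j, f (j + n)) - l * (n : ℝ) ^ q| ≤ η / 2 * (n : ℝ) ^ q := by
    rw [abs_le]
    constructor
    · have := hasSum_le (fun j => (abs_le.1 (h1 j)).1) h5.neg h4
      linarith
    · exact hasSum_le (fun j => (abs_le.1 (h1 j)).2) h4 h5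
  rw [Real.dist_eq]
  have e : (∑' j, f (j + n)) / (n : ℝ) ^ q - l =
      ((∑' j, f (j + n)) - l * (n : ℝ) ^ q) / (n : ℝ) ^ q := by field_simp
  rw [e, abs_div, abs_of_pos hnq, div_lt_iff₀ hnq]
  refine h6.trans_lt ?_
  gcongr
  linarith

/-- For e > 0 the partial sums are summed directly. For e < 0 the total is 0, so a partial sum is
minus a tail; the two signs cancel and the constant is again c/e. -/
theorem HasMemory.tendsto_partialSum_div {e c : ℝ} {a : ℕ → ℝ} (h : HasMemory e c a)
    (he : e ≠ 0) :
    Tendsto (fun m : ℕ => partialSumZ a m / (m : ℝ) ^ e) atTop (𝓝 (c / e)) := by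
  have ht := h.tendsto_div he
  -- `partialSumZ a m` includes the term j = m, so the sum over `range m` is shifted by one.
  have hshift := tendsto_natCast_add_div_rpow 1 e
  have key : Tendsto (fun m : ℕ => (∑ j ∈ Finset.range m, a j) / (m : ℝ) ^ e) atTop
      (𝓝 (c / e)) := by
    rcases lt_or_gt_of_ne he with he' | he'
    · have hs : HasSum a 0 := by
        rcases h with ⟨h, -⟩ | ⟨h, -⟩ | ⟨-, -, -, h, -⟩
        · exact absurd h he
        · linarith
        · exact h
      have h1 := (tendsto_tail_div_rpow he' hs.summable ht).neg
      rw [neg_neg] at h1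
      refine h1.congr fun m => ?_
      have := hs.summable.sum_add_tsum_nat_add m
      rw [hs.tsum_eq] at this
      rw [← neg_div]
      congr 1
      linarith
    · exact tendsto_sum_div_rpow he' ht
  have h1 := (key.comp (tendsto_add_atTop_nat 1)).mul hshift
  rw [mul_one] at h1
  refine h1.congr fun m => ?_
  have : (0 : ℝ) < ((m + 1 : ℕ) : ℝ) ^ e := Real.rpow_pos_of_pos (by positivity) _
  simp only [Function.comp]
  rw [div_mul_div_cancel₀ this.ne', partialSumZ_natCast]

/-- The base m + 1 makes the bound valid at m = 0 even for negative q. -/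
theorem exists_abs_le_of_tendsto_div {f : ℕ → ℝ} {q κ : ℝ}
    (h : Tendsto (fun m : ℕ => f m / (m : ℝ) ^ q) atTop (𝓝 κ)) :
    ∃ C : ℝ, 0 < C ∧ ∀ m : ℕ, |f m| ≤ C * ((m : ℝ) + 1) ^ q := by
  have h1 := h.div (tendsto_natCast_add_div_rpow 1 q) one_ne_zero
  have h2 : Tendsto (fun m : ℕ => f m / ((m : ℝ) + 1) ^ q) atTop (𝓝 (κ / 1)) := by
    refine h1.congr' ?_
    filter_upwards [eventually_gt_atTop 0] with m hm
    have : (0 : ℝ) < (m : ℝ) ^ q := Real.rpow_pos_of_pos (by exact_mod_cast hm) _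
    simp only [Pi.div_apply]
    rw [div_div_div_cancel_right₀ this.ne']
    push_cast
    rfl
  obtain ⟨C, hC⟩ := h2.abs.bddAbove_range
  refine ⟨max C 1, by positivity, fun m => ?_⟩
  have h3 := hC ⟨m, rfl⟩
  have h4 : (0 : ℝ) < ((m : ℝ) + 1) ^ q := Real.rpow_pos_of_pos (by positivity) _
  simp only [abs_div, abs_of_pos h4] at h3
  rw [div_le_iff₀ h4] at h3
  exact h3.trans (mul_le_mul_of_nonneg_right (le_max_left _ _) h4.le)

theorem HasMemory.exists_partialSum_bound {e c : ℝ} {a : ℕ → ℝ} (h : HasMemory e c a)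
    (he : e ≠ 0) : ∃ C : ℝ, 0 < C ∧ ∀ m : ℕ, |partialSumZ a m| ≤ C * ((m : ℝ) + 1) ^ e :=
  exists_abs_le_of_tendsto_div (h.tendsto_partialSum_div he)

theorem HasMemory.exists_partialSum_increment_bound {e c : ℝ} {a : ℕ → ℝ} (h : HasMemory e c a)
    (he : e ≠ 0) (he1 : e ≤ 1) : ∃ C : ℝ, 0 < C ∧ ∀ m k : ℕ,
      |partialSumZ a (m + k : ℕ) - partialSumZ a m| ≤ C * k * ((m : ℝ) + 1) ^ (e - 1) := by
  obtain ⟨C, hC0, hC⟩ := exists_abs_le_of_tendsto_div (h.tendsto_div he)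
  refine ⟨C, hC0, fun m k => ?_⟩
  have h1 := partialSumZ_add_sub a m k
  push_cast
  rw [h1]
  calc |∑ t ∈ Finset.range k, coeffZ a (m + t + 1)|
      ≤ ∑ t ∈ Finset.range k, |coeffZ a (m + t + 1)| := Finset.abs_sum_le_sum_abs _ _
    _ ≤ ∑ _t ∈ Finset.range k, C * ((m : ℝ) + 1) ^ (e - 1) := by
        refine Finset.sum_le_sum fun t _ => ?_
        have e1 : coeffZ a (m + t + 1) = a (m + t + 1) := by
          have h0 : (0 : ℤ) ≤ m + t + 1 := by omega
          have h0' : ((m : ℤ) + t + 1).toNat = m + t + 1 := by omega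
          rw [coeffZ, if_pos h0, h0']
        rw [e1]
        refine (hC _).trans ?_
        gcongr ?_ * ?_
        refine Real.rpow_le_rpow_of_nonpos (by positivity) ?_ (by linarith)
        push_cast
        have : (0 : ℝ) ≤ t := by positivity
        linarith
    _ = _ := by
        rw [Finset.sum_const, Finset.card_range, nsmul_eq_mul]; ring

end LongMemory

namespace LongMemory

/-! ### The variance constant as an integral -/

theorem beta_integral_Ioo {u v : ℝ} (hu : 0 < u) (hv : 0 < v) :
    IntegrableOn (fun x : ℝ => x ^ (u - 1) * (1 - x) ^ (v - 1)) (Set.Ioo 0 1) ∧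
      ∫ x in Set.Ioo (0 : ℝ) 1, x ^ (u - 1) * (1 - x) ^ (v - 1) = beta u v := by
  have hconv := Complex.betaIntegral_convergent (u := u) (v := v) (by simpa) (by simpa)
  rw [intervalIntegrable_iff_integrableOn_Ioc_of_le zero_le_one] at hconv
  have e : ∀ x ∈ Set.Ioc (0 : ℝ) 1, RCLike.re ((x : ℂ) ^ ((u : ℂ) - 1) * (1 - x) ^ ((v : ℂ) - 1)) =
      x ^ (u - 1) * (1 - x) ^ (v - 1) := by
    intro x hx
    norm_cast
    rw [← Complex.ofReal_cpow hx.1.le, ← Complex.ofReal_cpow (by linarith [hx.2]),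
      ← Complex.ofReal_mul, RCLike.re_to_complex, Complex.ofReal_re]
  constructor
  · have h1 : IntegrableOn (fun x : ℝ => x ^ (u - 1) * (1 - x) ^ (v - 1)) (Set.Ioc 0 1) :=
      (integrableOn_congr_fun e measurableSet_Ioc).1 hconv.re
    exact h1.mono_set Set.Ioo_subset_Ioc_self
  · rw [beta_eq_betaIntegralReal u v hu hv, Complex.betaIntegral,
      intervalIntegral.integral_of_le zero_le_one, ← integral_Ioc_eq_integral_Ioo,
      ← RCLike.re_to_complex, ← integral_re hconv]
    exact (setIntegral_congr_fun measurableSet_Ioc e).symm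

/-- The substitution x = y/(1-y) in the integral over the unit interval. -/
theorem beta_integral_Ioi {u v : ℝ} (hu : 0 < u) (hv : 0 < v) :
    IntegrableOn (fun x : ℝ => x ^ (u - 1) * (1 + x) ^ (-(u + v))) (Set.Ioi 0) ∧
      ∫ x in Set.Ioi (0 : ℝ), x ^ (u - 1) * (1 + x) ^ (-(u + v)) = beta u v := by
  obtain ⟨h1, h2⟩ := beta_integral_Ioo hu hv
  set f : ℝ → ℝ := fun y => y / (1 - y)
  set f' : ℝ → ℝ := fun y => 1 / (1 - y) ^ 2
  have hf' : ∀ y ∈ Set.Ioo (0 : ℝ) 1, HasDerivWithinAt f (f' y) (Set.Ioo 0 1) y := by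
    intro y hy
    have hne : 1 - y ≠ 0 := by linarith [hy.2]
    have := (hasDerivAt_id y).div ((hasDerivAt_id y).const_sub 1) hne
    refine (this.congr_deriv ?_).hasDerivWithinAt
    simp only [f', id]
    congr 1
    ring
  have hinj : Set.InjOn f (Set.Ioo 0 1) := by
    intro x hx y hy hxy
    simp only [f] at hxy
    have hx1 : 1 - x ≠ 0 := by linarith [hx.2]
    have hy1 : 1 - y ≠ 0 := by linarith [hy.2]
    rw [div_eq_div_iff hx1 hy1] at hxy
    linarith
  have himg : f '' Set.Ioo 0 1 = Set.Ioi 0 := by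
    ext x
    simp only [Set.mem_image, Set.mem_Ioo, Set.mem_Ioi, f]
    constructor
    · rintro ⟨y, ⟨hy0, hy1⟩, rfl⟩
      exact div_pos hy0 (by linarith)
    · intro hx
      refine ⟨x / (1 + x), ⟨by positivity, ?_⟩, ?_⟩
      · rw [div_lt_one (by linarith)]; linarith
      · field_simp
        ring_nf
  have hcongr : ∀ y ∈ Set.Ioo (0 : ℝ) 1,
      |f' y| • ((f y) ^ (u - 1) * (1 + f y) ^ (-(u + v))) = y ^ (u - 1) * (1 - y) ^ (v - 1) := by
    intro y hy
    have h0 : 0 < 1 - y := by linarith [hy.2]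
    have e1 : 1 + f y = (1 - y)⁻¹ := by simp only [f]; field_simp; ring
    have e2 : |f' y| = (1 - y) ^ (-2 : ℝ) := by
      have : f' y = (1 - y) ^ (-2 : ℝ) := by
        rw [Real.rpow_neg h0.le, Real.rpow_ofNat]
        simp [f']
      rw [this, abs_of_pos (Real.rpow_pos_of_pos h0 _)]
    have e3 : f y ^ (u - 1) = y ^ (u - 1) * (1 - y) ^ (-(u - 1)) := by
      simp only [f]
      rw [Real.div_rpow hy.1.le h0.le, Real.rpow_neg h0.le, div_eq_mul_inv]
    have e4 : ((1 - y)⁻¹) ^ (-(u + v)) = (1 - y) ^ (u + v) := by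
      rw [Real.inv_rpow h0.le, Real.rpow_neg h0.le, inv_inv]
    rw [e1, e2, e3, e4, smul_eq_mul]
    have : (1 - y) ^ (v - 1) = (1 - y) ^ (-2 : ℝ) * (1 - y) ^ (-(u - 1)) * (1 - y) ^ (u + v) := by
      rw [← Real.rpow_add h0, ← Real.rpow_add h0]
      ring_nf
    rw [this]
    ring
  constructor
  · rw [← himg, integrableOn_image_iff_integrableOn_abs_deriv_smul measurableSet_Ioo hf' hinj]
    exact (integrableOn_congr_fun hcongr measurableSet_Ioo).2 h1
  · rw [← himg, integral_image_eq_integral_abs_deriv_smul measurableSet_Ioo hf' hinj, ← h2]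
    exact setIntegral_congr_fun measurableSet_Ioo hcongr

theorem tendsto_rpow_increment_real (q : ℝ) :
    Tendsto (fun x : ℝ => ((1 + x) ^ q - x ^ q) / x ^ (q - 1)) atTop (𝓝 q) := by
  have d : HasDerivAt (fun x : ℝ => (1 + x) ^ q) q 0 := by
    have h0 : HasDerivAt (fun x : ℝ => 1 + x) 1 0 := (hasDerivAt_id 0).const_add 1
    simpa using h0.rpow_const (p := q) (Or.inl (by norm_num))
  have h1 := (hasDerivAt_iff_tendsto_slope_zero.1 d)
  have h2 : Tendsto (fun x : ℝ => x⁻¹) atTop (𝓝[≠] 0) := by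
    refine tendsto_nhdsWithin_iff.2 ⟨tendsto_inv_atTop_zero, ?_⟩
    filter_upwards [eventually_gt_atTop 0] with n hn
    simp [hn.ne']
  refine (h1.comp h2).congr' ?_
  filter_upwards [eventually_gt_atTop 0] with x hx
  simp only [Function.comp, zero_add, inv_inv, add_zero, Real.one_rpow, smul_eq_mul]
  have e1 : (1 + x) ^ q = x ^ q * (1 + x⁻¹) ^ q := by
    rw [← Real.mul_rpow hx.le (by positivity)]
    congr 1
    field_simp
    ring
  have : (0 : ℝ) < x ^ q := Real.rpow_pos_of_pos hx _
  rw [e1, Real.rpow_sub_one hx.ne']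
  field_simp

theorem abs_rpow_increment_le {e x : ℝ} (he : e ≤ 1) (hx : 0 < x) :
    |(1 + x) ^ e - x ^ e| ≤ |e| * x ^ (e - 1) := by
  have hderiv : ∀ y ∈ Set.Ioo x (1 + x), HasDerivAt (fun y : ℝ => y ^ e) (e * y ^ (e - 1)) y :=
    fun y hy => Real.hasDerivAt_rpow_const (Or.inl (by linarith [hy.1]))
  have hcont : ContinuousOn (fun y : ℝ => y ^ e) (Set.Icc x (1 + x)) := fun y hy =>
    (Real.continuousAt_rpow_const _ _ (Or.inl (by linarith [hy.1]))).continuousWithinAt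
  obtain ⟨y, hy, h⟩ := exists_hasDerivAt_eq_slope (fun y : ℝ => y ^ e) (fun y => e * y ^ (e - 1))
    (by linarith : x < 1 + x) hcont hderiv
  have h1 : (1 + x) ^ e - x ^ e = e * y ^ (e - 1) := by
    rw [h]
    simp
  rw [h1, abs_mul, abs_of_pos (Real.rpow_pos_of_pos (by linarith [hy.1]) _)]
  exact mul_le_mul_of_nonneg_left (Real.rpow_le_rpow_of_nonpos hx hy.1.le (by linarith))
    (abs_nonneg _)

/-- An integrable majorant for the squared increments in the variance integral. -/
noncomputable def varMajorant (e C : ℝ) (x : ℝ) : ℝ :=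
  if x ≤ 1 then C * (x ^ (2 * e) + 1) else C * x ^ (2 * e - 2)

theorem integrableOn_varMajorant {e : ℝ} (C : ℝ) (he : -(1 / 2) < e) (he' : e < 1 / 2) :
    IntegrableOn (varMajorant e C) (Set.Ioi 0) := by
  rw [← Set.Ioc_union_Ioi_eq_Ioi zero_le_one]
  refine IntegrableOn.union ?_ ?_
  · have h1 : IntegrableOn (fun x : ℝ => x ^ (2 * e)) (Set.Ioc 0 1) := by
      rw [← intervalIntegrable_iff_integrableOn_Ioc_of_le zero_le_one]
      exact intervalIntegral.intervalIntegrable_rpow' (by linarith)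
    have h2 : IntegrableOn (fun x : ℝ => C * (x ^ (2 * e) + 1)) (Set.Ioc 0 1) :=
      (h1.add (integrableOn_const (by simp))).const_mul C
    refine (integrableOn_congr_fun (fun x hx => ?_) measurableSet_Ioc).1 h2
    rw [varMajorant, if_pos hx.2]
  · have h1 : IntegrableOn (fun x : ℝ => C * x ^ (2 * e - 2)) (Set.Ioi 1) :=
      (integrableOn_Ioi_rpow_of_lt (by linarith) zero_lt_one).const_mul C
    refine (integrableOn_congr_fun (fun x hx => ?_) measurableSet_Ioi).1 h1
    rw [varMajorant, if_neg (not_le.2 hx)]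

theorem sq_le_varMajorant {e C x y : ℝ} (hx : 0 < x)
    (h1 : x ≤ 1 → |y| ≤ C * (x ^ e + 1)) (h2 : 1 < x → |y| ≤ C * x ^ (e - 1)) :
    y ^ 2 ≤ varMajorant e (2 * C ^ 2) x := by
  unfold varMajorant
  have e1 : x ^ (2 * e) = (x ^ e) ^ 2 := by
    rw [← Real.rpow_natCast, ← Real.rpow_mul hx.le]; ring_nf
  have e2 : x ^ (2 * e - 2) = (x ^ (e - 1)) ^ 2 := by
    rw [← Real.rpow_natCast, ← Real.rpow_mul hx.le]; ring_nf
  split_ifs with h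
  · have h3 := h1 h
    rw [e1, ← sq_abs]
    calc |y| ^ 2 ≤ (C * (x ^ e + 1)) ^ 2 := by gcongr
      _ = C ^ 2 * (x ^ e + 1) ^ 2 := by ring
      _ ≤ C ^ 2 * (2 * ((x ^ e) ^ 2 + 1)) := by
        gcongr
        nlinarith [sq_nonneg (x ^ e - 1)]
      _ = _ := by ring
  · have h3 := h2 (not_le.1 h)
    rw [e2, ← sq_abs]
    calc |y| ^ 2 ≤ (C * x ^ (e - 1)) ^ 2 := by gcongr
      _ = C ^ 2 * (x ^ (e - 1)) ^ 2 := by ring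
      _ ≤ _ := by
        have : 0 ≤ C ^ 2 * (x ^ (e - 1)) ^ 2 := by positivity
        linarith

theorem integrableOn_sq_rpow_increment {e : ℝ} (he : -(1 / 2) < e) (he' : e < 1 / 2) :
    IntegrableOn (fun x : ℝ => ((1 + x) ^ e - x ^ e) ^ 2) (Set.Ioi 0) := by
  refine (integrableOn_varMajorant (2 * 2 ^ 2) he he').mono' ?_ ?_
  · refine ContinuousOn.aestronglyMeasurable (fun x hx => ?_) measurableSet_Ioi
    have hx' : (0 : ℝ) < x := hx
    have c1 : ContinuousAt (fun x : ℝ => (1 + x) ^ e) x :=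
      (continuousAt_const.add continuousAt_id).rpow_const (Or.inl (by simp; linarith))
    have c2 : ContinuousAt (fun x : ℝ => x ^ e) x :=
      continuousAt_id.rpow_const (Or.inl (by simp; linarith))
    exact ((c1.sub c2).pow 2).continuousWithinAt
  · refine ae_restrict_of_forall_mem measurableSet_Ioi fun x hx => ?_
    have hx' : (0 : ℝ) < x := hx
    rw [Real.norm_eq_abs, abs_of_nonneg (sq_nonneg _)]
    have p1 : 0 < x ^ e := Real.rpow_pos_of_pos hx' _
    have p2 : 0 < (1 + x) ^ e := Real.rpow_pos_of_pos (by linarith) _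
    refine sq_le_varMajorant hx' (fun h => ?_) fun h => ?_
    · have h3 : (1 + x) ^ e ≤ 2 := by
        calc (1 + x) ^ e ≤ (1 + x) ^ (1 : ℝ) :=
              Real.rpow_le_rpow_of_exponent_le (by linarith) (by linarith)
          _ ≤ 2 := by rw [Real.rpow_one]; linarith
      rw [abs_le]
      constructor <;> linarith
    · refine (abs_rpow_increment_le (by linarith) hx').trans ?_
      gcongr
      rw [abs_le]
      constructor <;> linarith

/-- The primitive is the product of the unit increments of x^e and x^(e+1). Its derivative trades
the squared increment for a beta integrand. -/
theorem hasDerivAt_variance_primitive {e x : ℝ} (hx : 0 < x) :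
    HasDerivAt (fun x : ℝ => ((1 + x) ^ e - x ^ e) * ((1 + x) ^ e * (1 + x) - x ^ e * x))
      ((2 * e + 1) * ((1 + x) ^ e - x ^ e) ^ 2 - e * (x ^ (e - 1) * (1 + x) ^ (e - 1))) x := by
  have h0 : HasDerivAt (fun x : ℝ => 1 + x) 1 x := (hasDerivAt_id x).const_add 1
  have hA := h0.rpow_const (p := e) (Or.inl (by linarith))
  have hB := (hasDerivAt_id x).rpow_const (p := e) (Or.inl hx.ne')
  have := (hA.sub hB).mul ((hA.mul h0).sub (hB.mul (hasDerivAt_id x)))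
  refine this.congr_deriv ?_
  simp only [id, Pi.mul_apply, Pi.sub_apply]
  have hx1 : 1 + x ≠ 0 := by linarith
  rw [Real.rpow_sub_one hx1, Real.rpow_sub_one hx.ne']
  field_simp
  ring

theorem hasDerivAt_rpow_mul_rpow {e x : ℝ} (hx : 0 < x) :
    HasDerivAt (fun x : ℝ => x ^ e * (1 + x) ^ e)
      (e * (x ^ (e - 1) * (1 + x) ^ (e - 1)) + 2 * e * (x ^ e * (1 + x) ^ (e - 1))) x := by
  have h0 : HasDerivAt (fun x : ℝ => 1 + x) 1 x := (hasDerivAt_id x).const_add 1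
  have hA := h0.rpow_const (p := e) (Or.inl (by linarith))
  have hB := (hasDerivAt_id x).rpow_const (p := e) (Or.inl hx.ne')
  refine (hB.mul hA).congr_deriv ?_
  simp only [id]
  have hx1 : 1 + x ≠ 0 := by linarith
  rw [Real.rpow_sub_one hx1, Real.rpow_sub_one hx.ne']
  field_simp
  ring

theorem tendsto_variance_primitive {e : ℝ} (he : e < 1 / 2) :
    Tendsto (fun x : ℝ => ((1 + x) ^ e - x ^ e) * ((1 + x) ^ e * (1 + x) - x ^ e * x)) atTop
      (𝓝 0) := by
  have h1 := (tendsto_rpow_increment_real e).mul (tendsto_rpow_increment_real (e + 1))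
  have h2 : Tendsto (fun x : ℝ => x ^ (-(1 - 2 * e))) atTop (𝓝 0) :=
    tendsto_rpow_neg_atTop (by linarith)
  have h3 := h1.mul h2
  rw [mul_zero] at h3
  refine h3.congr' ?_
  filter_upwards [eventually_gt_atTop 0] with x hx
  have e1 : x ^ (-(1 - 2 * e)) = x ^ (e - 1) * x ^ (e + 1 - 1) := by
    rw [← Real.rpow_add hx]; ring_nf
  have p1 : 0 < x ^ (e - 1) := Real.rpow_pos_of_pos hx _
  have p2 : 0 < x ^ (e + 1 - 1) := Real.rpow_pos_of_pos hx _
  rw [e1, Real.rpow_add_one hx.ne' e, Real.rpow_add_one (by linarith : 1 + x ≠ 0) e]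
  field_simp

theorem tendsto_rpow_mul_rpow_zero {e : ℝ} (he : e < 0) :
    Tendsto (fun x : ℝ => x ^ e * (1 + x) ^ e) atTop (𝓝 0) := by
  have h1 : Tendsto (fun x : ℝ => x ^ e) atTop (𝓝 0) := by
    simpa using tendsto_rpow_neg_atTop (y := -e) (by linarith)
  have h2 := h1.comp (tendsto_atTop_add_const_left atTop (1 : ℝ) tendsto_id)
  simpa using h1.mul h2

/-- The fundamental theorem of calculus for the primitive above, which equals 1 at 0 for e > 0 and
tends to 0 at infinity. For e < 0 the integrand x^(e-1)(1+x)^(e-1) is not integrable at 0; adding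
the derivative of x^e(1+x)^e replaces it by the integrand of B(e+1, -2e), and the functional
equation of Γ converts the result. -/
theorem integral_sq_rpow_increment {e : ℝ} (he : -(1 / 2) < e) (he' : e < 1 / 2) (h0 : e ≠ 0) :
    1 / (2 * e + 1) + ∫ x in Set.Ioi (0 : ℝ), ((1 + x) ^ e - x ^ e) ^ 2 =
      e * beta e (1 - 2 * e) / (2 * e + 1) := by
  have hint := integrableOn_sq_rpow_increment he he'
  have hpos : 0 < 2 * e + 1 := by linarith
  suffices h : (2 * e + 1) * ∫ x in Set.Ioi (0 : ℝ), ((1 + x) ^ e - x ^ e) ^ 2 =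
      e * beta e (1 - 2 * e) - 1 by
    field_simp
    linarith
  rcases lt_or_gt_of_ne h0 with hneg | hp
  · obtain ⟨hb1, hb2⟩ := beta_integral_Ioi (u := e + 1) (v := -(2 * e)) (by linarith) (by linarith)
    have ee : ∀ x : ℝ, x ^ (e + 1 - 1) * (1 + x) ^ (-(e + 1 + -(2 * e))) =
        x ^ e * (1 + x) ^ (e - 1) := by intro x; ring_nf
    simp_rw [ee] at hb1 hb2
    -- The modified primitive is multiplied out, so that the terms singular at 0 cancel and
    -- continuity there becomes visible.
    have hc : ContinuousWithinAt (fun x : ℝ => (1 + x) ^ (2 * e + 1) + x ^ (2 * e + 1) -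
        2 * (x ^ (e + 1) * (1 + x) ^ e)) (Set.Ici 0) 0 := by
      have c1 : ∀ p : ℝ, ContinuousAt (fun x : ℝ => (1 + x) ^ p) 0 := fun p =>
        (continuousAt_const.add continuousAt_id).rpow_const (Or.inl (by simp))
      have c2 : ∀ p : ℝ, 0 < p → ContinuousAt (fun x : ℝ => x ^ p) 0 := fun p hp =>
        continuousAt_id.rpow_const (Or.inr hp.le)
      exact (((c1 _).add (c2 _ hpos)).sub
        (((c2 (e + 1) (by linarith)).mul (c1 e)).const_mul 2)).continuousWithinAt
    have heq : ∀ x : ℝ, 0 < x → (1 + x) ^ (2 * e + 1) + x ^ (2 * e + 1) -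
        2 * (x ^ (e + 1) * (1 + x) ^ e) =
        ((1 + x) ^ e - x ^ e) * ((1 + x) ^ e * (1 + x) - x ^ e * x) + x ^ e * (1 + x) ^ e := by
      intro x hx
      have hx1 : 0 < 1 + x := by linarith
      rw [Real.rpow_add_one hx.ne', Real.rpow_add_one hx.ne', Real.rpow_add_one hx1.ne',
        two_mul e, Real.rpow_add hx, Real.rpow_add hx1]
      ring
    have hd : ∀ x ∈ Set.Ioi (0 : ℝ), HasDerivAt (fun x : ℝ => (1 + x) ^ (2 * e + 1) +
        x ^ (2 * e + 1) - 2 * (x ^ (e + 1) * (1 + x) ^ e))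
        ((2 * e + 1) * ((1 + x) ^ e - x ^ e) ^ 2 + 2 * e * (x ^ e * (1 + x) ^ (e - 1))) x := by
      intro x hx
      have hx' : (0 : ℝ) < x := hx
      have := (hasDerivAt_variance_primitive (e := e) hx').add (hasDerivAt_rpow_mul_rpow (e := e) hx')
      refine (this.congr_of_eventuallyEq ?_).congr_deriv (by ring)
      filter_upwards [eventually_gt_nhds hx'] with y hy using heq y hy
    have hl : Tendsto (fun x : ℝ => (1 + x) ^ (2 * e + 1) + x ^ (2 * e + 1) -
        2 * (x ^ (e + 1) * (1 + x) ^ e)) atTop (𝓝 0) := by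
      have := (tendsto_variance_primitive he').add (tendsto_rpow_mul_rpow_zero hneg)
      rw [add_zero] at this
      refine this.congr' ?_
      filter_upwards [eventually_gt_atTop 0] with x hx using (heq x hx).symm
    have i1 := hint.const_mul (2 * e + 1)
    have i2 := hb1.const_mul (2 * e)
    have := integral_Ioi_of_hasDerivAt_of_tendsto hc hd (i1.add i2) hl
    rw [integral_add i1 i2, integral_const_mul, integral_const_mul, hb2] at this
    have z1 : (0 : ℝ) ^ (2 * e + 1) = 0 := Real.zero_rpow hpos.ne'
    have z2 : (0 : ℝ) ^ (e + 1) = 0 := Real.zero_rpow (by linarith)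
    simp only [add_zero, Real.one_rpow, z1, z2, zero_mul, mul_zero, sub_zero, zero_sub] at this
    have g1 : Real.Gamma (e + 1) = e * Real.Gamma e := Real.Gamma_add_one h0
    have g2 : Real.Gamma (1 - 2 * e) = -(2 * e) * Real.Gamma (-(2 * e)) := by
      rw [show 1 - 2 * e = -(2 * e) + 1 by ring]
      exact Real.Gamma_add_one (by simpa using h0)
    have hbeta : -(2 * e) * beta (e + 1) (-(2 * e)) = e * beta e (1 - 2 * e) := by
      unfold beta
      rw [g1, g2, show e + 1 + -(2 * e) = e + (1 - 2 * e) by ring]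
      ring
    linarith
  · obtain ⟨hb1, hb2⟩ := beta_integral_Ioi (u := e) (v := 1 - 2 * e) hp (by linarith)
    have ee : ∀ x : ℝ, x ^ (e - 1) * (1 + x) ^ (-(e + (1 - 2 * e))) =
        x ^ (e - 1) * (1 + x) ^ (e - 1) := by intro x; ring_nf
    simp_rw [ee] at hb1 hb2
    have hc : ContinuousWithinAt (fun x : ℝ =>
        ((1 + x) ^ e - x ^ e) * ((1 + x) ^ e * (1 + x) - x ^ e * x)) (Set.Ici 0) 0 := by
      have c0 : ContinuousAt (fun x : ℝ => 1 + x) 0 := by fun_prop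
      have c1 : ContinuousAt (fun x : ℝ => (1 + x) ^ e) 0 := c0.rpow_const (Or.inl (by simp))
      have c2 : ContinuousAt (fun x : ℝ => x ^ e) 0 := continuousAt_id.rpow_const (Or.inr hp.le)
      exact ((c1.sub c2).mul ((c1.mul c0).sub (c2.mul continuousAt_id))).continuousWithinAt
    have i1 := hint.const_mul (2 * e + 1)
    have i2 := hb1.const_mul e
    have := integral_Ioi_of_hasDerivAt_of_tendsto hc
      (fun x hx => hasDerivAt_variance_primitive (e := e) hx) (i1.sub i2)
      (tendsto_variance_primitive he')
    rw [integral_sub i1 i2, integral_const_mul, integral_const_mul, hb2] at this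
    have z1 : (0 : ℝ) ^ e = 0 := Real.zero_rpow h0
    simp only [add_zero, Real.one_rpow, z1] at this
    linarith

end LongMemory

/-! ### Growth of the variance of increments for d > 1/2 -/

namespace LongMemory

/-- A series is the integral of a step function, so the Riemann sums below can be treated by
dominated convergence on a half-line. -/
theorem integral_natFloor {g : ℕ → ℝ} (hg : Summable g) (h0 : ∀ p, 0 ≤ g p) :
    ∫ y in Set.Ioi (0 : ℝ), g ⌊y⌋₊ = ∑' p, g p := by
  have hU : (⋃ p : ℕ, Set.Ico (p : ℝ) (p + 1)) = Set.Ici (0 : ℝ) := by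
    ext y
    simp only [Set.mem_iUnion, Set.mem_Ico, Set.mem_Ici]
    constructor
    · rintro ⟨p, hp, -⟩
      exact le_trans p.cast_nonneg hp
    · intro hy
      exact ⟨⌊y⌋₊, Nat.floor_le hy, Nat.lt_floor_add_one y⟩
  have hm : ∀ p : ℕ, MeasurableSet (Set.Ico (p : ℝ) (p + 1)) := fun p => measurableSet_Ico
  have hfl : ∀ p : ℕ, ∀ y ∈ Set.Ico (p : ℝ) (p + 1), g ⌊y⌋₊ = g p := by
    intro p y hy
    rw [(Nat.floor_eq_iff (le_trans p.cast_nonneg hy.1)).2 hy]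
  have hi : ∀ p : ℕ, ∫ y in Set.Ico (p : ℝ) (p + 1), g ⌊y⌋₊ = g p := by
    intro p
    rw [setIntegral_congr_fun (hm p) (hfl p)]
    simp
  have hi' : ∀ p : ℕ, ∫ y in Set.Ico (p : ℝ) (p + 1), ‖g ⌊y⌋₊‖ = g p := by
    intro p
    rw [← hi p]
    simp only [Real.norm_of_nonneg (h0 _)]
  have hd : Pairwise (Function.onFun Disjoint fun p : ℕ => Set.Ico (p : ℝ) (p + 1)) := by
    intro p q hpq
    rw [Function.onFun, Set.disjoint_left]
    intro y hy hy'
    apply hpq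
    rw [← (Nat.floor_eq_iff (le_trans p.cast_nonneg hy.1)).2 hy,
      ← (Nat.floor_eq_iff (le_trans q.cast_nonneg hy'.1)).2 hy']
  have hint : IntegrableOn (fun y : ℝ => g ⌊y⌋₊) (⋃ p : ℕ, Set.Ico (p : ℝ) (p + 1)) := by
    apply integrableOn_iUnion_of_summable_integral_norm
    · intro p
      refine (integrableOn_const (C := g p) (by simp) (by simp)).congr_fun
        (fun y hy => (hfl p y hy).symm) (hm p)
    · simpa only [hi'] using hg
  have hs := hasSum_integral_iUnion hm hd hint
  rw [hU] at hs
  simp only [hi] at hs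
  rw [← integral_Ici_eq_integral_Ioi, hs.tsum_eq]

theorem integral_natFloor_mul {g : ℕ → ℝ} (hg : Summable g) (h0 : ∀ p, 0 ≤ g p) {k : ℝ}
    (hk : 0 < k) : ∫ x in Set.Ioi (0 : ℝ), g ⌊k * x⌋₊ = (∑' p, g p) / k := by
  have := integral_comp_mul_left_Ioi (fun y : ℝ => g ⌊y⌋₊) 0 hk
  rw [this, mul_zero, integral_natFloor hg h0, smul_eq_mul, div_eq_inv_mul]

section Increment

variable {a : ℕ → ℝ} {s : ℕ → L2Z}

theorem hasSum_sq_increment (hs : ∀ k i, s k i = partialSumZ a (k - i) - partialSumZ a (-i))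
    (k : ℕ) : HasSum (fun m : ℤ => (partialSumZ a (m + k) - partialSumZ a m) ^ 2) (‖s k‖ ^ 2) := by
  have h := L2Z.hasSum_sq (s k)
  rw [← (Equiv.neg ℤ).hasSum_iff] at h
  refine h.congr_fun fun m => ?_
  simp only [Function.comp_apply, Equiv.neg_apply, hs, neg_neg, sub_neg_eq_add]
  rw [add_comm (k : ℤ) m]

theorem summable_sq_increment (hs : ∀ k i, s k i = partialSumZ a (k - i) - partialSumZ a (-i))
    (k : ℕ) : Summable fun p : ℕ =>
      (partialSumZ a ((p + k : ℕ) : ℤ) - partialSumZ a p) ^ 2 := by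
  have := (hasSum_sq_increment hs k).summable.comp_injective
    (i := fun p : ℕ => (p : ℤ)) Nat.cast_injective
  refine this.congr fun p => ?_
  simp

/-- The finite sum comes from the innovations at times 1, ..., k, where S(-i) = 0; the series comes
from the past, with p = -i. -/
theorem norm_increment_sq (hs : ∀ k i, s k i = partialSumZ a (k - i) - partialSumZ a (-i))
    (k : ℕ) : ‖s k‖ ^ 2 = ∑ m ∈ Finset.range k, partialSumZ a m ^ 2 +
      ∑' p : ℕ, (partialSumZ a ((p + k : ℕ) : ℤ) - partialSumZ a p) ^ 2 := by
  have h1 := (summable_sq_increment hs k).hasSum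
  have h2 : HasSum (fun n : ℕ => (partialSumZ a (-((n : ℤ) + 1) + k) -
      partialSumZ a (-((n : ℤ) + 1))) ^ 2) (∑ m ∈ Finset.range k, partialSumZ a m ^ 2) := by
    rw [← Finset.sum_range_reflect]
    have : ∀ n ∈ Finset.range k, partialSumZ a ((k - 1 - n : ℕ) : ℤ) ^ 2 =
        (partialSumZ a (-((n : ℤ) + 1) + k) - partialSumZ a (-((n : ℤ) + 1))) ^ 2 := by
      intro n hn
      rw [Finset.mem_range] at hn
      rw [partialSumZ_of_neg a (m := -((n : ℤ) + 1)) (by omega), sub_zero]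
      congr 2
      omega
    rw [Finset.sum_congr rfl this]
    apply hasSum_sum_of_ne_finset_zero
    intro n hn
    rw [Finset.mem_range] at hn
    rw [partialSumZ_of_neg a (m := -((n : ℤ) + 1)) (by omega), partialSumZ_of_neg a (by omega)]
    simp
  have h3 := HasSum.of_nat_of_neg_add_one
    (f := fun m : ℤ => (partialSumZ a (m + k) - partialSumZ a m) ^ 2)
    (by simpa using h1) h2
  rw [(hasSum_sq_increment hs k).unique h3]
  simp [add_comm]

end Increment

/-- One bound for both signs of e: for e ≤ 0 the power decreases from y to z, and for 0 < e < 1/2 it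
is at most 3. -/
theorem rpow_le_rpow_add_three {e y z : ℝ} (he : e < 1 / 2) (hy : 0 < y) (hyz : y ≤ z)
    (hz : z ≤ 3) : z ^ e ≤ y ^ e + 3 := by
  have hz0 : 0 < z := hy.trans_le hyz
  rcases le_or_gt e 0 with h | h
  · have := Real.rpow_le_rpow_of_nonpos hy hyz h
    linarith
  · have h1 : z ^ e ≤ 3 ^ e := Real.rpow_le_rpow hz0.le hz h.le
    have h2 : (3 : ℝ) ^ e ≤ 3 ^ (1 : ℝ) :=
      Real.rpow_le_rpow_of_exponent_le (by norm_num) (by linarith)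
    rw [Real.rpow_one] at h2
    have := Real.rpow_nonneg hy.le e
    linarith

theorem tendsto_comp_div_rpow {f : ℕ → ℝ} {e κ y : ℝ} (hy : 0 < y)
    (hf : Tendsto (fun m : ℕ => f m / (m : ℝ) ^ e) atTop (𝓝 κ)) {u : ℕ → ℕ}
    (hu : Tendsto (fun k : ℕ => (u k : ℝ) / k) atTop (𝓝 y)) :
    Tendsto (fun k : ℕ => f (u k) / (k : ℝ) ^ e) atTop (𝓝 (κ * y ^ e)) := by
  have hu1 : Tendsto u atTop atTop := by
    rw [← tendsto_natCast_atTop_iff (R := ℝ)]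
    have h := hu.pos_mul_atTop hy (tendsto_natCast_atTop_atTop (R := ℝ))
    refine h.congr' ?_
    filter_upwards [eventually_gt_atTop 0] with k hk
    have : (k : ℝ) ≠ 0 := by positivity
    field_simp
  have h2 := (hf.comp hu1).mul (hu.rpow_const (p := e) (Or.inl hy.ne'))
  refine h2.congr' ?_
  filter_upwards [eventually_gt_atTop 0, hu1.eventually_gt_atTop 0] with k hk hk'
  simp only [Function.comp_apply]
  have h3 : (0 : ℝ) < k := by positivity
  have h4 : (0 : ℝ) < u k := by positivity
  rw [Real.div_rpow h4.le h3.le]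
  have := (Real.rpow_pos_of_pos h4 e).ne'
  field_simp

/-- With p = ⌊kx⌋, the rescaled partial sums at p and p + k tend to (c/e)x^e and (c/e)(1+x)^e. The
bound on S dominates for x ≤ 1 and the bound on its increments for x > 1. -/
theorem HasMemory.tendsto_tail_increment {e c : ℝ} {a : ℕ → ℝ} (h : HasMemory e c a)
    {s : ℕ → L2Z} (hs : ∀ k i, s k i = partialSumZ a (k - i) - partialSumZ a (-i))
    (h0 : e ≠ 0) (he : -(1 / 2) < e) (he' : e < 1 / 2) :
    Tendsto (fun k : ℕ => (∑' p : ℕ, (partialSumZ a ((p + k : ℕ) : ℤ) - partialSumZ a p) ^ 2) /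
      (k : ℝ) ^ (2 * e + 1)) atTop
      (𝓝 ((c / e) ^ 2 * ∫ x in Set.Ioi (0 : ℝ), ((1 + x) ^ e - x ^ e) ^ 2)) := by
  obtain ⟨C, hC, hb⟩ := h.exists_partialSum_bound h0
  obtain ⟨D, hD, hi⟩ := h.exists_partialSum_increment_bound h0 (by linarith)
  have hlim := h.tendsto_partialSum_div h0
  set F : ℕ → ℝ → ℝ := fun k x =>
    ((partialSumZ a ((⌊(k : ℝ) * x⌋₊ + k : ℕ) : ℤ) - partialSumZ a (⌊(k : ℝ) * x⌋₊ : ℕ)) /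
      (k : ℝ) ^ e) ^ 2 with hF
  have hint : ∀ k : ℕ, 0 < k → ∫ x in Set.Ioi (0 : ℝ), F k x =
      (∑' p : ℕ, (partialSumZ a ((p + k : ℕ) : ℤ) - partialSumZ a p) ^ 2) /
      (k : ℝ) ^ (2 * e + 1) := by
    intro k hk
    have hk0 : (0 : ℝ) < k := by positivity
    have := integral_natFloor_mul (g := fun p : ℕ =>
      ((partialSumZ a ((p + k : ℕ) : ℤ) - partialSumZ a p) / (k : ℝ) ^ e) ^ 2)
      (by simpa only [div_pow] using (summable_sq_increment hs k).div_const _)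
      (fun p => sq_nonneg _) hk0
    rw [hF]
    simp only
    rw [this]
    simp only [div_pow]
    rw [tsum_div_const, div_div, Real.rpow_add hk0, Real.rpow_one, two_mul, Real.rpow_add hk0, sq]
  rw [← integral_const_mul]
  refine Tendsto.congr' (f₁ := fun k : ℕ => ∫ x in Set.Ioi (0 : ℝ), F k x) ?_ ?_
  · filter_upwards [eventually_gt_atTop 0] with k hk using hint k hk
  apply tendsto_integral_filter_of_dominated_convergence
    -- 6C serves x ≤ 1, where two terms C(x^e + 3) occur, and D serves x > 1; their sum covers both.
    (varMajorant e (2 * (6 * C + D) ^ 2))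
  · refine Eventually.of_forall fun k => ?_
    have hm : Measurable fun x : ℝ => ⌊(k : ℝ) * x⌋₊ :=
      Nat.measurable_floor.comp (measurable_const_mul _)
    have : Measurable (F k) := (measurable_from_nat (f := fun p : ℕ =>
      ((partialSumZ a ((p + k : ℕ) : ℤ) - partialSumZ a p) / (k : ℝ) ^ e) ^ 2)).comp hm
    exact this.aestronglyMeasurable
  · filter_upwards [eventually_gt_atTop 0] with k hk
    refine (ae_restrict_iff' measurableSet_Ioi).2 (ae_of_all _ fun x hx => ?_)
    have hx0 : 0 < x := hx
    have hk0 : (0 : ℝ) < k := by positivity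
    have hk1 : (1 : ℝ) ≤ k := by exact_mod_cast hk
    have hke := Real.rpow_pos_of_pos hk0 e
    have hfl : (k : ℝ) * x ≤ ⌊(k : ℝ) * x⌋₊ + 1 := (Nat.lt_floor_add_one _).le
    have hfl' : (⌊(k : ℝ) * x⌋₊ : ℝ) ≤ k * x := Nat.floor_le (by positivity)
    rw [Real.norm_of_nonneg (sq_nonneg _)]
    set p := ⌊(k : ℝ) * x⌋₊ with hp
    apply sq_le_varMajorant hx0
    · intro hx1
      -- The indices used are p and p + k. Since p ≤ k and k ≥ 1, both satisfy q + 1 ≤ 3k, whence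
      -- the 3.
      have hbd : ∀ q : ℕ, (k : ℝ) * x ≤ q + 1 → (q : ℝ) + 1 ≤ 3 * k →
          |partialSumZ a q| / (k : ℝ) ^ e ≤ C * (x ^ e + 3) := by
        intro q h1 h2
        have h3 : ((q : ℝ) + 1) ^ e / (k : ℝ) ^ e ≤ x ^ e + 3 := by
          rw [← Real.div_rpow (by positivity) hk0.le]
          apply rpow_le_rpow_add_three he' hx0
          · rw [le_div_iff₀ hk0]; linarith
          · rw [div_le_iff₀ hk0]; linarith
        calc |partialSumZ a q| / (k : ℝ) ^ e ≤ C * ((q : ℝ) + 1) ^ e / (k : ℝ) ^ e := by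
              gcongr; exact hb q
          _ = C * (((q : ℝ) + 1) ^ e / (k : ℝ) ^ e) := by ring
          _ ≤ _ := by gcongr
      have hkx : (k : ℝ) * x ≤ k := by nlinarith
      have h1 := hbd p hfl (by linarith)
      have h2 := hbd (p + k) (by push_cast; linarith) (by push_cast; linarith)
      have hxe := Real.rpow_pos_of_pos hx0 e
      calc |(partialSumZ a ((p + k : ℕ) : ℤ) - partialSumZ a p) / (k : ℝ) ^ e|
          ≤ (|partialSumZ a ((p + k : ℕ) : ℤ)| + |partialSumZ a p|) / (k : ℝ) ^ e := by
            rw [abs_div, abs_of_pos hke]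
            gcongr
            exact abs_sub _ _
        _ ≤ C * (x ^ e + 3) + C * (x ^ e + 3) := by rw [add_div]; exact add_le_add h2 h1
        _ ≤ (6 * C + D) * (x ^ e + 1) := by nlinarith [mul_pos hC hxe, mul_pos hD hxe]
    · intro hx1
      have h3 : ((p : ℝ) + 1) ^ (e - 1) ≤ (k * x) ^ (e - 1) :=
        Real.rpow_le_rpow_of_nonpos (by positivity) hfl (by linarith)
      have hxe := Real.rpow_pos_of_pos hx0 (e - 1)
      calc |(partialSumZ a ((p + k : ℕ) : ℤ) - partialSumZ a p) / (k : ℝ) ^ e|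
          ≤ (D * k * (k * x) ^ (e - 1)) / (k : ℝ) ^ e := by
            rw [abs_div, abs_of_pos hke]
            gcongr
            exact (hi p k).trans (by gcongr)
        _ = D * x ^ (e - 1) := by
            rw [Real.mul_rpow hk0.le hx0.le, Real.rpow_sub_one hk0.ne']
            field_simp
        _ ≤ (6 * C + D) * x ^ (e - 1) := by
            gcongr; linarith
  · exact integrableOn_varMajorant _ he he'
  · refine (ae_restrict_iff' measurableSet_Ioi).2 (ae_of_all _ fun x hx => ?_)
    have hx0 : 0 < x := hx
    have h1 : Tendsto (fun k : ℕ => (⌊(k : ℝ) * x⌋₊ : ℝ) / k) atTop (𝓝 x) := by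
      have := (tendsto_nat_floor_mul_div_atTop (R := ℝ) hx0.le).comp
        (tendsto_natCast_atTop_atTop (R := ℝ))
      refine this.congr fun k => ?_
      simp [mul_comm]
    have h2 : Tendsto (fun k : ℕ => ((⌊(k : ℝ) * x⌋₊ + k : ℕ) : ℝ) / k) atTop (𝓝 (1 + x)) := by
      rw [add_comm]
      refine (h1.add_const 1).congr' ?_
      filter_upwards [eventually_gt_atTop 0] with k hk
      have : (k : ℝ) ≠ 0 := by positivity
      push_cast
      field_simp
    have h3 := ((tendsto_comp_div_rpow (by linarith) hlim h2).sub
      (tendsto_comp_div_rpow hx0 hlim h1)).pow 2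
    convert h3 using 2
    · simp only [hF]; rw [sub_div]
    · ring

/-- One factor of the square is bounded by the full absolute sum, the other termwise; summing over p
turns the latter into tails of the absolute series. -/
theorem tsum_sq_increment_le {a : ℕ → ℝ} (ha : Summable fun j => |a j|)
    {s : ℕ → L2Z} (hs : ∀ k i, s k i = partialSumZ a (k - i) - partialSumZ a (-i)) (k : ℕ) :
    ∑' p : ℕ, (partialSumZ a ((p + k : ℕ) : ℤ) - partialSumZ a p) ^ 2 ≤
      (∑' j, |a j|) * ∑ t ∈ Finset.range k, ∑' p, |a (p + (t + 1))| := by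
  have h1 : HasSum (fun p => (∑' j, |a j|) * ∑ t ∈ Finset.range k, |a (p + (t + 1))|)
      ((∑' j, |a j|) * ∑ t ∈ Finset.range k, ∑' p, |a (p + (t + 1))|) :=
    (hasSum_sum fun t _ =>
      ((summable_nat_add_iff (f := fun j => |a j|) (t + 1)).2 ha).hasSum).mul_left _
  refine hasSum_le (fun p => ?_) (summable_sq_increment hs k).hasSum h1
  have h2 := abs_increment_le_of_summable_abs ha p k
  have h3 : |partialSumZ a ((p : ℤ) + k) - partialSumZ a p| ≤
      ∑ t ∈ Finset.range k, |a (p + (t + 1))| := by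
    rw [partialSumZ_add_sub]
    refine (Finset.abs_sum_le_sum_abs _ _).trans (Finset.sum_le_sum fun t _ => le_of_eq ?_)
    have h4 : ((p : ℤ) + t + 1).toNat = p + (t + 1) := by omega
    rw [coeffZ, if_pos (by positivity), h4]
  rw [← sq_abs, sq]
  push_cast
  exact mul_le_mul h2 h3 (abs_nonneg _) ((abs_nonneg _).trans h2)

/-- The tails tend to 0, hence so do their Cesàro means: with summable coefficients the past is
negligible. -/
theorem tendsto_tail_increment_of_summable_abs {a : ℕ → ℝ} (ha : Summable fun j => |a j|)
    {s : ℕ → L2Z} (hs : ∀ k i, s k i = partialSumZ a (k - i) - partialSumZ a (-i)) :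
    Tendsto (fun k : ℕ => (∑' p : ℕ, (partialSumZ a ((p + k : ℕ) : ℤ) - partialSumZ a p) ^ 2) /
      k) atTop (𝓝 0) := by
  have hR0 : Tendsto (fun t : ℕ => ∑' p, |a (p + (t + 1))|) atTop (𝓝 0) :=
    (tendsto_sum_nat_add fun j => |a j|).comp (tendsto_add_atTop_nat 1)
  have hces := hR0.cesaro.const_mul (∑' j, |a j|)
  rw [mul_zero] at hces
  refine squeeze_zero (fun k => div_nonneg (tsum_nonneg fun p => sq_nonneg _) k.cast_nonneg)
    (fun k => ?_) hces
  rw [div_eq_inv_mul, mul_left_comm]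
  exact mul_le_mul_of_nonneg_left (tsum_sq_increment_le ha hs k) (by positivity)

/-- For e ≠ 0 the innovations after time 0 give (c/e)²/(2e+1) and the past gives (c/e)² times the
integral; for e = 0 only the former count, through the Cesàro mean of S². -/
theorem HasMemory.tendsto_norm_increment_sq {e c : ℝ} {a : ℕ → ℝ} (h : HasMemory e c a)
    {s : ℕ → L2Z} (hs : ∀ k i, s k i = partialSumZ a (k - i) - partialSumZ a (-i))
    (he : -(1 / 2) < e) (he' : e < 1 / 2) {σ2 : ℝ} (hσ : σ2 ≠ 0) :
    Tendsto (fun k : ℕ => ‖s k‖ ^ 2 / (k : ℝ) ^ (2 * e + 1)) atTop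
      (𝓝 (delta e σ2 c a / σ2)) := by
  simp only [norm_increment_sq hs, add_div]
  by_cases h0 : e = 0
  · subst h0
    have ha := h.summable_abs le_rfl
    have hb : Tendsto (fun m : ℕ => partialSumZ a m) atTop (𝓝 (∑' j, a j)) :=
      (ha.of_abs.hasSum.tendsto_sum_nat).comp (tendsto_add_atTop_nat 1)
    have h1 := (hb.pow 2).cesaro
    have h2 := h1.add (tendsto_tail_increment_of_summable_abs ha hs)
    have e1 : delta 0 σ2 c a / σ2 = (∑' j, a j) ^ 2 + 0 := by
      rw [delta, if_neg (by norm_num), if_pos rfl]; field_simp; ring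
    rw [e1]
    refine h2.congr fun k => ?_
    simp [div_eq_inv_mul]
  · have h1 : Tendsto (fun m : ℕ => partialSumZ a m ^ 2 / (m : ℝ) ^ (2 * e + 1 - 1)) atTop
        (𝓝 ((c / e) ^ 2)) := by
      refine ((h.tendsto_partialSum_div h0).pow 2).congr fun m => ?_
      rw [div_pow, ← Real.rpow_natCast, ← Real.rpow_natCast, ← Real.rpow_mul m.cast_nonneg]
      congr 2
      push_cast; ring
    have h2 := (tendsto_sum_div_rpow (by linarith) h1).add
      (h.tendsto_tail_increment hs h0 he he')
    convert h2 using 2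
    rw [delta, if_neg he.ne', if_neg h0]
    have h3 := integral_sq_rpow_increment he he' h0
    have h4 : 2 * e + 1 ≠ 0 := by linarith
    have : (c / e) ^ 2 / (2 * e + 1) + (c / e) ^ 2 *
        ∫ x in Set.Ioi (0 : ℝ), ((1 + x) ^ e - x ^ e) ^ 2 =
        (c / e) ^ 2 * (e * beta e (1 - 2 * e) / (2 * e + 1)) := by rw [← h3]; ring
    rw [this]
    field_simp

end LongMemory

/-! ### The sample mean as a linear form, and its normal limit for d > 1/2 -/

namespace LongMemory

theorem L2Z.coeFn_finsetSum {ι : Type*} (F : Finset ι) (x : ι → L2Z) (i : ℤ) :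
    (∑ k ∈ F, x k : L2Z) i = ∑ k ∈ F, x k i := by
  rw [lp.coeFn_sum, Finset.sum_apply]

/-- A weighted average `r ∑_{k ∈ F} θ_k (X_k - X_0)` is a linear form in the innovations. -/
theorem isLin_weightedSum {Ω : Type*} [MeasurableSpace Ω] {P : Measure Ω} [IsProbabilityMeasure P]
    {ε : ℤ → Ω → ℝ} {X : ℕ → Ω → ℝ} {d c : ℝ} {a : ℕ → ℝ} (hX : IsIntegrated P d c a ε X)
    {s : ℕ → L2Z} (hs : ∀ k i, s k i = partialSumZ a (k - i) - partialSumZ a (-i))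
    (F : Finset ℕ) (θ : ℕ → ℝ) (r : ℝ) :
    IsLin P ε (r • ∑ k ∈ F, θ k • s k : L2Z)
      (fun ω => r * ∑ k ∈ F, θ k * (X k ω - X 0 ω)) := by
  have h1 : ∀ k ∈ F, IsLin P ε (θ k • s k : L2Z) (fun ω => θ k * (X k ω - X 0 ω)) := by
    intro k _
    have := (isLin_increment hX hX.coeff.summable_sq k).const_mul (θ k)
    convert this using 2 with i
    simp [hs]
  have h2 := (IsLin.finsetSum hX.innovation F h1).const_mul r
  convert h2 using 2 with i
  rw [lp.coeFn_smul, Pi.smul_apply, L2Z.coeFn_finsetSum, smul_eq_mul]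

/-- The coefficients of `X̄_n - X_0`. -/
noncomputable def meanVec (s : ℕ → L2Z) (n : ℕ) : L2Z := (n : ℝ)⁻¹ • ∑ k ∈ Finset.Icc 1 n, s k

theorem sampleMean_sub {n : ℕ} (hn : n ≠ 0) (x : ℕ → ℝ) (y : ℝ) :
    sampleMean x n - y = (n : ℝ)⁻¹ * ∑ k ∈ Finset.Icc 1 n, (x k - y) := by
  have : (n : ℝ) ≠ 0 := by exact_mod_cast hn
  rw [sampleMean, Finset.sum_sub_distrib, Finset.sum_const, Nat.card_Icc]
  simp
  field_simp

theorem norm_meanVec_sq {a : ℕ → ℝ} {s : ℕ → L2Z}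
    (hs : ∀ k i, s k i = partialSumZ a (k - i) - partialSumZ a (-i)) (n : ℕ) :
    ‖meanVec s n‖ ^ 2 =
      (∑ k ∈ Finset.range n, ((k : ℝ) + 1) * ‖s (k + 1)‖ ^ 2) / (n : ℝ) ^ 2 := by
  have : ∑ k ∈ Finset.Icc 1 n, s k = ∑ k ∈ Finset.range n, s (k + 1) := by
    rw [Finset.range_eq_Ico, Finset.sum_Ico_add' (fun k => s k) 0 n 1]
    rfl
  rw [meanVec, norm_smul, mul_pow, this, norm_sum_increment hs, norm_inv, inv_pow,
    Real.norm_natCast, div_eq_inv_mul]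

section Mean

variable {Ω : Type*} [MeasurableSpace Ω] {P : Measure Ω}
  {ε : ℤ → Ω → ℝ} {X : ℕ → Ω → ℝ} {d c : ℝ} {a : ℕ → ℝ} {s : ℕ → L2Z}

theorem measurable_sampleMean (hX : IsIntegrated P d c a ε X) (n : ℕ) :
    Measurable fun ω => sampleMean (fun k => X k ω) n :=
  (Finset.measurable_fun_sum _ fun k _ => hX.measurable k).div_const _

variable [IsProbabilityMeasure P]

theorem isLin_sampleMean (hX : IsIntegrated P d c a ε X)
    (hs : ∀ k i, s k i = partialSumZ a (k - i) - partialSumZ a (-i)) {n : ℕ} (hn : n ≠ 0) :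
    IsLin P ε (meanVec s n) (fun ω => sampleMean (fun k => X k ω) n - X 0 ω) := by
  have := isLin_weightedSum hX hs (Finset.Icc 1 n) (fun _ => 1) (n : ℝ)⁻¹
  simp only [one_smul, one_mul] at this
  simpa only [sampleMean_sub hn, meanVec] using this

theorem abs_meanVec_le {M : ℝ} {n : ℕ} (hM : 0 ≤ M) {i : ℤ} (h : ∀ k ≤ n, |s k i| ≤ M) :
    |meanVec s n i| ≤ M := by
  rcases eq_or_ne n 0 with rfl | hn
  · simpa [meanVec] using hM
  have h0 : (0 : ℝ) < n := by positivity
  rw [meanVec, lp.coeFn_smul, Pi.smul_apply, L2Z.coeFn_finsetSum, smul_eq_mul, abs_mul, abs_inv,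
    Nat.abs_cast, inv_mul_le_iff₀ h0]
  calc |∑ k ∈ Finset.Icc 1 n, s k i| ≤ ∑ k ∈ Finset.Icc 1 n, |s k i| :=
        Finset.abs_sum_le_sum_abs _ _
    _ ≤ ∑ k ∈ Finset.Icc 1 n, M :=
        Finset.sum_le_sum fun k hk => h k (Finset.mem_Icc.1 hk).2
    _ = n * M := by simp

/-- Asymptotic normality of the sample mean, given the asymptotics of its variance. -/
theorem tendstoInDistribution_sampleMean (hX : IsIntegrated P d c a ε X)
    (hs : ∀ k i, s k i = partialSumZ a (k - i) - partialSumZ a (-i)) {v : ℝ}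
    (hv : Tendsto (fun n => ‖meanVec s n‖ ^ 2 / meanNorm d n ^ 2) atTop (𝓝 v)) :
    TendstoInDistribution (fun n ω => sampleMean (fun k => X k ω) n / meanNorm d n) atTop id
      (fun _ => P) (gaussianReal 0 (innovationVariance P ε * v).toNNReal) := by
  obtain ⟨M, hM, hMlim⟩ := hX.coeff.exists_increment_bound hX.le_memory
  have hD := tendsto_meanNorm hX.le_memory
  have hm := measurable_sampleMean hX
  -- The mean is split into its deviation from X_0, a linear form, and X_0 itself, which is
  -- negligible at every point after normalisation.
  have key := tendstoInDistribution_gaussian (P := P) hX.innovation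
    (x := fun n => (meanNorm d n)⁻¹ • meanVec s n) (ρ := fun n => M n / meanNorm d n) (v := v)
    (W := fun n ω => (meanNorm d n)⁻¹ * (sampleMean (fun k => X k ω) n - X 0 ω))
    (R := fun n ω => (meanNorm d n)⁻¹ * X 0 ω)
    (by
      filter_upwards [eventually_ne_atTop 0] with n hn
      exact (isLin_sampleMean hX hs hn).const_mul (meanNorm d n)⁻¹)
    (fun n => ((hm n).sub (hX.measurable 0)).const_mul _)
    (by
      refine hv.congr fun n => ?_
      rw [norm_smul, mul_pow, norm_inv, inv_pow, Real.norm_eq_abs, sq_abs, div_eq_inv_mul])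
    hMlim
    (by
      filter_upwards [hD.eventually_gt_atTop 0] with n hn i
      have hM0 : 0 ≤ M n := (abs_nonneg _).trans (hM n 0 0 n.zero_le)
      have h1 : |meanVec s n i| ≤ M n :=
        abs_meanVec_le hM0 fun k hk => by rw [hs]; exact hM n k i hk
      rw [lp.coeFn_smul, Pi.smul_apply, smul_eq_mul, abs_mul, abs_inv, abs_of_pos hn,
        div_eq_inv_mul]
      gcongr)
    (fun n => (hX.measurable 0).const_mul _)
    (fun ω => by simpa using hD.inv_tendsto_atTop.mul_const (X 0 ω))
  convert key using 3 with n ω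
  ring

/-- The terms k‖s_k‖² grow like k^(2e+2), so their sum carries the factor 1/(2e+3), which is
1/(2d+1) for e = d - 1. -/
theorem tendsto_norm_meanVec_sq {e : ℝ} (h : HasMemory e c a)
    (hs : ∀ k i, s k i = partialSumZ a (k - i) - partialSumZ a (-i))
    (he : -(1 / 2) < e) (he' : e < 1 / 2) {σ2 : ℝ} (hσ : σ2 ≠ 0) :
    Tendsto (fun n : ℕ => ‖meanVec s n‖ ^ 2 / (n : ℝ) ^ (2 * e + 1)) atTop
      (𝓝 (delta e σ2 c a / σ2 / (2 * e + 3))) := by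
  have h1 := (h.tendsto_norm_increment_sq hs he he' hσ).comp (tendsto_add_atTop_nat 1)
  have h2 := h1.mul (tendsto_natCast_add_div_rpow 1 (2 * e + 3 - 1))
  rw [mul_one] at h2
  have h3 : Tendsto (fun k : ℕ => ((k : ℝ) + 1) * ‖s (k + 1)‖ ^ 2 / (k : ℝ) ^ (2 * e + 3 - 1))
      atTop (𝓝 (delta e σ2 c a / σ2)) := by
    refine h2.congr fun k => ?_
    have hk : (0 : ℝ) < ((k + 1 : ℕ) : ℝ) := by positivity
    have e1 : ((k + 1 : ℕ) : ℝ) ^ (2 * e + 3 - 1) =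
        ((k + 1 : ℕ) : ℝ) ^ (2 * e + 1) * ((k : ℝ) + 1) := by
      rw [show 2 * e + 3 - 1 = 2 * e + 1 + 1 by ring, Real.rpow_add hk, Real.rpow_one]
      push_cast; ring
    have := (Real.rpow_pos_of_pos hk (2 * e + 1)).ne'
    simp only [Function.comp_apply]
    rw [e1]
    field_simp
  refine (tendsto_sum_div_rpow (by linarith) h3).congr' ?_
  filter_upwards [eventually_gt_atTop 0] with n hn
  have hn0 : (0 : ℝ) < n := by positivity
  rw [norm_meanVec_sq hs, div_div, show 2 * e + 3 = (2 : ℕ) + (2 * e + 1) by push_cast; ring,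
    Real.rpow_add hn0, Real.rpow_natCast]

theorem tendstoInDistribution_sampleMean_of_lt (hX : IsIntegrated P d c a ε X)
    (hd : 1 / 2 < d) :
    TendstoInDistribution (fun n ω => sampleMean (fun k => X k ω) n / meanNorm d n) atTop id
      (fun _ => P)
      (gaussianReal 0 (delta (d - 1) (innovationVariance P ε) c a / (2 * d + 1)).toNNReal) := by
  have hσ : 0 < innovationVariance P ε := hX.innovation.variance_pos
  have hd' := hX.memory_lt
  obtain ⟨s, hs⟩ := exists_increment hX.coeff.summable_sq
  have h1 := tendsto_norm_meanVec_sq hX.coeff hs (by linarith) (by linarith) hσ.ne'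
  have h2 : Tendsto (fun n => ‖meanVec s n‖ ^ 2 / meanNorm d n ^ 2) atTop
      (𝓝 (delta (d - 1) (innovationVariance P ε) c a / innovationVariance P ε /
        (2 * (d - 1) + 3))) := by
    refine h1.congr fun n => ?_
    rw [meanNorm, if_neg hd.ne', ← Real.rpow_natCast ((n : ℝ) ^ _), ← Real.rpow_mul n.cast_nonneg]
    congr 2
    push_cast; ring
  have := tendstoInDistribution_sampleMean hX hs h2
  rwa [show 2 * (d - 1) + 3 = 2 * d + 1 by ring, ← mul_div_assoc, mul_div_cancel₀ _ hσ.ne']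
    at this

end Mean

end LongMemory

/-! ### The case d = 1/2: block approximation of the increments -/

namespace LongMemory

/-- The vector `∑_{p ∈ I} b_p e_{h - p}` of partial sums running backwards from `h`. -/
noncomputable def block (a : ℕ → ℝ) (h : ℤ) (I : Finset ℕ) : L2Z :=
  ∑ p ∈ I, lp.single 2 (h - p) (partialSumZ a p)

theorem inner_block (a : ℕ → ℝ) (h : ℤ) (I : Finset ℕ) (z : L2Z) :
    inner ℝ (block a h I) z = ∑ p ∈ I, partialSumZ a p * z (h - p) := by
  rw [block, sum_inner]
  refine Finset.sum_congr rfl fun p _ => ?_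
  rw [lp.inner_single_left]
  simp [mul_comm]

theorem block_apply (a : ℕ → ℝ) (h : ℤ) (I : Finset ℕ) (i : ℤ) :
    block a h I i = if (h - i).toNat ∈ I then partialSumZ a (h - i) else 0 := by
  rw [block, L2Z.coeFn_finsetSum]
  rcases lt_or_ge h i with hi | hi
  · rw [partialSumZ_of_neg a (by omega), ite_self]
    refine Finset.sum_eq_zero fun p _ => ?_
    rw [lp.single_apply, Pi.single_eq_of_ne (by omega)]
  · obtain ⟨q, hq⟩ := Int.eq_ofNat_of_zero_le (sub_nonneg.2 hi)
    rw [hq, Int.toNat_natCast, ← Finset.sum_ite_eq' I q fun p => partialSumZ a p]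
    refine Finset.sum_congr rfl fun p _ => ?_
    rw [lp.single_apply, Pi.single_apply]
    congr 1
    simp only [eq_iff_iff]
    omega

theorem block_apply_sub (a : ℕ → ℝ) (h : ℤ) (I : Finset ℕ) (p : ℕ) :
    block a h I (h - p) = if p ∈ I then partialSumZ a p else 0 := by
  rw [block_apply, sub_sub_cancel, Int.toNat_natCast]

theorem abs_block_apply_le (a : ℕ → ℝ) (h : ℤ) (I : Finset ℕ) (i : ℤ) :
    |block a h I i| ≤ |partialSumZ a (h - i)| := by
  rw [block_apply]
  split_ifs <;> simp

theorem norm_block_sq (a : ℕ → ℝ) (h : ℤ) (I : Finset ℕ) :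
    ‖block a h I‖ ^ 2 = ∑ p ∈ I, partialSumZ a p ^ 2 := by
  rw [← real_inner_self_eq_norm_sq, inner_block]
  refine Finset.sum_congr rfl fun p hp => ?_
  rw [block_apply_sub, if_pos hp, sq]

theorem block_sub_block (a : ℕ → ℝ) (h : ℤ) {I J : Finset ℕ} (hIJ : J ⊆ I) :
    block a h I - block a h J = block a h (I \ J) := by
  rw [sub_eq_iff_eq_add, block, block, block, Finset.sum_sdiff hIJ]

theorem L2Z.norm_le_of_sum_range {x : L2Z} {N : ℕ} {C : ℝ} (hC : 0 ≤ C)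
    (h0 : ∀ i : ℤ, -(N : ℤ) < i → x i = 0)
    (h : ∀ n : ℕ, ∑ p ∈ Finset.range n, x (-((p + N : ℕ) : ℤ)) ^ 2 ≤ C ^ 2) : ‖x‖ ≤ C := by
  have hinj : Function.Injective fun p : ℕ => -((p + N : ℕ) : ℤ) := by
    intro p q hpq
    simp only at hpq
    omega
  have h1 := L2Z.hasSum_sq x
  rw [← hinj.hasSum_iff (by
    intro i hi
    rw [h0 i, sq, zero_mul]
    by_contra hlt
    exact hi ⟨(-i - N).toNat, by simp only; omega⟩)] at h1
  have h2 : ‖x‖ ^ 2 ≤ C ^ 2 := le_of_tendsto' h1.tendsto_sum_nat h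
  exact (pow_le_pow_iff_left₀ (norm_nonneg _) hC two_ne_zero).1 h2

theorem L2Z.norm_eq_of_shift {x y : L2Z} (h : ℤ) (hxy : ∀ i, y i = x (i - h)) : ‖y‖ = ‖x‖ := by
  have h1 := L2Z.hasSum_sq x
  rw [← (Equiv.subRight h).hasSum_iff] at h1
  have h2 : ‖x‖ ^ 2 = ‖y‖ ^ 2 := h1.unique ((L2Z.hasSum_sq y).congr_fun fun i => by simp [hxy])
  exact ((pow_left_inj₀ (norm_nonneg _) (norm_nonneg _) two_ne_zero).1 h2).symm

theorem sum_inv_mul_succ_le {N : ℕ} (hN : 0 < N) (n : ℕ) :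
    ∑ p ∈ Finset.range n, (((p + N : ℕ) : ℝ) * ((p + N : ℕ) + 1))⁻¹ ≤ (N : ℝ)⁻¹ := by
  have h : ∑ p ∈ Finset.range n, (((p + N : ℕ) : ℝ) * ((p + N : ℕ) + 1))⁻¹ =
      (N : ℝ)⁻¹ - ((n + N : ℕ) : ℝ)⁻¹ := by
    induction n with
    | zero => simp
    | succ n ih =>
      rw [Finset.sum_range_succ, ih]
      push_cast
      have : (0 : ℝ) < N := by positivity
      field_simp
      ring
  rw [h]
  have : (0 : ℝ) ≤ ((n + N : ℕ) : ℝ)⁻¹ := by positivity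
  linarith

theorem sum_rpow_neg_half_le (n : ℕ) :
    ∑ k ∈ Finset.range n, ((k : ℝ) + 1) ^ (-(1 / 2) : ℝ) ≤ 2 * √n := by
  induction n with
  | zero => simp
  | succ n ih =>
    rw [Finset.sum_range_succ]
    have h1 : ((n : ℝ) + 1) ^ (-(1 / 2) : ℝ) = (√((n : ℝ) + 1))⁻¹ := by
      rw [Real.rpow_neg (by positivity), Real.sqrt_eq_rpow]
    have h2 : 0 < √((n : ℝ) + 1) := by positivity
    have h3 : √((n : ℝ) + 1) ^ 2 = n + 1 := Real.sq_sqrt (by positivity)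
    have h4 : √(n : ℝ) ^ 2 = n := Real.sq_sqrt (by positivity)
    have h5 : (√((n : ℝ) + 1))⁻¹ ≤ 2 * √((n : ℝ) + 1) - 2 * √(n : ℝ) := by
      rw [inv_le_iff_one_le_mul₀ h2]
      nlinarith [sq_nonneg (√((n : ℝ) + 1) - √(n : ℝ))]
    push_cast
    linarith [h1 ▸ h5]

section Half

variable {a : ℕ → ℝ} {C : ℝ}

/-- The basic gain at d = 1/2: n consecutive values of S have absolute sum O(√n), uniformly in
position. Leading zeros at negative indices are discarded one at a time; from a nonnegative start
the majorant is decreasing. -/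
theorem sum_abs_partialSum_le (hC : 0 ≤ C)
    (hb : ∀ m : ℕ, |partialSumZ a m| ≤ C * ((m : ℝ) + 1) ^ (-(1 / 2) : ℝ)) (n : ℕ) (m : ℤ) :
    ∑ k ∈ Finset.range n, |partialSumZ a (m + k)| ≤ 2 * C * √n := by
  induction n generalizing m with
  | zero => simp
  | succ n ih =>
    rcases lt_or_ge m 0 with hm | hm
    · rw [Finset.sum_range_succ']
      have h1 := ih (m + 1)
      have h2 : √(n : ℝ) ≤ √((n + 1 : ℕ) : ℝ) := Real.sqrt_le_sqrt (by push_cast; linarith)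
      have h3 : ∀ k : ℕ, m + ((k + 1 : ℕ) : ℤ) = m + 1 + k := fun k => by push_cast; ring
      simp only [h3]
      rw [Nat.cast_zero, add_zero, partialSumZ_of_neg a hm, abs_zero, add_zero]
      exact h1.trans (by gcongr)
    · obtain ⟨q, rfl⟩ := Int.eq_ofNat_of_zero_le hm
      calc ∑ k ∈ Finset.range (n + 1), |partialSumZ a ((q : ℤ) + k)|
          ≤ ∑ k ∈ Finset.range (n + 1), C * ((k : ℝ) + 1) ^ (-(1 / 2) : ℝ) := by
            refine Finset.sum_le_sum fun k _ => ?_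
            have h1 := hb (q + k)
            push_cast at h1
            refine h1.trans ?_
            gcongr C * ?_
            exact Real.rpow_le_rpow_of_nonpos (by positivity)
              (by linarith [(Nat.cast_nonneg q : (0 : ℝ) ≤ q)]) (by norm_num)
        _ ≤ 2 * C * √((n + 1 : ℕ) : ℝ) := by
            rw [← Finset.mul_sum]
            have := mul_le_mul_of_nonneg_left (sum_rpow_neg_half_le (n + 1)) hC
            linarith

theorem sum_abs_partialSum_Icc_le (hC : 0 ≤ C)
    (hb : ∀ m : ℕ, |partialSumZ a m| ≤ C * ((m : ℝ) + 1) ^ (-(1 / 2) : ℝ)) (n : ℕ) (i : ℤ) :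
    ∑ k ∈ Finset.Icc 1 n, |partialSumZ a (k - i)| ≤ 2 * C * √n := by
  have h1 := sum_abs_partialSum_le hC hb n (1 - i)
  have h2 : ∑ k ∈ Finset.Icc 1 n, |partialSumZ a (k - i)| =
      ∑ k ∈ Finset.range n, |partialSumZ a (1 - i + k)| := by
    rw [Finset.range_eq_Ico]
    have := Finset.sum_Ico_add' (fun k : ℕ => |partialSumZ a ((k : ℤ) - i)|) 0 n 1
    refine Eq.trans (by rfl) (this.symm.trans (Finset.sum_congr rfl fun k _ => ?_))
    push_cast
    congr 2
    ring
  rwa [h2]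

/-- Duality of ℓ¹ and ℓ^∞: the absolute sum of a block is O(√N), so pairing with a vector of entries
O(N^(-1/2)) costs only a constant. -/
theorem abs_inner_block_le (hC : 0 ≤ C)
    (hb : ∀ m : ℕ, |partialSumZ a m| ≤ C * ((m : ℝ) + 1) ^ (-(1 / 2) : ℝ)) (h : ℤ) {I : Finset ℕ}
    {N : ℕ} (hI : I ⊆ Finset.range N) {z : L2Z} {ρ : ℝ} (hz : ∀ i, |z i| ≤ ρ) :
    |inner ℝ (block a h I) z| ≤ 2 * C * √N * ρ := by
  have hρ : 0 ≤ ρ := (abs_nonneg _).trans (hz 0)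
  rw [inner_block]
  calc |∑ p ∈ I, partialSumZ a p * z (h - p)| ≤ ∑ p ∈ I, |partialSumZ a p| * ρ := by
        refine (Finset.abs_sum_le_sum_abs _ _).trans (Finset.sum_le_sum fun p _ => ?_)
        rw [abs_mul]
        gcongr
        exact hz _
    _ ≤ ∑ p ∈ Finset.range N, |partialSumZ a p| * ρ :=
        Finset.sum_le_sum_of_subset_of_nonneg hI fun p _ _ => by positivity
    _ ≤ _ := by
        rw [← Finset.sum_mul]
        have := sum_abs_partialSum_le hC hb N 0
        simp only [zero_add] at this
        gcongr

/-- Up to a bounded error, an increment vector is a difference of two blocks. -/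
theorem norm_increment_sub_block_le {s : ℕ → L2Z}
    (hs : ∀ k i, s k i = partialSumZ a (k - i) - partialSumZ a (-i)) (hC : 0 ≤ C)
    (hi : ∀ m k : ℕ, |partialSumZ a (m + k : ℕ) - partialSumZ a m| ≤
      C * k * ((m : ℝ) + 1) ^ (-(1 / 2) - 1 : ℝ)) {k N : ℕ} (hk : k ≤ N) :
    ‖s k - (block a k (Finset.range (N + k + 1)) - block a 0 (Finset.range (N + 1)))‖ ≤ C := by
  apply L2Z.norm_le_of_sum_range (N := N + 1) hC
  · intro i hi0
    simp only [lp.coeFn_sub, Pi.sub_apply, hs, block_apply, Finset.mem_range, zero_sub]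
    rw [if_pos (by omega), if_pos (by omega), sub_self]
  · intro n
    -- Past the cut-off, the entries are increments S(q+k) - S(q) of size at most Ck(q+1)^(-3/2).
    -- With k ≤ N + 1 ≤ q, their squares are dominated by a telescoping series of total C².
    have hterm : ∀ p : ℕ, (s k - (block a k (Finset.range (N + k + 1)) -
        block a 0 (Finset.range (N + 1))) : L2Z) (-((p + (N + 1) : ℕ) : ℤ)) ^ 2 ≤
        C ^ 2 * (N + 1 : ℕ) * (((p + (N + 1) : ℕ) : ℝ) * ((p + (N + 1) : ℕ) + 1))⁻¹ := by
      intro p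
      simp only [lp.coeFn_sub, Pi.sub_apply, hs, block_apply, Finset.mem_range, zero_sub]
      rw [if_neg (by omega), if_neg (by omega), sub_zero, sub_zero]
      have h1 := hi (p + (N + 1)) k
      set q := p + (N + 1) with hq
      have h2 : (k : ℤ) - -(q : ℤ) = ((q + k : ℕ) : ℤ) := by push_cast; ring
      rw [h2, neg_neg, ← sq_abs]
      have hkN : (k : ℝ) ≤ (N + 1 : ℕ) := by exact_mod_cast hk.trans (Nat.le_succ N)
      have hNq : ((N + 1 : ℕ) : ℝ) ≤ q := by exact_mod_cast (by omega : N + 1 ≤ q)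
      have hN0 : (0 : ℝ) < (N + 1 : ℕ) := by positivity
      have hq0 : (0 : ℝ) < q := hN0.trans_le hNq
      have h3 : (((q : ℝ) + 1) ^ (-(1 / 2) - 1 : ℝ)) ^ 2 = (((q : ℝ) + 1) ^ 3)⁻¹ := by
        rw [← Real.rpow_natCast, ← Real.rpow_natCast, ← Real.rpow_neg (by positivity),
          ← Real.rpow_mul (by positivity)]
        norm_num
      calc |partialSumZ a ((q + k : ℕ) : ℤ) - partialSumZ a q| ^ 2
          ≤ (C * k * ((q : ℝ) + 1) ^ (-(1 / 2) - 1 : ℝ)) ^ 2 := by gcongr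
        _ = C ^ 2 * (k : ℝ) ^ 2 * (((q : ℝ) + 1) ^ 3)⁻¹ := by rw [mul_pow, mul_pow, h3]
        _ ≤ C ^ 2 * ((N + 1 : ℕ) * q) * ((q : ℝ) * q * (q + 1))⁻¹ := by
            have : (k : ℝ) ^ 2 ≤ (N + 1 : ℕ) * q := by
              rw [sq]; exact mul_le_mul hkN (hkN.trans hNq) (by positivity) (by positivity)
            have h4 : (q : ℝ) * q * (q + 1) ≤ ((q : ℝ) + 1) ^ 3 := by nlinarith
            gcongr
        _ = _ := by field_simp
    calc _ ≤ ∑ p ∈ Finset.range n,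
          C ^ 2 * (N + 1 : ℕ) * (((p + (N + 1) : ℕ) : ℝ) * ((p + (N + 1) : ℕ) + 1))⁻¹ :=
          Finset.sum_le_sum fun p _ => hterm p
      _ ≤ C ^ 2 * (N + 1 : ℕ) * ((N + 1 : ℕ) : ℝ)⁻¹ := by
          rw [← Finset.mul_sum]
          gcongr
          exact sum_inv_mul_succ_le N.succ_pos n
      _ = C ^ 2 := by
          have : ((N + 1 : ℕ) : ℝ) ≠ 0 := by positivity
          field_simp

/-- The average `n⁻¹ ∑_{k=1}^n θ_k w_k` of the blocks `w_k` ending at `k`. -/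
noncomputable def blockMean (a : ℕ → ℝ) (θ : ℕ → ℝ) (n : ℕ) : L2Z :=
  (n : ℝ)⁻¹ • ∑ k ∈ Finset.Icc 1 n, θ k • block a k (Finset.range (n + k + 1))

theorem abs_blockMean_le (hC : 0 ≤ C)
    (hb : ∀ m : ℕ, |partialSumZ a m| ≤ C * ((m : ℝ) + 1) ^ (-(1 / 2) : ℝ)) {θ : ℕ → ℝ}
    (hθ : ∀ k, |θ k| ≤ 1) (n : ℕ) (i : ℤ) : |blockMean a θ n i| ≤ 2 * C / √n := by
  rcases eq_or_ne n 0 with rfl | hn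
  · simp [blockMean]
  have h0 : (0 : ℝ) < n := by positivity
  rw [blockMean, lp.coeFn_smul, Pi.smul_apply, L2Z.coeFn_finsetSum, smul_eq_mul, abs_mul, abs_inv,
    Nat.abs_cast, inv_mul_le_iff₀ h0]
  calc _ ≤ ∑ k ∈ Finset.Icc 1 n, |partialSumZ a (k - i)| := by
        refine (Finset.abs_sum_le_sum_abs _ _).trans (Finset.sum_le_sum fun k _ => ?_)
        rw [lp.coeFn_smul, Pi.smul_apply, smul_eq_mul, abs_mul]
        exact (mul_le_of_le_one_left (abs_nonneg _) (hθ k)).trans (abs_block_apply_le _ _ _ _)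
    _ ≤ 2 * C * √n := sum_abs_partialSum_Icc_le hC hb n i
    _ = n * (2 * C / √n) := by
        have h1 : 0 < √(n : ℝ) := Real.sqrt_pos.2 h0
        have h2 : √(n : ℝ) ^ 2 = n := Real.sq_sqrt h0.le
        field_simp
        linear_combination C * h2

theorem sqrt_natCast_le_two_mul {n N : ℕ} (h : N ≤ 4 * n) : √(N : ℝ) ≤ 2 * √n := by
  have : (N : ℝ) ≤ 2 ^ 2 * n := by norm_num; exact_mod_cast h
  calc √(N : ℝ) ≤ √(2 ^ 2 * n) := Real.sqrt_le_sqrt this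
    _ = 2 * √n := by rw [Real.sqrt_mul (by positivity), Real.sqrt_sq (by norm_num)]

/-- In ‖v‖² = ⟨v, v⟩ one factor is expanded as an average of blocks and the other is bounded
entrywise by 2C/√n. Each block has absolute sum at most 4C√n, so ‖v‖² ≤ 8C² ≤ (3C)². -/
theorem norm_blockMean_le (hC : 0 ≤ C)
    (hb : ∀ m : ℕ, |partialSumZ a m| ≤ C * ((m : ℝ) + 1) ^ (-(1 / 2) : ℝ)) {θ : ℕ → ℝ}
    (hθ : ∀ k, |θ k| ≤ 1) (n : ℕ) : ‖blockMean a θ n‖ ≤ 3 * C := by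
  rcases eq_or_ne n 0 with rfl | hn
  · simpa [blockMean] using hC
  have h0 : (0 : ℝ) < n := by positivity
  have h1 : 0 < √(n : ℝ) := Real.sqrt_pos.2 h0
  have h2 : ‖blockMean a θ n‖ ^ 2 ≤ 8 * C ^ 2 := by
    rw [← real_inner_self_eq_norm_sq]
    nth_rewrite 1 [blockMean]
    rw [real_inner_smul_left, sum_inner, inv_mul_le_iff₀ h0]
    refine (le_abs_self _).trans ((Finset.abs_sum_le_sum_abs _ _).trans ?_)
    calc _ ≤ ∑ k ∈ Finset.Icc 1 n, 8 * C ^ 2 := by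
          refine Finset.sum_le_sum fun k hk => ?_
          rw [Finset.mem_Icc] at hk
          rw [real_inner_smul_left, abs_mul]
          refine (mul_le_of_le_one_left (abs_nonneg _) (hθ k)).trans ?_
          refine (abs_inner_block_le hC hb k subset_rfl (abs_blockMean_le hC hb hθ n)).trans ?_
          have h3 := sqrt_natCast_le_two_mul (n := n) (N := n + k + 1) (by omega)
          calc 2 * C * √((n + k + 1 : ℕ) : ℝ) * (2 * C / √n)
              ≤ 2 * C * (2 * √n) * (2 * C / √n) := by gcongr
            _ = 8 * C ^ 2 := by field_simp; ring
      _ = n * (8 * C ^ 2) := by simp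
  refine (pow_le_pow_iff_left₀ (norm_nonneg _) (by positivity) two_ne_zero).1 (h2.trans ?_)
  nlinarith [sq_nonneg C]

/-- The weighted average of the increment vectors. -/
noncomputable def weightedMeanVec (s : ℕ → L2Z) (θ : ℕ → ℝ) (n : ℕ) : L2Z :=
  (n : ℝ)⁻¹ • ∑ k ∈ Finset.Icc 1 n, θ k • s k

theorem weightedMeanVec_one (s : ℕ → L2Z) (n : ℕ) :
    weightedMeanVec s (fun _ => 1) n = meanVec s n := by
  simp [weightedMeanVec, meanVec]

/-- The cut-off n is common to all k, so the subtracted block at 0 is the same each time and is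
multiplied by the average weight. -/
theorem norm_weightedMeanVec_sub_le {s : ℕ → L2Z}
    (hs : ∀ k i, s k i = partialSumZ a (k - i) - partialSumZ a (-i)) (hC : 0 ≤ C)
    (hi : ∀ m k : ℕ, |partialSumZ a (m + k : ℕ) - partialSumZ a m| ≤
      C * k * ((m : ℝ) + 1) ^ (-(1 / 2) - 1 : ℝ)) {θ : ℕ → ℝ} (hθ : ∀ k, |θ k| ≤ 1) (n : ℕ) :
    ‖weightedMeanVec s θ n - (blockMean a θ n -
      ((n : ℝ)⁻¹ * ∑ k ∈ Finset.Icc 1 n, θ k) • block a 0 (Finset.range (n + 1)))‖ ≤ C := by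
  have h1 : weightedMeanVec s θ n - (blockMean a θ n -
      ((n : ℝ)⁻¹ * ∑ k ∈ Finset.Icc 1 n, θ k) • block a 0 (Finset.range (n + 1))) =
      (n : ℝ)⁻¹ • ∑ k ∈ Finset.Icc 1 n, θ k •
        (s k - (block a k (Finset.range (n + k + 1)) - block a 0 (Finset.range (n + 1)))) := by
    simp only [weightedMeanVec, blockMean, smul_sub, Finset.sum_sub_distrib, mul_smul,
      Finset.sum_smul]
  rcases eq_or_ne n 0 with rfl | hn
  · rw [h1]; simpa using hC
  have h0 : (0 : ℝ) < n := by positivity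
  rw [h1, norm_smul, norm_inv, Real.norm_natCast, inv_mul_le_iff₀ h0]
  calc _ ≤ ∑ k ∈ Finset.Icc 1 n, C := by
        refine (norm_sum_le _ _).trans (Finset.sum_le_sum fun k hk => ?_)
        rw [norm_smul]
        exact (mul_le_of_le_one_left (norm_nonneg _) (hθ k)).trans
          (norm_increment_sub_block_le hs hC hi (Finset.mem_Icc.1 hk).2)
    _ = n * C := by simp

/-- With constant weights the averaged blocks are bounded and only the block at 0 survives. This is
why the mean has variance of order log n. -/
theorem norm_meanVec_add_block_le {s : ℕ → L2Z}
    (hs : ∀ k i, s k i = partialSumZ a (k - i) - partialSumZ a (-i)) (hC : 0 ≤ C)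
    (hb : ∀ m : ℕ, |partialSumZ a m| ≤ C * ((m : ℝ) + 1) ^ (-(1 / 2) : ℝ))
    (hi : ∀ m k : ℕ, |partialSumZ a (m + k : ℕ) - partialSumZ a m| ≤
      C * k * ((m : ℝ) + 1) ^ (-(1 / 2) - 1 : ℝ)) {n : ℕ} (hn : n ≠ 0) :
    ‖meanVec s n + block a 0 (Finset.range (n + 1))‖ ≤ 4 * C := by
  have h1 := norm_weightedMeanVec_sub_le hs hC hi (θ := fun _ => 1) (by simp) n
  have h2 := norm_blockMean_le hC hb (θ := fun _ => 1) (by simp) n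
  have h0 : (n : ℝ) ≠ 0 := by positivity
  rw [weightedMeanVec_one, Finset.sum_const, Nat.card_Icc, Nat.add_sub_cancel, nsmul_one,
    inv_mul_cancel₀ h0, one_smul] at h1
  have e : meanVec s n + block a 0 (Finset.range (n + 1)) =
      (meanVec s n - (blockMean a (fun _ => 1) n - block a 0 (Finset.range (n + 1)))) +
        blockMean a (fun _ => 1) n := by abel
  rw [e]
  exact (norm_add_le _ _).trans (by linarith)

/-- Weights of sum zero eliminate the block at 0, the only unbounded part. -/
theorem norm_weightedMeanVec_le {s : ℕ → L2Z}
    (hs : ∀ k i, s k i = partialSumZ a (k - i) - partialSumZ a (-i)) (hC : 0 ≤ C)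
    (hb : ∀ m : ℕ, |partialSumZ a m| ≤ C * ((m : ℝ) + 1) ^ (-(1 / 2) : ℝ))
    (hi : ∀ m k : ℕ, |partialSumZ a (m + k : ℕ) - partialSumZ a m| ≤
      C * k * ((m : ℝ) + 1) ^ (-(1 / 2) - 1 : ℝ)) {θ : ℕ → ℝ} (hθ : ∀ k, |θ k| ≤ 1) {n : ℕ}
    (h0 : ∑ k ∈ Finset.Icc 1 n, θ k = 0) : ‖weightedMeanVec s θ n‖ ≤ 4 * C := by
  have h1 := norm_weightedMeanVec_sub_le hs hC hi hθ n
  have h2 := norm_blockMean_le hC hb hθ n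
  rw [h0, mul_zero, zero_smul, sub_zero] at h1
  have e : weightedMeanVec s θ n = (weightedMeanVec s θ n - blockMean a θ n) + blockMean a θ n := by
    abel
  rw [e]
  exact (norm_add_le _ _).trans (by linarith)

theorem abs_weightedMeanVec_le {s : ℕ → L2Z}
    (hs : ∀ k i, s k i = partialSumZ a (k - i) - partialSumZ a (-i)) (hC : 0 ≤ C)
    (hb : ∀ m : ℕ, |partialSumZ a m| ≤ C * ((m : ℝ) + 1) ^ (-(1 / 2) : ℝ)) {θ : ℕ → ℝ}
    (hθ : ∀ k, |θ k| ≤ 1) {n : ℕ} (h0 : ∑ k ∈ Finset.Icc 1 n, θ k = 0) (i : ℤ) :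
    |weightedMeanVec s θ n i| ≤ 2 * C / √n := by
  rcases eq_or_ne n 0 with rfl | hn
  · simp [weightedMeanVec]
  have hn0 : (0 : ℝ) < n := by positivity
  have h2 : ∑ k ∈ Finset.Icc 1 n, (θ k • s k : L2Z) i =
      ∑ k ∈ Finset.Icc 1 n, θ k * partialSumZ a (k - i) := by
    simp only [lp.coeFn_smul, Pi.smul_apply, smul_eq_mul, hs, mul_sub, Finset.sum_sub_distrib,
      ← Finset.sum_mul, h0, zero_mul, sub_zero]
  rw [weightedMeanVec, lp.coeFn_smul, Pi.smul_apply, L2Z.coeFn_finsetSum, smul_eq_mul, abs_mul,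
    abs_inv, Nat.abs_cast, inv_mul_le_iff₀ hn0, h2]
  calc _ ≤ ∑ k ∈ Finset.Icc 1 n, |partialSumZ a (k - i)| := by
        refine (Finset.abs_sum_le_sum_abs _ _).trans (Finset.sum_le_sum fun k _ => ?_)
        rw [abs_mul]
        exact mul_le_of_le_one_left (abs_nonneg _) (hθ k)
    _ ≤ 2 * C * √n := sum_abs_partialSum_Icc_le hC hb n i
    _ = n * (2 * C / √n) := by
        have h1 : 0 < √(n : ℝ) := Real.sqrt_pos.2 hn0
        have h2 : √(n : ℝ) ^ 2 = n := Real.sq_sqrt hn0.le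
        field_simp
        linear_combination C * h2

end Half

end LongMemory

/-! ### The case d = 1/2: logarithmic variances of the mean and of D_n -/

namespace LongMemory

theorem tendsto_log_natCast : Tendsto (fun n : ℕ => Real.log n) atTop atTop :=
  Real.tendsto_log_atTop.comp tendsto_natCast_atTop_atTop

theorem tendsto_log_div_log {u : ℕ → ℕ} (h1 : ∀ n, n ≤ u n) (h2 : ∀ᶠ n in atTop, u n ≤ 4 * n) :
    Tendsto (fun n => Real.log (u n) / Real.log n) atTop (𝓝 1) := by
  have h3 : Tendsto (fun n : ℕ => 1 + Real.log 4 / Real.log n) atTop (𝓝 1) := by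
    simpa using (tendsto_log_natCast.const_div_atTop (Real.log 4)).const_add 1
  refine tendsto_of_tendsto_of_tendsto_of_le_of_le' tendsto_const_nhds h3 ?_ ?_
  · filter_upwards [tendsto_log_natCast.eventually_gt_atTop 0, eventually_gt_atTop 0] with n hn hn0
    rw [le_div_iff₀ hn, one_mul]
    exact Real.log_le_log (by positivity) (by exact_mod_cast h1 n)
  · filter_upwards [tendsto_log_natCast.eventually_gt_atTop 0, eventually_gt_atTop 0, h2]
      with n hn hn0 h
    have hu : (0 : ℝ) < u n := by exact_mod_cast hn0.trans_le (h1 n)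
    have h4 : Real.log (u n) ≤ Real.log 4 + Real.log n := by
      rw [← Real.log_mul (by norm_num) (by positivity)]
      exact Real.log_le_log hu (by exact_mod_cast h)
    rw [div_le_iff₀ hn, add_mul, one_mul, div_mul_cancel₀ _ hn.ne']
    linarith

theorem tendsto_log_sqrt_succ_div_log :
    Tendsto (fun n : ℕ => Real.log ((n.sqrt + 1 : ℕ) : ℝ) / Real.log n) atTop (𝓝 (1 / 2)) := by
  have h := tendsto_log_div_log (u := fun n => (n.sqrt + 1) ^ 2)
    (fun n => by simpa [sq] using (Nat.lt_succ_sqrt n).le)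
    (by
      filter_upwards [eventually_ge_atTop 1] with n hn
      have h1 := Nat.sqrt_le' n
      have h2 : 1 ≤ n.sqrt := Nat.sqrt_pos.2 hn
      nlinarith)
  refine (h.div_const 2).congr fun n => ?_
  rw [Nat.cast_pow, Real.log_pow]
  push_cast
  ring

/-- A bounded error changes the squared norm by at most K(2‖y‖ + K), which is O(√(log n)). -/
theorem tendsto_norm_sq_div_log_of_norm_sub_le {x y : ℕ → L2Z} {K v : ℝ}
    (h : ∀ᶠ n in atTop, ‖x n - y n‖ ≤ K)
    (hy : Tendsto (fun n : ℕ => ‖y n‖ ^ 2 / Real.log n) atTop (𝓝 v)) :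
    Tendsto (fun n : ℕ => ‖x n‖ ^ 2 / Real.log n) atTop (𝓝 v) := by
  have hl := tendsto_log_natCast
  have h1 : Tendsto (fun n : ℕ => (√(Real.log n))⁻¹) atTop (𝓝 0) :=
    (Real.tendsto_sqrt_atTop.comp hl).inv_tendsto_atTop
  have h2 : Tendsto (fun n : ℕ => 2 * K * (√(‖y n‖ ^ 2 / Real.log n) * (√(Real.log n))⁻¹) +
      K ^ 2 / Real.log n) atTop (𝓝 0) := by
    simpa using ((hy.sqrt.mul h1).const_mul (2 * K)).add (hl.const_div_atTop (K ^ 2))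
  have h3 : Tendsto (fun n : ℕ => ‖x n‖ ^ 2 / Real.log n - ‖y n‖ ^ 2 / Real.log n) atTop
      (𝓝 0) := by
    refine squeeze_zero_norm' ?_ h2
    filter_upwards [h, hl.eventually_gt_atTop 0] with n hn hln
    have hK : 0 ≤ K := (norm_nonneg _).trans hn
    have h5 : |‖x n‖ - ‖y n‖| ≤ K := (abs_norm_sub_norm_le _ _).trans hn
    have h6 : |‖x n‖ ^ 2 - ‖y n‖ ^ 2| ≤ 2 * K * ‖y n‖ + K ^ 2 := by
      have h7 := norm_nonneg (x n)
      have h8 := norm_nonneg (y n)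
      have h9 : ‖x n‖ + ‖y n‖ ≤ 2 * ‖y n‖ + K := by linarith [(abs_le.1 h5).2]
      calc |‖x n‖ ^ 2 - ‖y n‖ ^ 2| = |‖x n‖ - ‖y n‖| * (‖x n‖ + ‖y n‖) := by
            rw [sq_sub_sq, abs_mul, abs_of_nonneg (by positivity : 0 ≤ ‖x n‖ + ‖y n‖), mul_comm]
        _ ≤ K * (2 * ‖y n‖ + K) := by gcongr
        _ = _ := by ring
    rw [Real.norm_eq_abs, ← sub_div, abs_div, abs_of_pos hln, Real.sqrt_div' _ hln.le,
      Real.sqrt_sq (norm_nonneg _)]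
    have h10 : √(Real.log n) * √(Real.log n) = Real.log n := Real.mul_self_sqrt hln.le
    have h11 : ‖y n‖ / √(Real.log n) * (√(Real.log n))⁻¹ = ‖y n‖ / Real.log n := by
      rw [← div_eq_mul_inv, div_div, h10]
    rw [h11, ← mul_div_assoc, ← add_div]
    gcongr
  simpa using h3.add hy

/-- The coefficients of the difference of the initial and final means. -/
noncomputable def meanDiffVec (s : ℕ → L2Z) (n : ℕ) : L2Z :=
  (n.sqrt : ℝ)⁻¹ • (∑ k ∈ Finset.Icc 1 n.sqrt, s k - ∑ k ∈ Finset.Icc (n - n.sqrt + 1) n, s k)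

theorem sum_Icc_sub_add_one {M : Type*} [AddCommMonoid M] {m n : ℕ} (h : m ≤ n) (f : ℕ → M) :
    ∑ k ∈ Finset.Icc (n - m + 1) n, f k = ∑ j ∈ Finset.Icc 1 m, f (j + (n - m)) := by
  have h1 := Finset.sum_Ico_add' f 1 (m + 1) (n - m)
  rw [show 1 + (n - m) = n - m + 1 by omega, show m + 1 + (n - m) = n + 1 by omega] at h1
  exact h1.symm

/-- The main part of `meanDiffVec`. -/
noncomputable def meanDiffMain (a : ℕ → ℝ) (n : ℕ) : L2Z :=
  block a 0 (Finset.range (n + 1) \ Finset.range (n.sqrt + 1)) -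
    block a ((n - n.sqrt : ℕ) : ℤ)
      (Finset.range (n + (n - n.sqrt) + 1) \ Finset.range (n.sqrt + 1))

section Half

variable {a : ℕ → ℝ} {C : ℝ} {s : ℕ → L2Z}

/-- With h = n - m, the initial mean is minus the first m + 1 terms of the block at 0. By
stationarity the final mean is s_h minus the first m + 1 terms of the block at h, and s_h is itself
a difference of the two blocks. The errors are 4C, 4C and C. -/
theorem norm_meanDiffVec_sub_le
    (hs : ∀ k i, s k i = partialSumZ a (k - i) - partialSumZ a (-i)) (hC : 0 ≤ C)
    (hb : ∀ m : ℕ, |partialSumZ a m| ≤ C * ((m : ℝ) + 1) ^ (-(1 / 2) : ℝ))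
    (hi : ∀ m k : ℕ, |partialSumZ a (m + k : ℕ) - partialSumZ a m| ≤
      C * k * ((m : ℝ) + 1) ^ (-(1 / 2) - 1 : ℝ)) {n : ℕ} (hn : 0 < n) :
    ‖meanDiffVec s n - meanDiffMain a n‖ ≤ 9 * C := by
  set m := n.sqrt with hm
  have hm0 : 0 < m := Nat.sqrt_pos.2 hn
  have hmn : m ≤ n := Nat.sqrt_le_self n
  have hmR : (m : ℝ) ≠ 0 := by positivity
  set h := n - m with hh
  set x := meanVec s m + block a 0 (Finset.range (m + 1)) with hx
  have hx4 : ‖x‖ ≤ 4 * C := norm_meanVec_add_block_le hs hC hb hi hm0.ne'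
  set l : L2Z := (m : ℝ)⁻¹ • ∑ k ∈ Finset.Icc (n - m + 1) n, s k with hl
  set y := l - s h + block a h (Finset.range (m + 1)) with hy
  have hy4 : ‖y‖ ≤ 4 * C := by
    rw [L2Z.norm_eq_of_shift (x := x) (y := y) h]
    · exact hx4
    intro i
    simp only [hy, hx, hl, meanVec, lp.coeFn_add, lp.coeFn_sub, Pi.add_apply, Pi.sub_apply,
      lp.coeFn_smul, Pi.smul_apply, smul_eq_mul, L2Z.coeFn_finsetSum, sum_Icc_sub_add_one hmn]
    have h1 : block a 0 (Finset.range (m + 1)) (i - h) = block a h (Finset.range (m + 1)) i := by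
      rw [block_apply, block_apply]
      simp
    have h2 : ∑ j ∈ Finset.Icc 1 m, s j (i - h) =
        ∑ j ∈ Finset.Icc 1 m, s (j + (n - m)) i - m * s h i := by
      have : (m : ℝ) * s h i = ∑ j ∈ Finset.Icc 1 m, s h i := by simp
      rw [this, ← Finset.sum_sub_distrib]
      refine Finset.sum_congr rfl fun j _ => ?_
      simp only [hs, hh]
      push_cast
      have e1 : (j : ℤ) - (i - ((n - m : ℕ) : ℤ)) = j + ((n - m : ℕ) : ℤ) - i := by ring
      have e2 : -(i - ((n - m : ℕ) : ℤ)) = ((n - m : ℕ) : ℤ) - i := by ring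
      rw [e1, e2]
      ring
    rw [h1, h2]
    field_simp
  have hτ := norm_increment_sub_block_le hs hC hi (k := h) (N := n) (by omega)
  have e : meanDiffVec s n - meanDiffMain a n =
      x - y - (s h - (block a h (Finset.range (n + h + 1)) -
        block a 0 (Finset.range (n + 1)))) := by
    have hsub1 : Finset.range (m + 1) ⊆ Finset.range (n + 1) :=
      Finset.range_subset_range.2 (by omega)
    have hsub2 : Finset.range (m + 1) ⊆ Finset.range (n + h + 1) :=
      Finset.range_subset_range.2 (by omega)
    rw [meanDiffVec, meanDiffMain, ← hm, ← hh, ← block_sub_block a _ hsub1,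
      ← block_sub_block a _ hsub2, smul_sub, hx, hy, hl, meanVec]
    abel
  rw [e]
  calc _ ≤ ‖x‖ + ‖y‖ + _ := (norm_sub_le _ _).trans (add_le_add_left (norm_sub_le _ _) _)
    _ ≤ 4 * C + 4 * C + C := by gcongr
    _ = 9 * C := by ring

theorem two_mul_sqrt_le (n : ℕ) : 2 * n.sqrt ≤ n + 1 := by
  have := Nat.sqrt_le' n
  zify at this ⊢
  nlinarith [sq_nonneg ((n.sqrt : ℤ) - 1)]

/-- On the support of the block at 0, the block at h is indexed from h on, where S is at most
C/√(h+1); the absolute sum O(√n) of the first block is compensated because h is comparable to n. -/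
theorem abs_inner_block_block_le (hC : 0 ≤ C)
    (hb : ∀ m : ℕ, |partialSumZ a m| ≤ C * ((m : ℝ) + 1) ^ (-(1 / 2) : ℝ)) {h n : ℕ}
    (hn : n + 1 ≤ 4 * (h + 1)) (I J : Finset ℕ) (hI : I ⊆ Finset.range (n + 1)) :
    |inner ℝ (block a 0 I) (block a h J)| ≤ 4 * C ^ 2 := by
  rw [inner_block]
  have hpos : 0 < √((h + 1 : ℕ) : ℝ) := Real.sqrt_pos.2 (by positivity)
  have h1 : ∀ p : ℕ, |block a h J (0 - p)| ≤ C / √((h + 1 : ℕ) : ℝ) := by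
    intro p
    refine (abs_block_apply_le _ _ _ _).trans ?_
    have h2 := hb (h + p)
    rw [show (h : ℤ) - (0 - p) = ((h + p : ℕ) : ℤ) by push_cast; ring]
    refine h2.trans ?_
    rw [div_eq_mul_inv C, Real.sqrt_eq_rpow, ← Real.rpow_neg (by positivity)]
    gcongr C * ?_
    exact Real.rpow_le_rpow_of_nonpos (by positivity)
      (by push_cast; linarith [(Nat.cast_nonneg p : (0 : ℝ) ≤ p)]) (by norm_num)
  calc _ ≤ ∑ p ∈ I, |partialSumZ a p| * (C / √((h + 1 : ℕ) : ℝ)) := by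
        refine (Finset.abs_sum_le_sum_abs _ _).trans (Finset.sum_le_sum fun p _ => ?_)
        rw [abs_mul]
        gcongr
        exact h1 p
    _ ≤ ∑ p ∈ Finset.range (n + 1), |partialSumZ a p| * (C / √((h + 1 : ℕ) : ℝ)) :=
        Finset.sum_le_sum_of_subset_of_nonneg hI fun p _ _ => by positivity
    _ ≤ 2 * C * √((n + 1 : ℕ) : ℝ) * (C / √((h + 1 : ℕ) : ℝ)) := by
        rw [← Finset.sum_mul]
        have := sum_abs_partialSum_le hC hb (n + 1) 0
        simp only [zero_add] at this
        gcongr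
    _ ≤ 2 * C * (2 * √((h + 1 : ℕ) : ℝ)) * (C / √((h + 1 : ℕ) : ℝ)) := by
        gcongr
        exact sqrt_natCast_le_two_mul hn
    _ = 4 * C ^ 2 := by field_simp; ring

theorem sum_sdiff_range {f : ℕ → ℝ} {m n : ℕ} (h : m ≤ n) :
    ∑ p ∈ Finset.range n \ Finset.range m, f p =
      ∑ p ∈ Finset.range n, f p - ∑ p ∈ Finset.range m, f p := by
  rw [eq_sub_iff_add_eq, Finset.sum_sdiff (Finset.range_subset_range.2 h)]

theorem HasMemory.tendsto_sum_sq_partialSum {c : ℝ} (h : HasMemory (-(1 / 2)) c a) :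
    Tendsto (fun n : ℕ => (∑ m ∈ Finset.range n, partialSumZ a m ^ 2) / Real.log n) atTop
      (𝓝 (4 * c ^ 2)) := by
  apply tendsto_sum_div_log
  have h1 := (h.tendsto_partialSum_div (by norm_num)).pow 2
  rw [show (c / -(1 / 2)) ^ 2 = 4 * c ^ 2 by ring] at h1
  refine h1.congr fun n => ?_
  rw [div_pow, ← Real.rpow_natCast ((n : ℝ) ^ _), ← Real.rpow_mul n.cast_nonneg,
    show (-(1 / 2) : ℝ) * ((2 : ℕ) : ℝ) = -1 by norm_num, Real.rpow_neg_one]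

theorem HasMemory.tendsto_sum_sq_partialSum_comp {c r : ℝ} (h : HasMemory (-(1 / 2)) c a)
    {u : ℕ → ℕ} (hu : Tendsto u atTop atTop)
    (hr : Tendsto (fun n => Real.log (u n) / Real.log n) atTop (𝓝 r)) :
    Tendsto (fun n : ℕ => (∑ m ∈ Finset.range (u n), partialSumZ a m ^ 2) / Real.log n) atTop
      (𝓝 (4 * c ^ 2 * r)) := by
  refine ((h.tendsto_sum_sq_partialSum.comp hu).mul hr).congr' ?_
  filter_upwards [(tendsto_log_natCast.comp hu).eventually_gt_atTop 0] with n hn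
  simp only [Function.comp_apply] at hn ⊢
  field_simp

theorem tendsto_natSqrt : Tendsto Nat.sqrt atTop atTop :=
  tendsto_atTop_atTop.2 fun b => ⟨b ^ 2, fun n hn => by
    rw [Nat.le_sqrt']; exact hn⟩

theorem HasMemory.tendsto_norm_meanVec_sq_div_log {c : ℝ} (h : HasMemory (-(1 / 2)) c a)
    (hs : ∀ k i, s k i = partialSumZ a (k - i) - partialSumZ a (-i)) (hC : 0 ≤ C)
    (hb : ∀ m : ℕ, |partialSumZ a m| ≤ C * ((m : ℝ) + 1) ^ (-(1 / 2) : ℝ))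
    (hi : ∀ m k : ℕ, |partialSumZ a (m + k : ℕ) - partialSumZ a m| ≤
      C * k * ((m : ℝ) + 1) ^ (-(1 / 2) - 1 : ℝ)) :
    Tendsto (fun n : ℕ => ‖meanVec s n‖ ^ 2 / Real.log n) atTop (𝓝 (4 * c ^ 2)) := by
  apply tendsto_norm_sq_div_log_of_norm_sub_le (K := 4 * C)
    (y := fun n => -block a 0 (Finset.range (n + 1)))
  · filter_upwards [eventually_ne_atTop 0] with n hn
    rw [sub_neg_eq_add]
    exact norm_meanVec_add_block_le hs hC hb hi hn
  · simp only [norm_neg, norm_block_sq]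
    have := h.tendsto_sum_sq_partialSum_comp (tendsto_add_atTop_nat 1)
      (tendsto_log_div_log (u := fun n => n + 1) (fun n => n.le_succ)
        (by filter_upwards [eventually_gt_atTop 0] with n hn; omega))
    rwa [mul_one] at this

/-- Each of the two blocks has lost its first √n terms and keeps log n - log √n, half the logarithm.
The cross term is bounded, so the halves add up to the same 4c² as for the mean. -/
theorem HasMemory.tendsto_norm_meanDiffVec_sq_div_log {c : ℝ} (h : HasMemory (-(1 / 2)) c a)
    (hs : ∀ k i, s k i = partialSumZ a (k - i) - partialSumZ a (-i)) (hC : 0 ≤ C)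
    (hb : ∀ m : ℕ, |partialSumZ a m| ≤ C * ((m : ℝ) + 1) ^ (-(1 / 2) : ℝ))
    (hi : ∀ m k : ℕ, |partialSumZ a (m + k : ℕ) - partialSumZ a m| ≤
      C * k * ((m : ℝ) + 1) ^ (-(1 / 2) - 1 : ℝ)) :
    Tendsto (fun n : ℕ => ‖meanDiffVec s n‖ ^ 2 / Real.log n) atTop (𝓝 (4 * c ^ 2)) := by
  apply tendsto_norm_sq_div_log_of_norm_sub_le (K := 9 * C) (y := meanDiffMain a)
  · filter_upwards [eventually_gt_atTop 0] with n hn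
    exact norm_meanDiffVec_sub_le hs hC hb hi hn
  have h1 := h.tendsto_sum_sq_partialSum_comp (tendsto_add_atTop_nat 1)
    (tendsto_log_div_log (u := fun n => n + 1) (fun n => n.le_succ)
      (by filter_upwards [eventually_gt_atTop 0] with n hn; omega))
  have h2 := h.tendsto_sum_sq_partialSum_comp
    (u := fun n => n + (n - n.sqrt) + 1)
    (tendsto_atTop_mono (fun n => by simp only [id]; omega) tendsto_id)
    (tendsto_log_div_log (fun n => by omega)
      (by filter_upwards [eventually_gt_atTop 0] with n hn; omega))
  have h3 := h.tendsto_sum_sq_partialSum_comp (u := fun n => n.sqrt + 1)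
    ((tendsto_add_atTop_nat 1).comp tendsto_natSqrt) tendsto_log_sqrt_succ_div_log
  have h4 : Tendsto (fun n : ℕ => inner ℝ
      (block a 0 (Finset.range (n + 1) \ Finset.range (n.sqrt + 1)))
      (block a ((n - n.sqrt : ℕ) : ℤ)
        (Finset.range (n + (n - n.sqrt) + 1) \ Finset.range (n.sqrt + 1))) / Real.log n) atTop
      (𝓝 0) := by
    refine squeeze_zero_norm' ?_ (tendsto_log_natCast.const_div_atTop (4 * C ^ 2))
    filter_upwards [tendsto_log_natCast.eventually_gt_atTop 0] with n hn
    rw [norm_div, Real.norm_eq_abs, Real.norm_of_nonneg hn.le]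
    gcongr
    refine abs_inner_block_block_le hC hb (n := n) ?_ _ _ Finset.sdiff_subset
    have := two_mul_sqrt_le n
    omega
  have h5 := ((h1.sub h3).add (h2.sub h3)).sub (h4.const_mul 2)
  rw [show 4 * c ^ 2 * 1 - 4 * c ^ 2 * (1 / 2) + (4 * c ^ 2 * 1 - 4 * c ^ 2 * (1 / 2)) - 2 * 0 =
    4 * c ^ 2 by ring] at h5
  refine h5.congr fun n => ?_
  have hle : n.sqrt ≤ n := Nat.sqrt_le_self n
  rw [meanDiffMain, norm_sub_sq_real, norm_block_sq, norm_block_sq,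
    sum_sdiff_range (by omega), sum_sdiff_range (by omega)]
  ring

end Half

end LongMemory

namespace LongMemory

theorem HasMemory.exists_half_bound {c : ℝ} {a : ℕ → ℝ} (h : HasMemory (-(1 / 2)) c a) :
    ∃ C : ℝ, 0 ≤ C ∧ (∀ m : ℕ, |partialSumZ a m| ≤ C * ((m : ℝ) + 1) ^ (-(1 / 2) : ℝ)) ∧
      ∀ m k : ℕ, |partialSumZ a (m + k : ℕ) - partialSumZ a m| ≤
        C * k * ((m : ℝ) + 1) ^ (-(1 / 2) - 1 : ℝ) := by
  obtain ⟨C, hC, h1⟩ := h.exists_partialSum_bound (by norm_num)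
  obtain ⟨D, hD, h2⟩ := h.exists_partialSum_increment_bound (by norm_num) (by norm_num)
  refine ⟨max C D, hC.le.trans (le_max_left _ _), fun m => (h1 m).trans ?_,
    fun m k => (h2 m k).trans ?_⟩
  · gcongr; exact le_max_left _ _
  · gcongr; exact le_max_right _ _

/-! ### Fourier weights -/

/-- Real and imaginary parts of a geometric series whose ratio is an n-th root of unity different
from 1. -/
theorem sum_fourier_eq_zero {n J : ℕ} (h0 : 0 < J) (hJ : J < n) :
    ∑ k ∈ Finset.Icc 1 n, Real.cos (k * fourierFreq n J) = 0 ∧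
      ∑ k ∈ Finset.Icc 1 n, Real.sin (k * fourierFreq n J) = 0 := by
  have hn : (n : ℂ) ≠ 0 := by exact_mod_cast (by omega : n ≠ 0)
  set z : ℂ := Complex.exp (2 * Real.pi * Complex.I / n) with hz
  have hprim : IsPrimitiveRoot z n := Complex.isPrimitiveRoot_exp n (by omega)
  have hzJ : z ^ J ≠ 1 := hprim.pow_ne_one_of_pos_of_lt h0.ne' hJ
  have hzn : (z ^ J) ^ n = 1 := by rw [← pow_mul, mul_comm, pow_mul, hprim.pow_eq_one, one_pow]
  have hsum : ∑ k ∈ Finset.Icc 1 n, (z ^ J) ^ k = 0 := by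
    have h1 : ∑ k ∈ Finset.Icc 1 n, (z ^ J) ^ k = ∑ k ∈ Finset.range n, (z ^ J) ^ (k + 1) := by
      rw [Finset.range_eq_Ico, Finset.sum_Ico_add' (fun k => (z ^ J) ^ k) 0 n 1]
      rfl
    rw [h1]
    simp only [pow_succ]
    rw [← Finset.sum_mul, geom_sum_eq hzJ, hzn]
    simp
  have hexp : ∀ k : ℕ, (z ^ J) ^ k = Complex.exp (((k * fourierFreq n J : ℝ) : ℂ) * Complex.I) := by
    intro k
    rw [hz, ← Complex.exp_nat_mul, ← Complex.exp_nat_mul, fourierFreq]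
    congr 1
    push_cast
    field_simp
  simp only [hexp] at hsum
  constructor
  · have := congrArg Complex.re hsum
    simpa only [Complex.re_sum, Complex.exp_ofReal_mul_I_re, Complex.zero_re] using this
  · have := congrArg Complex.im hsum
    simpa only [Complex.im_sum, Complex.exp_ofReal_mul_I_im, Complex.zero_im] using this

/-- The weights of the entries of `dftVec`. -/
noncomputable def fourierWeight (s n : ℕ) : Fin s ⊕ Fin s → ℕ → ℝ :=
  Sum.elim (fun j k => Real.cos (k * fourierFreq n (j + 1)))
    (fun j k => Real.sin (k * fourierFreq n (j + 1)))

theorem abs_fourierWeight_le (s n : ℕ) (q : Fin s ⊕ Fin s) (k : ℕ) :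
    |fourierWeight s n q k| ≤ 1 := by
  rcases q with j | j
  · exact Real.abs_cos_le_one _
  · exact Real.abs_sin_le_one _

theorem sum_fourierWeight {s n : ℕ} (h : s < n) (q : Fin s ⊕ Fin s) :
    ∑ k ∈ Finset.Icc 1 n, fourierWeight s n q k = 0 := by
  rcases q with j | j
  · exact (sum_fourier_eq_zero (Nat.succ_pos j) (by omega)).1
  · exact (sum_fourier_eq_zero (Nat.succ_pos j) (by omega)).2

theorem dftVec_half_apply (s : ℕ) (x : ℕ → ℝ) (n : ℕ) (q : Fin s ⊕ Fin s) :
    dftVec (1 / 2) s x n q = (n : ℝ)⁻¹ * ∑ k ∈ Finset.Icc 1 n, fourierWeight s n q k * x k := by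
  have : (n : ℝ) ^ (1 / 2 + 1 / 2 : ℝ) = n := by norm_num
  rcases q with j | j <;>
  · simp only [dftVec, fourierWeight, Sum.elim_inl, Sum.elim_inr, this]
    rw [div_eq_inv_mul]

/-- The initial value cancels exactly once n exceeds all the frequencies, so the Fourier sums are
linear forms in the innovations. -/
theorem dftVec_half_sub {s n : ℕ} (h : s < n) (x : ℕ → ℝ) (q : Fin s ⊕ Fin s) (y : ℝ) :
    dftVec (1 / 2) s x n q =
      (n : ℝ)⁻¹ * ∑ k ∈ Finset.Icc 1 n, fourierWeight s n q k * (x k - y) := by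
  simp only [dftVec_half_apply, mul_sub, Finset.sum_sub_distrib, ← Finset.sum_mul,
    sum_fourierWeight h, zero_mul, sub_zero]

theorem meanDiff_sub (x : ℕ → ℝ) (n : ℕ) (y : ℝ) :
    meanDiff x n = (n.sqrt : ℝ)⁻¹ * (∑ k ∈ Finset.Icc 1 n.sqrt, (x k - y) -
      ∑ k ∈ Finset.Icc (n - n.sqrt + 1) n, (x k - y)) := by
  have h : n.sqrt ≤ n := Nat.sqrt_le_self n
  have h2 : n + 1 - (n - n.sqrt + 1) = n.sqrt := by omega
  rw [meanDiff, div_eq_inv_mul, Finset.sum_sub_distrib, Finset.sum_sub_distrib, Finset.sum_const,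
    Finset.sum_const, Nat.card_Icc, Nat.card_Icc, h2, Nat.add_sub_cancel]
  ring

section Vectors

variable {a : ℕ → ℝ} {C : ℝ} {s : ℕ → L2Z}

theorem abs_meanDiffVec_le {M : ℝ} {n : ℕ} (hM : 0 ≤ M) {i : ℤ} (h : ∀ k ≤ n, |s k i| ≤ M) :
    |meanDiffVec s n i| ≤ 2 * M := by
  rcases eq_or_ne n 0 with rfl | hn
  · simpa [meanDiffVec] using hM
  have hle : n.sqrt ≤ n := Nat.sqrt_le_self n
  have h0 : (0 : ℝ) < n.sqrt := by exact_mod_cast Nat.sqrt_pos.2 (Nat.pos_of_ne_zero hn)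
  have h2 : n + 1 - (n - n.sqrt + 1) = n.sqrt := by omega
  rw [meanDiffVec, lp.coeFn_smul, Pi.smul_apply, lp.coeFn_sub, Pi.sub_apply,
    L2Z.coeFn_finsetSum, L2Z.coeFn_finsetSum, smul_eq_mul, abs_mul, abs_inv,
    Nat.abs_cast, inv_mul_le_iff₀ h0]
  have h3 : ∀ F : Finset ℕ, (∀ k ∈ F, k ≤ n) → |∑ k ∈ F, s k i| ≤ F.card * M := by
    intro F hF
    rw [← nsmul_eq_mul, ← Finset.sum_const]
    exact (Finset.abs_sum_le_sum_abs _ _).trans (Finset.sum_le_sum fun k hk => h k (hF k hk))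
  have h4 := h3 (Finset.Icc 1 n.sqrt) fun k hk => (Finset.mem_Icc.1 hk).2.trans hle
  have h5 := h3 (Finset.Icc (n - n.sqrt + 1) n) fun k hk => (Finset.mem_Icc.1 hk).2
  rw [Nat.card_Icc, Nat.add_sub_cancel] at h4
  rw [Nat.card_Icc, h2] at h5
  refine (abs_sub _ _).trans ?_
  linarith

theorem abs_inner_block_weightedMean_le
    (hC : 0 ≤ C)
    (hb : ∀ m : ℕ, |partialSumZ a m| ≤ C * ((m : ℝ) + 1) ^ (-(1 / 2) : ℝ)) {n N : ℕ} (hn : 0 < n)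
    (hN : N ≤ 4 * n) (h : ℤ) {I : Finset ℕ} (hI : I ⊆ Finset.range N) {z : L2Z}
    (hz : ∀ i, |z i| ≤ 2 * C / √n) : |inner ℝ (block a h I) z| ≤ 8 * C ^ 2 := by
  have h1 : 0 < √(n : ℝ) := Real.sqrt_pos.2 (by positivity)
  have h3 := sqrt_natCast_le_two_mul hN
  calc _ ≤ 2 * C * √N * (2 * C / √n) := abs_inner_block_le hC hb h hI hz
    _ ≤ 2 * C * (2 * √n) * (2 * C / √n) := by gcongr
    _ = 8 * C ^ 2 := by field_simp; ring

theorem abs_inner_le_of_norm_sub_le {x y z : L2Z} {K K' B : ℝ} (h : ‖x - y‖ ≤ K) (hz : ‖z‖ ≤ K')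
    (hB : |inner ℝ y z| ≤ B) : |inner ℝ x z| ≤ K * K' + B := by
  have e : inner ℝ x z = inner ℝ (x - y) z + inner ℝ y z := by
    rw [← inner_add_left, sub_add_cancel]
  rw [e]
  have hK : 0 ≤ K := (norm_nonneg _).trans h
  refine (abs_add_le _ _).trans (add_le_add ?_ hB)
  exact (abs_real_inner_le_norm _ _).trans (mul_le_mul h hz (norm_nonneg _) hK)

/-- The mean vectors have bounded inner products with the vectors of trigonometric sums. -/
theorem abs_inner_mean_le
    (hs : ∀ k i, s k i = partialSumZ a (k - i) - partialSumZ a (-i)) (hC : 0 ≤ C)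
    (hb : ∀ m : ℕ, |partialSumZ a m| ≤ C * ((m : ℝ) + 1) ^ (-(1 / 2) : ℝ))
    (hi : ∀ m k : ℕ, |partialSumZ a (m + k : ℕ) - partialSumZ a m| ≤
      C * k * ((m : ℝ) + 1) ^ (-(1 / 2) - 1 : ℝ)) {n : ℕ} (hn : 0 < n) {z : L2Z}
    (hz : ∀ i, |z i| ≤ 2 * C / √n) (hz' : ‖z‖ ≤ 4 * C) :
    |inner ℝ (meanVec s n) z| ≤ 52 * C ^ 2 ∧ |inner ℝ (meanDiffVec s n) z| ≤ 52 * C ^ 2 := by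
  constructor
  · refine (abs_inner_le_of_norm_sub_le (y := -block a 0 (Finset.range (n + 1)))
      (K := 4 * C) ?_ hz' (B := 8 * C ^ 2) ?_).trans (by nlinarith [sq_nonneg C])
    · rw [sub_neg_eq_add]
      exact norm_meanVec_add_block_le hs hC hb hi hn.ne'
    · rw [inner_neg_left, abs_neg]
      exact abs_inner_block_weightedMean_le hC hb hn (by omega) _ subset_rfl hz
  -- The constant is 9C · 4C from the approximation error plus 8C² for each of the two blocks, 52C²
  -- in all.
  · refine (abs_inner_le_of_norm_sub_le (y := meanDiffMain a n)
      (norm_meanDiffVec_sub_le hs hC hb hi hn) hz' (B := 8 * C ^ 2 + 8 * C ^ 2) ?_).trans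
      (by nlinarith [sq_nonneg C])
    rw [meanDiffMain, inner_sub_left]
    refine (abs_sub _ _).trans (add_le_add ?_ ?_)
    · exact abs_inner_block_weightedMean_le hC hb hn (N := n + 1) (by omega) _
        Finset.sdiff_subset hz
    · exact abs_inner_block_weightedMean_le hC hb hn (N := n + (n - n.sqrt) + 1) (by omega) _
        Finset.sdiff_subset hz

end Vectors

/-! ### The case d = 1/2: normal limits and asymptotic independence -/

section Limits

variable {Ω : Type*} [MeasurableSpace Ω] {P : Measure Ω}
  {ε : ℤ → Ω → ℝ} {X : ℕ → Ω → ℝ} {c : ℝ} {a : ℕ → ℝ} {s : ℕ → L2Z}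

theorem measurable_meanDiff {d : ℝ} (hX : IsIntegrated P d c a ε X) (n : ℕ) :
    Measurable fun ω => meanDiff (fun k => X k ω) n :=
  ((Finset.measurable_fun_sum _ fun k _ => hX.measurable k).sub
    (Finset.measurable_fun_sum _ fun k _ => hX.measurable k)).div_const _

theorem measurable_dftVec {d : ℝ} (hX : IsIntegrated P d c a ε X) (r n : ℕ) :
    Measurable fun ω => dftVec (1 / 2) r (fun k => X k ω) n := by
  refine measurable_pi_lambda _ fun q => ?_
  simp only [dftVec_half_apply]
  exact (Finset.measurable_fun_sum _ fun k _ => (hX.measurable k).const_mul _).const_mul _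

theorem IsIntegrated.hasMemory_half (hX : IsIntegrated P (1 / 2) c a ε X) :
    HasMemory (-(1 / 2)) c a := by
  have h := hX.coeff
  rwa [show (1 / 2 - 1 : ℝ) = -(1 / 2) by norm_num] at h

theorem isTightMeasureSet_prodMk {A B : ℕ → Ω → ℝ} (hA : ∀ n, Measurable (A n))
    (hB : ∀ n, Measurable (B n)) (tA : IsTightMeasureSet (Set.range fun n => P.map (A n)))
    (tB : IsTightMeasureSet (Set.range fun n => P.map (B n))) :
    IsTightMeasureSet (Set.range fun n => P.map fun ω => (A n ω, B n ω)) := by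
  apply IsTightMeasureSet.prodMk
  · rw [← Set.range_comp]
    convert tA using 3 with n
    exact Measure.fst_map_prodMk (hB n)
  · rw [← Set.range_comp]
    convert tB using 3 with n
    exact Measure.snd_map_prodMk (hA n)

variable [IsProbabilityMeasure P]

/-- Restores the term with X_0 to the decoupling of characteristic functions; it may depend on both
V and W, since only its pointwise convergence to 0 is used. -/
theorem tendsto_charFun_add_add_sub_mul {V W R : ℕ → Ω → ℝ} (mV : ∀ n, Measurable (V n))
    (mW : ∀ n, Measurable (W n)) (mR : ∀ n, Measurable (R n))
    (limR : ∀ ω, Tendsto (fun n => R n ω) atTop (𝓝 0))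
    (t1 : Tendsto (fun n => (∫ ω, Complex.exp ((V n ω + W n ω : ℝ) * Complex.I) ∂P) -
      (∫ ω, Complex.exp (V n ω * Complex.I) ∂P) * ∫ ω, Complex.exp (W n ω * Complex.I) ∂P)
      atTop (𝓝 0)) :
    Tendsto (fun n => (∫ ω, Complex.exp ((V n ω + W n ω + R n ω : ℝ) * Complex.I) ∂P) -
      (∫ ω, Complex.exp ((V n ω + R n ω : ℝ) * Complex.I) ∂P) *
        ∫ ω, Complex.exp (W n ω * Complex.I) ∂P) atTop (𝓝 0) := by
  have t2 := tendsto_integral_exp_add_sub (P := P) (W := fun n ω => V n ω + W n ω)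
    (fun n => (mV n).add (mW n)) mR limR
  have t3 := tendsto_integral_exp_add_sub (P := P) mV mR limR
  have t4 : Tendsto (fun n => ((∫ ω, Complex.exp ((V n ω + R n ω : ℝ) * Complex.I) ∂P) -
      ∫ ω, Complex.exp (V n ω * Complex.I) ∂P) * ∫ ω, Complex.exp (W n ω * Complex.I) ∂P) atTop
      (𝓝 0) := by
    refine squeeze_zero_norm (fun n => ?_) (tendsto_zero_iff_norm_tendsto_zero.1 t3)
    rw [norm_mul]
    exact mul_le_of_le_one_right (norm_nonneg _) (norm_integral_exp_le_one _)
  have t5 := (t2.add t1).sub t4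
  rw [add_zero, sub_zero] at t5
  refine t5.congr fun n => ?_
  ring

theorem strongDual_apply_eq {ι : Type*} [Fintype ι] [DecidableEq ι]
    (L : StrongDual ℝ ((ℝ × ℝ) × (ι → ℝ))) : ∃ (α β : ℝ) (γ : ι → ℝ), ∀ u v z,
      L ((u, v), z) = α * u + β * v + ∑ q, γ q * z q := by
  refine ⟨L ((1, 0), 0), L ((0, 1), 0), fun q => L ((0, 0), Pi.single q 1), fun u v z => ?_⟩
  have : (((u, v), z) : (ℝ × ℝ) × (ι → ℝ)) =
      u • (((1, 0), 0) : (ℝ × ℝ) × (ι → ℝ)) + v • (((0, 1), 0) : (ℝ × ℝ) × (ι → ℝ)) +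
        ∑ q, z q • (((0, 0), Pi.single q 1) : (ℝ × ℝ) × (ι → ℝ)) := by
    refine Prod.ext ?_ ?_
    · simp [Prod.fst_sum]
    · funext q
      simp [Prod.snd_sum, Finset.sum_apply, Pi.single_apply]
  rw [this, map_add, map_add, map_smul, map_smul, map_sum]
  simp only [map_smul, smul_eq_mul, mul_comm]

theorem eventually_inv_sqrt_log_mul_norm_le {v : ℕ → L2Z} {w : ℝ}
    (hv : Tendsto (fun n : ℕ => ‖v n‖ ^ 2 / Real.log n) atTop (𝓝 w)) :
    ∀ᶠ n : ℕ in atTop, (√(Real.log n))⁻¹ * ‖v n‖ ≤ √(w + 1) := by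
  filter_upwards [hv.eventually_lt_const (lt_add_one w),
    tendsto_log_natCast.eventually_gt_atTop 0] with n hn hl
  rw [← div_eq_inv_mul]
  apply Real.le_sqrt_of_sq_le
  rw [div_pow, Real.sq_sqrt hl.le]
  exact hn.le

theorem isLin_meanDiff {d : ℝ} (hX : IsIntegrated P d c a ε X)
    (hs : ∀ k i, s k i = partialSumZ a (k - i) - partialSumZ a (-i)) (n : ℕ) :
    IsLin P ε (meanDiffVec s n) (fun ω => meanDiff (fun k => X k ω) n) := by
  have h1 := isLin_weightedSum hX hs (Finset.Icc 1 n.sqrt) (fun _ => 1) (n.sqrt : ℝ)⁻¹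
  have h2 := isLin_weightedSum hX hs (Finset.Icc (n - n.sqrt + 1) n) (fun _ => 1) (n.sqrt : ℝ)⁻¹
  have h3 := h1.sub hX.innovation h2
  simp only [one_smul, one_mul, ← mul_sub] at h3
  have h4 : ∀ ω, meanDiff (fun k => X k ω) n = _ := fun ω =>
    meanDiff_sub (fun k => X k ω) n (X 0 ω)
  simp only [h4]
  convert h3 using 2 with i
  simp only [meanDiffVec, smul_sub, lp.coeFn_sub, Pi.sub_apply]

theorem meanNorm_half (n : ℕ) : meanNorm (1 / 2) n = √(Real.log n) := if_pos rfl

theorem tendstoInDistribution_sampleMean_half (hX : IsIntegrated P (1 / 2) c a ε X) :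
    TendstoInDistribution (fun n ω => sampleMean (fun k => X k ω) n / √(Real.log n)) atTop id
      (fun _ => P) (gaussianReal 0 (innovationVariance P ε * (4 * c ^ 2)).toNNReal) := by
  have hm : HasMemory (-(1 / 2)) c a := hX.hasMemory_half
  obtain ⟨C, hC, hb, hi⟩ := hm.exists_half_bound
  obtain ⟨s, hs⟩ := exists_increment hX.coeff.summable_sq
  have h := tendstoInDistribution_sampleMean hX hs (v := 4 * c ^ 2) (by
    refine (hm.tendsto_norm_meanVec_sq_div_log hs hC hb hi).congr' ?_
    filter_upwards [tendsto_log_natCast.eventually_gt_atTop 0] with n hn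
    rw [meanNorm_half, Real.sq_sqrt hn.le])
  simpa only [meanNorm_half] using h

theorem tendstoInDistribution_meanDiff (hX : IsIntegrated P (1 / 2) c a ε X) :
    TendstoInDistribution (fun n ω => meanDiff (fun k => X k ω) n / √(Real.log n)) atTop id
      (fun _ => P) (gaussianReal 0 (innovationVariance P ε * (4 * c ^ 2)).toNNReal) := by
  have hm : HasMemory (-(1 / 2)) c a := hX.hasMemory_half
  obtain ⟨C, hC, hb, hi⟩ := hm.exists_half_bound
  obtain ⟨s, hs⟩ := exists_increment hX.coeff.summable_sq
  obtain ⟨M, hM, hMlim⟩ := hX.coeff.exists_increment_bound le_rfl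
  simp only [meanNorm_half] at hMlim
  have key := tendstoInDistribution_gaussian (P := P) hX.innovation
    (x := fun n => (√(Real.log n))⁻¹ • meanDiffVec s n)
    (ρ := fun n => 2 * (M n / √(Real.log n))) (v := 4 * c ^ 2)
    (W := fun n ω => (√(Real.log n))⁻¹ * meanDiff (fun k => X k ω) n)
    -- Both averages have √n terms, so X_0 cancels and nothing is left to remove.
    (R := fun n ω => 0)
    (Eventually.of_forall fun n => (isLin_meanDiff hX hs n).const_mul _)
    (fun n => (measurable_meanDiff hX n).const_mul _)
    (by
      refine (hm.tendsto_norm_meanDiffVec_sq_div_log hs hC hb hi).congr' ?_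
      filter_upwards [tendsto_log_natCast.eventually_gt_atTop 0] with n hn
      rw [norm_smul, mul_pow, norm_inv, inv_pow, Real.norm_eq_abs, sq_abs, Real.sq_sqrt hn.le,
        div_eq_inv_mul])
    (by simpa using hMlim.const_mul 2)
    (by
      filter_upwards [tendsto_log_natCast.eventually_gt_atTop 0] with n hn i
      have hM0 : 0 ≤ M n := (abs_nonneg _).trans (hM n 0 0 n.zero_le)
      have h1 : |meanDiffVec s n i| ≤ 2 * M n :=
        abs_meanDiffVec_le hM0 fun k hk => by rw [hs]; exact hM n k i hk
      rw [lp.coeFn_smul, Pi.smul_apply, smul_eq_mul, abs_mul, abs_inv,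
        abs_of_pos (Real.sqrt_pos.2 hn), ← mul_div_assoc, div_eq_inv_mul]
      gcongr)
    (fun n => measurable_const) (fun ω => tendsto_const_nhds)
  simpa only [add_zero, ← div_eq_inv_mul] using key

theorem isLin_dftVec {d : ℝ} (hX : IsIntegrated P d c a ε X)
    (hs : ∀ k i, s k i = partialSumZ a (k - i) - partialSumZ a (-i)) {r n : ℕ} (h : r < n)
    (q : Fin r ⊕ Fin r) :
    IsLin P ε (weightedMeanVec s (fourierWeight r n q) n)
      (fun ω => dftVec (1 / 2) r (fun k => X k ω) n q) := by
  have h1 : ∀ ω, dftVec (1 / 2) r (fun k => X k ω) n q = _ := fun ω =>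
    dftVec_half_sub h (fun k => X k ω) q (X 0 ω)
  simp only [h1]
  exact isLin_weightedSum hX hs _ _ _

/-- The characteristic functions of the means and of the trigonometric sums decouple. -/
theorem tendsto_charFun_means_dftVec (hX : IsIntegrated P (1 / 2) c a ε X) (r : ℕ) (α β : ℝ)
    (γ : Fin r ⊕ Fin r → ℝ) :
    Tendsto (fun n : ℕ =>
      (∫ ω, Complex.exp (((√(Real.log n))⁻¹ * (α * (sampleMean (fun k => X k ω) n - X 0 ω) +
        β * meanDiff (fun k => X k ω) n) +
        ∑ q, γ q * dftVec (1 / 2) r (fun k => X k ω) n q : ℝ) * Complex.I) ∂P) -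
      (∫ ω, Complex.exp (((√(Real.log n))⁻¹ * (α * (sampleMean (fun k => X k ω) n - X 0 ω) +
        β * meanDiff (fun k => X k ω) n) : ℝ) * Complex.I) ∂P) *
      ∫ ω, Complex.exp ((∑ q, γ q * dftVec (1 / 2) r (fun k => X k ω) n q : ℝ) * Complex.I) ∂P)
      atTop (𝓝 0) := by
  have hmem : HasMemory (-(1 / 2)) c a := hX.hasMemory_half
  have h := hX.innovation
  obtain ⟨C, hC, hb, hi⟩ := hmem.exists_half_bound
  obtain ⟨s, hs⟩ := exists_increment hX.coeff.summable_sq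
  obtain ⟨M, hM, hMlim⟩ := hX.coeff.exists_increment_bound le_rfl
  simp only [meanNorm_half] at hMlim
  have hζ : ∀ n, r < n → ∀ q, ‖weightedMeanVec s (fourierWeight r n q) n‖ ≤ 4 * C :=
    fun n hn q => norm_weightedMeanVec_le hs hC hb hi (abs_fourierWeight_le r n q)
      (sum_fourierWeight hn q)
  have hζ' : ∀ n, r < n → ∀ q i, |weightedMeanVec s (fourierWeight r n q) n i| ≤ 2 * C / √n :=
    fun n hn q i => abs_weightedMeanVec_le hs hC hb (abs_fourierWeight_le r n q)
      (sum_fourierWeight hn q) i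
  have hsq : Tendsto (fun n : ℕ => √(Real.log n)) atTop atTop :=
    Real.tendsto_sqrt_atTop.comp tendsto_log_natCast
  set G : ℝ := ∑ q, |γ q| with hG
  have hG0 : 0 ≤ G := Finset.sum_nonneg fun q _ => abs_nonneg _
  set x : ℕ → L2Z := fun n => (√(Real.log n))⁻¹ • (α • meanVec s n + β • meanDiffVec s n) with hx
  set y : ℕ → L2Z := fun n => ∑ q, γ q • weightedMeanVec s (fourierWeight r n q) n with hy
  have linV : ∀ᶠ n in atTop, IsLin P ε (x n) (fun ω => (√(Real.log n))⁻¹ *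
      (α * (sampleMean (fun k => X k ω) n - X 0 ω) + β * meanDiff (fun k => X k ω) n)) := by
    filter_upwards [eventually_ne_atTop 0] with n hn
    exact (((isLin_sampleMean hX hs hn).const_mul α).add h
      ((isLin_meanDiff hX hs n).const_mul β)).const_mul _
  have linW : ∀ᶠ n in atTop, IsLin P ε (y n)
      (fun ω => ∑ q, γ q * dftVec (1 / 2) r (fun k => X k ω) n q) := by
    filter_upwards [eventually_gt_atTop r] with n hn
    have := IsLin.finsetSum h Finset.univ
      fun q _ => (isLin_dftVec hX hs hn q).const_mul (γ q)
    convert this using 2 with i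
    rw [L2Z.coeFn_finsetSum]
    rfl
  have nMean := eventually_inv_sqrt_log_mul_norm_le
    (hmem.tendsto_norm_meanVec_sq_div_log hs hC hb hi)
  have nDiff := eventually_inv_sqrt_log_mul_norm_le
    (hmem.tendsto_norm_meanDiffVec_sq_div_log hs hC hb hi)
  have hK : ∀ᶠ n in atTop, ‖x n‖ ≤ (|α| + |β|) * √(4 * c ^ 2 + 1) := by
    filter_upwards [nMean, nDiff] with n h1 h2
    have h0 : 0 ≤ (√(Real.log n))⁻¹ := by positivity
    calc ‖x n‖ ≤ (√(Real.log n))⁻¹ * (|α| * ‖meanVec s n‖ + |β| * ‖meanDiffVec s n‖) := by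
          rw [hx]
          simp only
          rw [norm_smul, Real.norm_of_nonneg h0]
          gcongr
          refine (norm_add_le _ _).trans ?_
          rw [norm_smul, norm_smul, Real.norm_eq_abs, Real.norm_eq_abs]
      _ = |α| * ((√(Real.log n))⁻¹ * ‖meanVec s n‖) +
          |β| * ((√(Real.log n))⁻¹ * ‖meanDiffVec s n‖) := by ring
      _ ≤ |α| * √(4 * c ^ 2 + 1) + |β| * √(4 * c ^ 2 + 1) := by gcongr
      _ = _ := by ring
  have hK' : ∀ᶠ n in atTop, ‖y n‖ ≤ G * (4 * C) := by
    filter_upwards [eventually_gt_atTop r] with n hn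
    rw [hG, Finset.sum_mul]
    refine (norm_sum_le _ _).trans (Finset.sum_le_sum fun q _ => ?_)
    rw [norm_smul, Real.norm_eq_abs]
    gcongr
    exact hζ n hn q
  have supx : ∀ᶠ n in atTop, ∀ i, |x n i| ≤ (|α| + 2 * |β|) * (M n / √(Real.log n)) := by
    refine Eventually.of_forall fun n i => ?_
    have h0 : 0 ≤ (√(Real.log n))⁻¹ := by positivity
    have hM0 : 0 ≤ M n := (abs_nonneg _).trans (hM n 0 0 n.zero_le)
    have hk : ∀ k ≤ n, |s k i| ≤ M n := fun k hk => by rw [hs]; exact hM n k i hk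
    have h1 := abs_meanVec_le hM0 hk
    have h2 := abs_meanDiffVec_le hM0 hk
    rw [hx]
    simp only [lp.coeFn_smul, lp.coeFn_add, Pi.smul_apply, Pi.add_apply, smul_eq_mul]
    rw [abs_mul, abs_of_nonneg h0]
    calc _ ≤ (√(Real.log n))⁻¹ * (|α| * M n + |β| * (2 * M n)) := by
          gcongr
          refine (abs_add_le _ _).trans ?_
          rw [abs_mul, abs_mul]
          gcongr
      _ = _ := by ring
  have supy : ∀ᶠ n in atTop, ∀ i, |y n i| ≤ G * (2 * C / √n) := by
    filter_upwards [eventually_gt_atTop r] with n hn i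
    rw [hy, hG, Finset.sum_mul]
    simp only
    rw [L2Z.coeFn_finsetSum]
    refine (Finset.abs_sum_le_sum_abs _ _).trans (Finset.sum_le_sum fun q _ => ?_)
    rw [lp.coeFn_smul, Pi.smul_apply, smul_eq_mul, abs_mul]
    gcongr
    exact hζ' n hn q i
  -- The unnormalised inner products are bounded, and only the vector of the means is divided by
  -- √(log n).
  have hinner : Tendsto (fun n => inner ℝ (x n) (y n)) atTop (𝓝 0) := by
    have hlim : Tendsto (fun n : ℕ => (√(Real.log n))⁻¹ *
        (G * ((|α| + |β|) * (52 * C ^ 2)))) atTop (𝓝 0) := by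
      simpa using hsq.inv_tendsto_atTop.mul_const (G * ((|α| + |β|) * (52 * C ^ 2)))
    refine squeeze_zero_norm' ?_ hlim
    filter_upwards [eventually_gt_atTop r] with n hn
    have h0 : 0 ≤ (√(Real.log n))⁻¹ := by positivity
    rw [hx, hy]
    simp only
    rw [real_inner_smul_left, norm_mul, Real.norm_of_nonneg h0, inner_sum, hG, Finset.sum_mul]
    gcongr
    refine (norm_sum_le _ _).trans (Finset.sum_le_sum fun q _ => ?_)
    rw [real_inner_smul_right, norm_mul, Real.norm_eq_abs, Real.norm_eq_abs]
    gcongr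
    have h1 := abs_inner_mean_le hs hC hb hi (by omega : 0 < n) (hζ' n hn q) (hζ n hn q)
    rw [inner_add_left, real_inner_smul_left, real_inner_smul_left, add_mul]
    refine (abs_add_le _ _).trans ?_
    rw [abs_mul, abs_mul]
    exact add_le_add (mul_le_mul_of_nonneg_left h1.1 (abs_nonneg _))
      (mul_le_mul_of_nonneg_left h1.2 (abs_nonneg _))
  have hrn : Tendsto (fun n : ℕ => G * (2 * C / √(n : ℝ))) atTop (𝓝 0) := by
    simpa using ((Real.tendsto_sqrt_atTop.comp
      tendsto_natCast_atTop_atTop).const_div_atTop (2 * C)).const_mul G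
  exact tendsto_charFun_add_sub_mul h linV linW hK hK'
    (by simpa using hMlim.const_mul (|α| + 2 * |β|)) hrn supx supy hinner

/-- Tightness of the means comes from their convergence in law, that of the Fourier vector from its
bounded variances; the limit law of the latter is never needed. -/
theorem asymptoticallyIndep_dftVec (hX : IsIntegrated P (1 / 2) c a ε X) (r : ℕ) :
    AsymptoticallyIndep P
      (fun (n : ℕ) ω => (sampleMean (fun k => X k ω) n / √(Real.log n),
        meanDiff (fun k => X k ω) n / √(Real.log n)))
      (fun (n : ℕ) ω => dftVec (1 / 2) r (fun k => X k ω) n) := by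
  have h := hX.innovation
  have mMean := measurable_sampleMean hX
  have mDiff := measurable_meanDiff hX
  have mDft := measurable_dftVec hX r
  have hsq : Tendsto (fun n : ℕ => √(Real.log n)) atTop atTop :=
    Real.tendsto_sqrt_atTop.comp tendsto_log_natCast
  refine asymptoticallyIndep_of_charFunDual
    (fun n => ((mMean n).div_const _).prodMk ((mDiff n).div_const _)) mDft ?_ ?_ ?_
  · exact isTightMeasureSet_prodMk (fun n => (mMean n).div_const _)
      (fun n => (mDiff n).div_const _)
      (isTightMeasureSet_of_tendstoInDistribution (tendstoInDistribution_sampleMean_half hX))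
      (isTightMeasureSet_of_tendstoInDistribution (tendstoInDistribution_meanDiff hX))
  · obtain ⟨C, hC, hb, hi⟩ := hX.hasMemory_half.exists_half_bound
    obtain ⟨s, hs⟩ := exists_increment hX.coeff.summable_sq
    refine isTightMeasureSet_of_eLpNorm_le mDft
      (C := (√(innovationVariance P ε) * (4 * C)).toNNReal) ?_
    filter_upwards [eventually_gt_atTop r] with n hn q
    rw [(isLin_dftVec hX hs hn q).eLpNorm_eq h]
    refine ENNReal.ofReal_le_ofReal (mul_le_mul_of_nonneg_left ?_ (Real.sqrt_nonneg _))
    exact norm_weightedMeanVec_le hs hC hb hi (abs_fourierWeight_le r n q)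
      (sum_fourierWeight hn q)
  intro L
  obtain ⟨α, β, γ, hL⟩ := strongDual_apply_eq L
  have key := tendsto_charFun_add_add_sub_mul (P := P)
    (V := fun n ω => (√(Real.log n))⁻¹ * (α * (sampleMean (fun k => X k ω) n - X 0 ω) +
        β * meanDiff (fun k => X k ω) n))
    (W := fun n ω => ∑ q, γ q * dftVec (1 / 2) r (fun k => X k ω) n q)
    (R := fun n ω => α * ((√(Real.log n))⁻¹ * X 0 ω))
    (fun n => ((((mMean n).sub (hX.measurable 0)).const_mul _).add
      ((mDiff n).const_mul _)).const_mul _)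
    (fun n => Finset.measurable_fun_sum _ fun q _ =>
      ((measurable_pi_apply q).comp (mDft n)).const_mul _)
    (fun n => ((hX.measurable 0).const_mul _).const_mul _)
    (fun ω => by simpa using (hsq.inv_tendsto_atTop.mul_const (X 0 ω)).const_mul α)
    (tendsto_charFun_means_dftVec hX r α β γ)
  refine key.congr fun n => ?_
  congr 1
  · refine integral_congr_ae (ae_of_all _ fun ω => ?_)
    simp only
    rw [hL]
    congr 3
    ring
  · congr 1
    · refine integral_congr_ae (ae_of_all _ fun ω => ?_)
      simp only
      rw [hL]
      congr 3
      simp only [Pi.zero_apply, mul_zero, Finset.sum_const_zero]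
      ring
    · refine integral_congr_ae (ae_of_all _ fun ω => ?_)
      simp only
      rw [← Prod.mk_zero_zero, hL, mul_zero, mul_zero, add_zero, zero_add]

end Limits

end LongMemory

/-! ### The case d = 1/2: the sample variance in L² -/

namespace LongMemory

instance holderTriple_four_four_two : ENNReal.HolderTriple 4 4 2 where
  inv_add_inv_eq_inv := by
    rw [show (4 : ℝ≥0∞) = 2 * 2 by norm_num, ENNReal.mul_inv (by simp) (by simp), ← mul_add,
      ENNReal.inv_two_add_inv_two, mul_one]

/-- The integers `-n, …, n`. -/
def window (n : ℕ) : Finset ℤ :=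
  (Finset.range (2 * n + 1)).map ⟨fun j : ℕ => (n : ℤ) - j, fun i j h => by simp at h; omega⟩

theorem sum_window {M : Type*} [AddCommMonoid M] (n : ℕ) (f : ℤ → M) :
    ∑ i ∈ window n, f i = ∑ j ∈ Finset.range (2 * n + 1), f (n - j) := by
  rw [window, Finset.sum_map]
  rfl

/-- The block at k has length n + k + 1 precisely so that its support runs from -n to k. All n
blocks then live on one finite window, where the finite moment formulas apply. -/
theorem block_eq_zero_of_notMem_window {a : ℕ → ℝ} {n k : ℕ} (hk : k ≤ n) {i : ℤ}
    (hi : i ∉ window n) : block a k (Finset.range (n + k + 1)) i = 0 := by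
  rw [block_apply]
  by_cases h : i ≤ k
  · refine if_neg fun h1 => hi ?_
    rw [Finset.mem_range] at h1
    rw [window, Finset.mem_map]
    refine ⟨(n - i).toNat, ?_, ?_⟩
    · rw [Finset.mem_range]; omega
    · change (n : ℤ) - (((n : ℤ) - i).toNat : ℤ) = i
      omega
  · rw [partialSumZ_of_neg a (by omega), ite_self]

theorem sum_window_block_sq {a : ℕ → ℝ} {n k : ℕ} (hk : k ≤ n) :
    ∑ i ∈ window n, block a k (Finset.range (n + k + 1)) i ^ 2 =
      ∑ p ∈ Finset.range (n + k + 1), partialSumZ a p ^ 2 := by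
  rw [← norm_block_sq a k]
  refine HasSum.unique ?_ (L2Z.hasSum_sq _)
  exact hasSum_sum_of_ne_finset_zero fun i hi => by
    rw [block_eq_zero_of_notMem_window hk hi, sq, zero_mul]

section Blocks

variable {a : ℕ → ℝ} {C : ℝ}

theorem sum_window_abs_block_le (hC : 0 ≤ C)
    (hb : ∀ m : ℕ, |partialSumZ a m| ≤ C * ((m : ℝ) + 1) ^ (-(1 / 2) : ℝ)) {n k : ℕ} (hn : 0 < n) :
    ∑ i ∈ window n, |block a k (Finset.range (n + k + 1)) i| ≤ 4 * C * √n := by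
  rw [sum_window]
  calc _ ≤ ∑ j ∈ Finset.range (2 * n + 1), |partialSumZ a ((k : ℤ) - n + j)| := by
        refine Finset.sum_le_sum fun j _ => (abs_block_apply_le _ _ _ _).trans (le_of_eq ?_)
        congr 2
        ring
    _ ≤ 2 * C * √((2 * n + 1 : ℕ) : ℝ) := sum_abs_partialSum_le hC hb _ _
    _ ≤ 2 * C * (2 * √n) := by
        gcongr
        exact sqrt_natCast_le_two_mul (by omega)
    _ = _ := by ring

theorem sum_abs_block_mul_le (a : ℕ → ℝ) {n k l : ℕ} (hk : k ≤ n) (hl : l ≤ n) :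
    ∑ i ∈ window n, |block a k (Finset.range (n + k + 1)) i| *
      |block a l (Finset.range (n + l + 1)) i| ≤
      ∑ p ∈ Finset.range (2 * n + 1), partialSumZ a p ^ 2 := by
  have hmono : ∀ q ≤ n, ∑ p ∈ Finset.range (n + q + 1), partialSumZ a p ^ 2 ≤
      ∑ p ∈ Finset.range (2 * n + 1), partialSumZ a p ^ 2 := fun q hq =>
    Finset.sum_le_sum_of_subset_of_nonneg (Finset.range_subset_range.2 (by omega))
      fun _ _ _ => sq_nonneg _
  calc _ ≤ ∑ i ∈ window n, (block a k (Finset.range (n + k + 1)) i ^ 2 / 2 +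
        block a l (Finset.range (n + l + 1)) i ^ 2 / 2) := by
        refine Finset.sum_le_sum fun i _ => ?_
        have := two_mul_le_add_sq |block a k (Finset.range (n + k + 1)) i|
          |block a l (Finset.range (n + l + 1)) i|
        rw [sq_abs, sq_abs] at this
        linarith
    _ = (∑ p ∈ Finset.range (n + k + 1), partialSumZ a p ^ 2) / 2 +
        (∑ p ∈ Finset.range (n + l + 1), partialSumZ a p ^ 2) / 2 := by
        rw [Finset.sum_add_distrib, ← Finset.sum_div, ← Finset.sum_div, sum_window_block_sq hk,
          sum_window_block_sq hl]
    _ ≤ _ := by linarith [hmono k hk, hmono l hl]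

/-- One factor of each square is bounded by the sum B of squares of S. In the other, summing over l
first and then over the window gives √n twice. The total is O(n²B) with B of order log n, against a
normalisation of order n²(log n)². -/
theorem sum_sum_sq_abs_block_mul_le (hC : 0 ≤ C)
    (hb : ∀ m : ℕ, |partialSumZ a m| ≤ C * ((m : ℝ) + 1) ^ (-(1 / 2) : ℝ)) {n : ℕ} (hn : 0 < n) :
    ∑ k ∈ Finset.Icc 1 n, ∑ l ∈ Finset.Icc 1 n,
      (∑ i ∈ window n, |block a k (Finset.range (n + k + 1)) i| *
        |block a l (Finset.range (n + l + 1)) i|) ^ 2 ≤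
      8 * C ^ 2 * (n : ℝ) ^ 2 * ∑ p ∈ Finset.range (2 * n + 1), partialSumZ a p ^ 2 := by
  set B := ∑ p ∈ Finset.range (2 * n + 1), partialSumZ a p ^ 2 with hB
  have hB0 : 0 ≤ B := Finset.sum_nonneg fun _ _ => sq_nonneg _
  have hrow : ∀ k ∈ Finset.Icc 1 n, ∑ l ∈ Finset.Icc 1 n,
      (∑ i ∈ window n, |block a k (Finset.range (n + k + 1)) i| *
        |block a l (Finset.range (n + l + 1)) i|) ^ 2 ≤ 8 * C ^ 2 * n * B := by
    intro k hk
    rw [Finset.mem_Icc] at hk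
    calc _ ≤ ∑ l ∈ Finset.Icc 1 n, (∑ i ∈ window n, |block a k (Finset.range (n + k + 1)) i| *
          |block a l (Finset.range (n + l + 1)) i|) * B := by
          refine Finset.sum_le_sum fun l hl => ?_
          rw [sq]
          exact mul_le_mul_of_nonneg_left (sum_abs_block_mul_le a hk.2 (Finset.mem_Icc.1 hl).2)
            (Finset.sum_nonneg fun _ _ => by positivity)
      _ = (∑ i ∈ window n, |block a k (Finset.range (n + k + 1)) i| *
          ∑ l ∈ Finset.Icc 1 n, |block a l (Finset.range (n + l + 1)) i|) * B := by
          rw [← Finset.sum_mul, Finset.sum_comm]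
          simp only [Finset.mul_sum]
      _ ≤ (∑ i ∈ window n, |block a k (Finset.range (n + k + 1)) i| * (2 * C * √n)) * B := by
          gcongr with i _
          exact (Finset.sum_le_sum fun (l : ℕ) _ => abs_block_apply_le a (l : ℤ) _ i).trans
            (sum_abs_partialSum_Icc_le hC hb n i)
      _ ≤ (4 * C * √n * (2 * C * √n)) * B := by
          rw [← Finset.sum_mul]
          gcongr
          exact sum_window_abs_block_le hC hb hn
      _ = 8 * C ^ 2 * (√n * √n) * B := by ring
      _ = _ := by rw [Real.mul_self_sqrt n.cast_nonneg]
  refine (Finset.sum_le_sum hrow).trans (le_of_eq ?_)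
  rw [Finset.sum_const, Nat.card_Icc, nsmul_eq_mul, Nat.add_sub_cancel]
  ring

end Blocks

section Variance

variable {Ω : Type*} [MeasurableSpace Ω] {P : Measure Ω} {ε : ℤ → Ω → ℝ}

theorem memLp_two_sq {W : Ω → ℝ} (h : MemLp W 4 P) : MemLp (fun ω => W ω ^ 2) 2 P := by
  have e : (fun ω => W ω ^ 2) = W * W := by
    funext ω
    simp [sq]
  rw [e]
  exact h.mul (r := 2) h

variable [IsProbabilityMeasure P]

/-- The covariance of two squares is 2σ⁴⟨f, g⟩² plus the cumulant times ∑ f²g². Both are dominated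
by the square of the absolute inner product. -/
theorem IsInnovation.integral_centered_sq_mul_le (h : IsInnovation P ε) (f g : ℤ → ℝ)
    (F : Finset ℤ) :
    ∫ ω, (linSum ε f F ω ^ 2 - innovationVariance P ε * ∑ i ∈ F, f i ^ 2) *
        (linSum ε g F ω ^ 2 - innovationVariance P ε * ∑ i ∈ F, g i ^ 2) ∂P ≤
      (2 * innovationVariance P ε ^ 2 + |innovationCumulant P ε|) *
        (∑ i ∈ F, |f i| * |g i|) ^ 2 := by
  set σ := innovationVariance P ε with hσ
  set Bf := ∑ i ∈ F, f i ^ 2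
  set Bg := ∑ i ∈ F, g i ^ 2
  have i1 := integrable_mul_pow_of_memLp_four (linSum_memLp_four h f F) (linSum_memLp_four h g F)
    (linSum_memLp_four h g F) (p := 2) (q := 2) (r := 0) (by norm_num)
  simp only [pow_zero, mul_one] at i1
  have i2 := (linSum_memLp_two h f F).integrable_sq
  have i3 := (linSum_memLp_two h g F).integrable_sq
  have e1 : ∀ ω, (linSum ε f F ω ^ 2 - σ * Bf) * (linSum ε g F ω ^ 2 - σ * Bg) =
      linSum ε f F ω ^ 2 * linSum ε g F ω ^ 2 - σ * Bg * linSum ε f F ω ^ 2 -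
        σ * Bf * linSum ε g F ω ^ 2 + σ * Bf * (σ * Bg) := fun ω => by ring
  simp only [e1]
  have j1 : Integrable (fun ω => linSum ε f F ω ^ 2 * linSum ε g F ω ^ 2 -
      σ * Bg * linSum ε f F ω ^ 2) P := i1.sub (i2.const_mul _)
  have j2 : Integrable (fun ω => linSum ε f F ω ^ 2 * linSum ε g F ω ^ 2 -
      σ * Bg * linSum ε f F ω ^ 2 - σ * Bf * linSum ε g F ω ^ 2) P := j1.sub (i3.const_mul _)
  rw [integral_add j2 (integrable_const _), integral_sub j1 (i3.const_mul _),
    integral_sub i1 (i2.const_mul _), integral_const_mul, integral_const_mul,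
    integral_linSum_sq h, integral_linSum_sq h, integral_linSum_sq_mul_sq h, integral_const]
  simp only [probReal_univ, smul_eq_mul, one_mul]
  rw [← hσ]
  have h1 : (∑ i ∈ F, f i * g i) ^ 2 ≤ (∑ i ∈ F, |f i| * |g i|) ^ 2 := by
    rw [← sq_abs]
    gcongr
    refine (Finset.abs_sum_le_sum_abs _ _).trans (le_of_eq ?_)
    simp only [abs_mul]
  have h2 : ∑ i ∈ F, f i ^ 2 * g i ^ 2 ≤ (∑ i ∈ F, |f i| * |g i|) ^ 2 := by
    have := Finset.sum_sq_le_sq_sum_of_nonneg (s := F) (f := fun i => |f i| * |g i|)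
      fun i _ => by positivity
    simpa only [mul_pow, sq_abs] using this
  have h0 : 0 ≤ ∑ i ∈ F, f i ^ 2 * g i ^ 2 := Finset.sum_nonneg fun _ _ => by positivity
  have h3 : innovationCumulant P ε * ∑ i ∈ F, f i ^ 2 * g i ^ 2 ≤
      |innovationCumulant P ε| * (∑ i ∈ F, |f i| * |g i|) ^ 2 :=
    mul_le_mul (le_abs_self _) h2 h0 (abs_nonneg _)
  nlinarith [mul_le_mul_of_nonneg_left h1 (sq_nonneg σ)]

theorem IsInnovation.eLpNorm_sum_sq_sub_le {ι : Type*} (h : IsInnovation P ε) (s : Finset ι)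
    (f : ι → ℤ → ℝ) (F : Finset ℤ) :
    eLpNorm (fun ω => ∑ k ∈ s, (linSum ε (f k) F ω ^ 2 -
      innovationVariance P ε * ∑ i ∈ F, f k i ^ 2)) 2 P ≤
    ENNReal.ofReal (√((2 * innovationVariance P ε ^ 2 + |innovationCumulant P ε|) *
      ∑ k ∈ s, ∑ l ∈ s, (∑ i ∈ F, |f k i| * |f l i|) ^ 2)) := by
  have hU : ∀ k, MemLp (fun ω => linSum ε (f k) F ω ^ 2 -
      innovationVariance P ε * ∑ i ∈ F, f k i ^ 2) 2 P := fun k =>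
    (memLp_two_sq (linSum_memLp_four h (f k) F)).sub (memLp_const _)
  rw [eLpNorm_two_eq (memLp_finsetSum s fun k _ => hU k)]
  apply ENNReal.ofReal_le_ofReal
  apply Real.sqrt_le_sqrt
  simp only [sq (∑ k ∈ s, (linSum ε (f k) F _ ^ 2 - _)), Finset.sum_mul_sum]
  have hI : ∀ k l, Integrable (fun ω => (linSum ε (f k) F ω ^ 2 -
      innovationVariance P ε * ∑ i ∈ F, f k i ^ 2) * (linSum ε (f l) F ω ^ 2 -
      innovationVariance P ε * ∑ i ∈ F, f l i ^ 2)) P := fun k l => (hU k).integrable_mul (hU l)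
  rw [integral_finsetSum s fun k _ => integrable_finsetSum s fun l _ => hI k l, Finset.mul_sum]
  refine Finset.sum_le_sum fun k _ => ?_
  rw [integral_finsetSum s fun l _ => hI k l,
    Finset.mul_sum s fun l => (∑ i ∈ F, |f k i| * |f l i|) ^ 2]
  exact Finset.sum_le_sum fun l _ => h.integral_centered_sq_mul_le (f k) (f l) F

theorem IsLin.memLp_four (h : IsInnovation P ε) {x : L2Z} {W : Ω → ℝ} (hW : IsLin P ε x W) :
    MemLp W 4 P := by
  obtain ⟨K, -, hK⟩ := IsLin.eLpNorm_four_le h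
  exact ⟨hW.1.1, (hK x W hW).trans_lt ENNReal.ofReal_lt_top⟩

/-- Hölder's inequality with exponents 4 and 4, and the uniform fourth moment bound. -/
theorem IsLin.eLpNorm_mul_le (h : IsInnovation P ε) : ∃ K : ℝ, 0 ≤ K ∧
    ∀ (x y : L2Z) (V W : Ω → ℝ), IsLin P ε x V → IsLin P ε y W →
      eLpNorm (fun ω => V ω * W ω) 2 P ≤ ENNReal.ofReal (K * (‖x‖ * ‖y‖)) := by
  obtain ⟨K, hK0, hK⟩ := IsLin.eLpNorm_four_le h
  refine ⟨K * K, by positivity, fun x y V W hV hW => ?_⟩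
  have h1 : eLpNorm (V • W) 2 P ≤ eLpNorm V 4 P * eLpNorm W 4 P :=
    eLpNorm_smul_le_mul_eLpNorm (p := 4) (q := 4) (r := 2) (f := W) (φ := V) hW.1.1 hV.1.1
  calc eLpNorm (fun ω => V ω * W ω) 2 P
      ≤ ENNReal.ofReal (K * ‖x‖) * ENNReal.ofReal (K * ‖y‖) :=
        h1.trans (mul_le_mul' (hK x V hV) (hK y W hW))
    _ = _ := by
        rw [← ENNReal.ofReal_mul (by positivity)]
        congr 1
        ring

variable {X : ℕ → Ω → ℝ} {d c : ℝ} {a : ℕ → ℝ} {s : ℕ → L2Z}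

theorem isLin_sub_sampleMean (hX : IsIntegrated P d c a ε X)
    (hs : ∀ k i, s k i = partialSumZ a (k - i) - partialSumZ a (-i)) {n : ℕ} (hn : n ≠ 0)
    (k : ℕ) : IsLin P ε (s k - meanVec s n : L2Z)
      (fun ω => X k ω - sampleMean (fun k => X k ω) n) := by
  have h1 := (isLin_increment hX hX.coeff.summable_sq k).sub hX.innovation
    (isLin_sampleMean hX hs hn)
  convert h1 using 2 with i ω
  · rw [lp.coeFn_sub, Pi.sub_apply, hs]
  · ring

theorem memLp_sumSqDev (hX : IsIntegrated P d c a ε X) (n : ℕ) :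
    MemLp (fun ω => sumSqDev (fun k => X k ω) n) 2 P := by
  rcases eq_or_ne n 0 with rfl | hn
  · simp [sumSqDev]
  obtain ⟨s, hs⟩ := exists_increment hX.coeff.summable_sq
  exact memLp_finsetSum _ fun k _ =>
    memLp_two_sq ((isLin_sub_sampleMean hX hs hn k).memLp_four hX.innovation)

/-- The sum of squared deviations is, up to an explicit error, a deterministic sum. -/
theorem exists_eLpNorm_sumSqDev_sub_le (hX : IsIntegrated P (1 / 2) c a ε X) :
    ∃ K : ℝ, 0 ≤ K ∧ ∀ n : ℕ, 0 < n →
      eLpNorm (fun ω => sumSqDev (fun k => X k ω) n - innovationVariance P ε *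
        ∑ k ∈ Finset.Icc 1 n, ∑ p ∈ Finset.range (n + k + 1), partialSumZ a p ^ 2) 2 P ≤
      ENNReal.ofReal (n * (K * (1 + √(∑ p ∈ Finset.range (2 * n + 1), partialSumZ a p ^ 2)))) := by
  have h := hX.innovation
  have hσ : 0 < innovationVariance P ε := h.variance_pos
  obtain ⟨C, hC, hb, hi⟩ := hX.hasMemory_half.exists_half_bound
  obtain ⟨s, hs⟩ := exists_increment hX.coeff.summable_sq
  obtain ⟨K, hK0, hK⟩ := IsLin.eLpNorm_mul_le h
  set κ := 2 * innovationVariance P ε ^ 2 + |innovationCumulant P ε| with hκ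
  have hκ0 : 0 ≤ κ := by positivity
  refine ⟨K * (5 * C) * (5 * C + 2) + √(κ * (8 * C ^ 2)), by positivity, fun n hn => ?_⟩
  set B := ∑ p ∈ Finset.range (2 * n + 1), partialSumZ a p ^ 2 with hB
  have hB0 : 0 ≤ B := Finset.sum_nonneg fun _ _ => sq_nonneg _
  set w : ℕ → L2Z := fun k => block a k (Finset.range (n + k + 1)) with hw
  set W : ℕ → Ω → ℝ := fun k => linSum ε (w k) (window n) with hW
  set E : ℕ → Ω → ℝ := fun k ω => X k ω - sampleMean (fun k => X k ω) n - W k ω with hE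
  have linW : ∀ k ∈ Finset.Icc 1 n, IsLin P ε (w k) (W k) := fun k hk =>
    IsLin.of_finset h fun i hi => block_eq_zero_of_notMem_window (Finset.mem_Icc.1 hk).2 hi
  have linE : ∀ k ∈ Finset.Icc 1 n, IsLin P ε (s k - meanVec s n - w k : L2Z) (E k) :=
    fun k hk => (isLin_sub_sampleMean hX hs hn.ne' k).sub h (linW k hk)
  -- The block at 0 occurs in both s_k and the mean vector and cancels in their difference; the
  -- remaining errors C and 4C give 5C.
  have normE : ∀ k ∈ Finset.Icc 1 n, ‖s k - meanVec s n - w k‖ ≤ 5 * C := by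
    intro k hk
    have h1 := norm_increment_sub_block_le hs hC hi (Finset.mem_Icc.1 hk).2
    have h2 := norm_meanVec_add_block_le hs hC hb hi hn.ne'
    have e : s k - meanVec s n - w k = (s k - (block a k (Finset.range (n + k + 1)) -
        block a 0 (Finset.range (n + 1)))) - (meanVec s n + block a 0 (Finset.range (n + 1))) := by
      rw [hw]; abel
    rw [e]
    exact (norm_sub_le _ _).trans (by linarith)
  have normW : ∀ k ∈ Finset.Icc 1 n, ‖w k‖ ≤ √B := by
    intro k hk
    have hk := (Finset.mem_Icc.1 hk).2
    apply Real.le_sqrt_of_sq_le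
    rw [norm_block_sq]
    exact Finset.sum_le_sum_of_subset_of_nonneg (Finset.range_subset_range.2 (by omega))
      fun _ _ _ => sq_nonneg _
  -- The square of W + E minus W² is E(E + 2W), with E bounded and W of order √B, so each such term
  -- is O(1 + √B) in L².
  have cross : ∀ k ∈ Finset.Icc 1 n, eLpNorm (fun ω => E k ω * (E k ω + 2 * W k ω)) 2 P ≤
      ENNReal.ofReal (K * (5 * C * (5 * C + 2 * √B))) := by
    intro k hk
    have hl : IsLin P ε ((s k - meanVec s n - w k) + (2 : ℝ) • w k : L2Z)
        (fun ω => E k ω + 2 * W k ω) := (linE k hk).add h ((linW k hk).const_mul 2)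
    refine (hK _ _ _ _ (linE k hk) hl).trans (ENNReal.ofReal_le_ofReal ?_)
    have h2 : ‖(s k - meanVec s n - w k) + (2 : ℝ) • w k‖ ≤ 5 * C + 2 * √B := by
      refine (norm_add_le _ _).trans (add_le_add (normE k hk) ?_)
      rw [norm_smul, Real.norm_of_nonneg (by norm_num)]
      have := normW k hk
      linarith
    have := normE k hk
    gcongr
  have mW : ∀ k ∈ Finset.Icc 1 n, MemLp (W k) 4 P := fun k hk => (linW k hk).memLp_four h
  have mE : ∀ k ∈ Finset.Icc 1 n, MemLp (fun ω => E k ω * (E k ω + 2 * W k ω)) 2 P := by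
    intro k hk
    have h1 := (linE k hk).memLp_four h
    exact (h1.add ((mW k hk).const_mul 2)).mul (r := 2) h1
  have hdiag := h.eLpNorm_sum_sq_sub_le (Finset.Icc 1 n) (fun k => w k) (window n)
  have hsplit : (fun ω => sumSqDev (fun k => X k ω) n - innovationVariance P ε *
        ∑ k ∈ Finset.Icc 1 n, ∑ p ∈ Finset.range (n + k + 1), partialSumZ a p ^ 2) =
      (∑ k ∈ Finset.Icc 1 n, fun ω => E k ω * (E k ω + 2 * W k ω)) +
      fun ω => ∑ k ∈ Finset.Icc 1 n, (W k ω ^ 2 -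
        innovationVariance P ε * ∑ i ∈ window n, w k i ^ 2) := by
    funext ω
    simp only [Pi.add_apply, Finset.sum_apply]
    rw [← Finset.sum_add_distrib, sumSqDev, Finset.mul_sum, ← Finset.sum_sub_distrib]
    refine Finset.sum_congr rfl fun k hk => ?_
    rw [sum_window_block_sq (Finset.mem_Icc.1 hk).2, hE]
    ring
  have b1 : eLpNorm (∑ k ∈ Finset.Icc 1 n, fun ω => E k ω * (E k ω + 2 * W k ω)) 2 P ≤
      ENNReal.ofReal (n * (K * (5 * C * (5 * C + 2 * √B)))) := by
    refine (eLpNorm_sum_le (fun k hk => (mE k hk).1) (by norm_num)).trans ?_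
    refine (Finset.sum_le_sum cross).trans (le_of_eq ?_)
    rw [Finset.sum_const, Nat.card_Icc, Nat.add_sub_cancel, ENNReal.ofReal_mul n.cast_nonneg,
      ENNReal.ofReal_natCast, nsmul_eq_mul]
  have b2 : eLpNorm (fun ω => ∑ k ∈ Finset.Icc 1 n, (W k ω ^ 2 -
      innovationVariance P ε * ∑ i ∈ window n, w k i ^ 2)) 2 P ≤
      ENNReal.ofReal (n * (√(κ * (8 * C ^ 2)) * √B)) := by
    refine hdiag.trans (ENNReal.ofReal_le_ofReal ?_)
    have e : (n : ℝ) * (√(κ * (8 * C ^ 2)) * √B) = √(κ * (8 * C ^ 2 * (n : ℝ) ^ 2 * B)) := by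
      rw [show κ * (8 * C ^ 2 * (n : ℝ) ^ 2 * B) = (n : ℝ) ^ 2 * (κ * (8 * C ^ 2) * B) by ring,
        Real.sqrt_mul (sq_nonneg (n : ℝ)), Real.sqrt_sq n.cast_nonneg,
        Real.sqrt_mul (x := κ * (8 * C ^ 2)) (by positivity) B]
    rw [e]
    apply Real.sqrt_le_sqrt
    gcongr
    exact sum_sum_sq_abs_block_mul_le hC hb hn
  rw [hsplit]
  refine (eLpNorm_add_le (memLp_finsetSum' _ mE).1 ?_ (by norm_num)).trans
    ((add_le_add b1 b2).trans ?_)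
  · exact (memLp_finsetSum _ fun k hk => (memLp_two_sq (mW k hk)).sub (memLp_const _)).1
  · rw [← ENNReal.ofReal_add (by positivity) (by positivity)]
    apply ENNReal.ofReal_le_ofReal
    rw [← mul_add]
    gcongr
    have hsB := Real.sqrt_nonneg B
    have hsq := Real.sqrt_nonneg (κ * (8 * C ^ 2))
    have h5 : 0 ≤ K * (5 * C) := by positivity
    nlinarith [mul_nonneg h5 hC, mul_nonneg h5 hsB, mul_nonneg (mul_nonneg h5 hC) hsB]

/-- The inner sums lie between those of lengths n and 2n + 1, which have the same logarithmic
asymptotics. -/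
theorem tendsto_sum_sum_sq_partialSum (h : HasMemory (-(1 / 2)) c a) :
    Tendsto (fun n : ℕ => (∑ k ∈ Finset.Icc 1 n, ∑ p ∈ Finset.range (n + k + 1),
      partialSumZ a p ^ 2) / (n * Real.log n)) atTop (𝓝 (4 * c ^ 2)) := by
  have h1 := h.tendsto_sum_sq_partialSum_comp tendsto_id
    (tendsto_log_div_log (u := id) (fun n => le_rfl)
      (Eventually.of_forall fun n => by simp only [id]; omega))
  have h2 := h.tendsto_sum_sq_partialSum_comp (u := fun n => 2 * n + 1)
    (tendsto_atTop_mono (fun n => by simp only [id]; omega) tendsto_id)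
    (tendsto_log_div_log (fun n => by omega)
      (by filter_upwards [eventually_gt_atTop 0] with n hn; omega))
  rw [mul_one] at h1 h2
  refine tendsto_of_tendsto_of_tendsto_of_le_of_le' h1 h2 ?_ ?_
  · filter_upwards [tendsto_log_natCast.eventually_gt_atTop 0, eventually_gt_atTop 0] with n hl hn
    have hn0 : (0 : ℝ) < n := by positivity
    rw [← mul_div_mul_left _ _ hn0.ne']
    gcongr
    calc _ = ∑ k ∈ Finset.Icc 1 n, ∑ m ∈ Finset.range (id n), partialSumZ a m ^ 2 := by simp
      _ ≤ _ := Finset.sum_le_sum fun k _ => Finset.sum_le_sum_of_subset_of_nonneg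
        (Finset.range_subset_range.2 (by simp only [id]; omega)) fun _ _ _ => sq_nonneg _
  · filter_upwards [tendsto_log_natCast.eventually_gt_atTop 0, eventually_gt_atTop 0] with n hl hn
    have hn0 : (0 : ℝ) < n := by positivity
    rw [← mul_div_mul_left _ (Real.log n) hn0.ne']
    gcongr
    calc _ ≤ ∑ k ∈ Finset.Icc 1 n, ∑ m ∈ Finset.range (2 * n + 1), partialSumZ a m ^ 2 :=
          Finset.sum_le_sum fun k hk => Finset.sum_le_sum_of_subset_of_nonneg
            (Finset.range_subset_range.2 (by have := (Finset.mem_Icc.1 hk).2; omega))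
            fun _ _ _ => sq_nonneg _
      _ = _ := by simp

/-- After normalisation the random error is K(1 + √B)/log n with B ~ 4c² log n, hence of order (log
n)^(-1/2); the deterministic part converges to σ_ε² · 4c². -/
theorem tendsto_eLpNorm_sumSqDev (hX : IsIntegrated P (1 / 2) c a ε X) :
    Tendsto (fun n : ℕ => eLpNorm (fun ω => sumSqDev (fun k => X k ω) n / (n * Real.log n) -
      innovationVariance P ε * (4 * c ^ 2)) 2 P) atTop (𝓝 0) := by
  have hm := hX.hasMemory_half
  obtain ⟨K, hK0, hK⟩ := exists_eLpNorm_sumSqDev_sub_le hX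
  set σ := innovationVariance P ε with hσ
  set B : ℕ → ℝ := fun n => ∑ p ∈ Finset.range (2 * n + 1), partialSumZ a p ^ 2 with hB
  set A : ℕ → ℝ := fun n => ∑ k ∈ Finset.Icc 1 n, ∑ p ∈ Finset.range (n + k + 1),
    partialSumZ a p ^ 2 with hA
  have l1 : Tendsto (fun n : ℕ => A n / (n * Real.log n)) atTop (𝓝 (4 * c ^ 2)) :=
    tendsto_sum_sum_sq_partialSum hm
  have l2 : Tendsto (fun n => B n / Real.log n) atTop (𝓝 (4 * c ^ 2)) := by
    have h2 := hm.tendsto_sum_sq_partialSum_comp (u := fun n => 2 * n + 1)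
      (tendsto_atTop_mono (fun n => by simp only [id]; omega) tendsto_id)
      (tendsto_log_div_log (fun n => by omega)
        (by filter_upwards [eventually_gt_atTop 0] with n hn; omega))
    rwa [mul_one] at h2
  have hl := tendsto_log_natCast
  have hsq : Tendsto (fun n : ℕ => (√(Real.log n))⁻¹) atTop (𝓝 0) :=
    (Real.tendsto_sqrt_atTop.comp hl).inv_tendsto_atTop
  have l3 : Tendsto (fun n : ℕ => K * (1 / Real.log n + √(B n / Real.log n) *
      (√(Real.log n))⁻¹)) atTop (𝓝 0) := by
    simpa using ((hl.const_div_atTop 1).add (l2.sqrt.mul hsq)).const_mul K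
  have l4 : Tendsto (fun n : ℕ => |σ * (A n / (n * Real.log n)) - σ * (4 * c ^ 2)|) atTop
      (𝓝 0) := by
    have := ((l1.const_mul σ).sub_const (σ * (4 * c ^ 2))).abs
    rwa [sub_self, abs_zero] at this
  have l5 := ENNReal.tendsto_ofReal (l3.add l4)
  rw [add_zero, ENNReal.ofReal_zero] at l5
  refine tendsto_of_tendsto_of_tendsto_of_le_of_le' tendsto_const_nhds l5
    (Eventually.of_forall fun n => zero_le) ?_
  filter_upwards [hl.eventually_gt_atTop 0, eventually_gt_atTop 0] with n hln hn
  have hn0 : (0 : ℝ) < n := by positivity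
  have e : (fun ω => sumSqDev (fun k => X k ω) n / (n * Real.log n) - σ * (4 * c ^ 2)) =
      (((n : ℝ) * Real.log n)⁻¹ • fun ω => sumSqDev (fun k => X k ω) n - σ * A n) +
        fun _ => σ * (A n / (n * Real.log n)) - σ * (4 * c ^ 2) := by
    funext ω
    simp only [Pi.add_apply, Pi.smul_apply, smul_eq_mul]
    ring
  rw [e]
  refine (eLpNorm_add_le (((memLp_sumSqDev hX n).sub (memLp_const _)).const_smul _).1
    aestronglyMeasurable_const (by norm_num)).trans ?_
  rw [ENNReal.ofReal_add (by positivity) (abs_nonneg _)]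
  refine add_le_add ?_ ?_
  · rw [eLpNorm_const_smul, Real.enorm_of_nonneg (by positivity)]
    refine (mul_le_mul_right (hK n hn) _).trans (le_of_eq ?_)
    rw [← ENNReal.ofReal_mul (by positivity)]
    congr 1
    have h10 : √(Real.log n) * √(Real.log n) = Real.log n := Real.mul_self_sqrt hln.le
    rw [Real.sqrt_div' _ hln.le]
    have h11 : √(B n) / √(Real.log n) * (√(Real.log n))⁻¹ = √(B n) / Real.log n := by
      rw [← div_eq_mul_inv, div_div, h10]
    rw [h11]
    field_simp
    rfl
  · rw [eLpNorm_const _ (by norm_num) (IsProbabilityMeasure.ne_zero P), measure_univ,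
      ENNReal.one_rpow, mul_one, Real.enorm_eq_ofReal_abs]

end Variance

end LongMemory

/-! ### Slutsky arguments and the χ²(1) limits -/

namespace LongMemory

/-- Convergence in distribution depends only on laws, so the limit variable may be replaced by one
on another space with the same law. -/
theorem tendstoInDistribution_of_eventuallyEq {Ω Ω₁ Ω₂ : Type*} [MeasurableSpace Ω]
    [MeasurableSpace Ω₁] [MeasurableSpace Ω₂] {P : Measure Ω} [IsProbabilityMeasure P]
    {μ : Measure Ω₁} [IsProbabilityMeasure μ] {ν : Measure Ω₂} [IsProbabilityMeasure ν]
    {U V : ℕ → Ω → ℝ} {Y : Ω₁ → ℝ} {Z : Ω₂ → ℝ}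
    (h : TendstoInDistribution U atTop Y (fun _ => P) μ) (hV : ∀ n, AEMeasurable (V n) P)
    (hUV : ∀ᶠ n in atTop, V n = U n) (hZ : AEMeasurable Z ν) (hmap : μ.map Y = ν.map Z) :
    TendstoInDistribution V atTop Z (fun _ => P) ν := by
  refine ⟨hV, hZ, ?_⟩
  have h1 := h.tendsto
  have e : (⟨ν.map Z, Measure.isProbabilityMeasure_map hZ⟩ : ProbabilityMeasure ℝ) =
      ⟨μ.map Y, Measure.isProbabilityMeasure_map h.aemeasurable_limit⟩ := Subtype.ext hmap.symm
  rw [e]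
  refine h1.congr' ?_
  filter_upwards [hUV] with n hn
  apply Subtype.ext
  change P.map (U n) = P.map (V n)
  rw [hn]

theorem tendstoInMeasure_comp_const {Ω : Type*} [MeasurableSpace Ω] {P : Measure Ω}
    {T : ℕ → Ω → ℝ} {v : ℝ} {f : ℝ → ℝ} (h : TendstoInMeasure P T atTop fun _ => v)
    (hf : ContinuousAt f v) : TendstoInMeasure P (fun n ω => f (T n ω)) atTop fun _ => f v := by
  rw [tendstoInMeasure_iff_dist] at h ⊢
  intro η hη
  obtain ⟨ρ, hρ, hρ'⟩ := Metric.continuousAt_iff.1 hf η hη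
  refine tendsto_of_tendsto_of_tendsto_of_le_of_le tendsto_const_nhds (h ρ hρ)
    (fun n => zero_le) fun n => measure_mono fun ω hω => ?_
  by_contra hlt
  exact absurd (hρ' (not_le.1 hlt)) (not_lt.2 hω)

theorem map_gaussianReal_sq {v : ℝ} (hv : 0 ≤ v) :
    (gaussianReal 0 v.toNNReal).map (fun x => x ^ 2) = chiSqOne.map fun q => v * q := by
  have h1 : gaussianReal 0 v.toNNReal = (gaussianReal 0 1).map fun x => √v * x := by
    rw [gaussianReal_map_const_mul, mul_zero, mul_one]
    congr 1
    apply NNReal.eq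
    change (v.toNNReal : ℝ) = √v ^ 2
    rw [Real.coe_toNNReal _ hv, Real.sq_sqrt hv]
  rw [h1, chiSqOne, Measure.map_map (by fun_prop) (by fun_prop),
    Measure.map_map (by fun_prop) (by fun_prop)]
  congr 1
  funext x
  simp only [Function.comp_apply, mul_pow, Real.sq_sqrt hv]

section Slutsky

variable {Ω : Type*} [MeasurableSpace Ω] {P : Measure Ω} [IsProbabilityMeasure P]
  {A T : ℕ → Ω → ℝ} {v : ℝ}

theorem tendstoInDistribution_sq_div (hv : 0 < v)
    (hA : TendstoInDistribution A atTop id (fun _ => P) (gaussianReal 0 v.toNNReal))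
    (hT : TendstoInMeasure P T atTop fun _ => v) (mT : ∀ n, Measurable (T n)) :
    TendstoInDistribution (fun n ω => A n ω ^ 2 / T n ω) atTop id (fun _ => P) chiSqOne := by
  have h1 := tendstoInMeasure_comp_const hT (continuousAt_inv₀ hv.ne')
  have h2 := hA.continuous_comp_prodMk_of_tendstoInMeasure_const
    (g := fun p : ℝ × ℝ => p.1 ^ 2 * p.2) (by fun_prop) h1 fun n => (mT n).inv.aemeasurable
  refine tendstoInDistribution_of_eventuallyEq h2
    (fun n => ((hA.forall_aemeasurable n).pow_const 2).div (mT n).aemeasurable)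
    (Eventually.of_forall fun n => by funext ω; rw [div_eq_mul_inv]) aemeasurable_id ?_
  have e : (fun ω : ℝ => id ω ^ 2 * v⁻¹) = (fun x => x * v⁻¹) ∘ fun x => x ^ 2 := rfl
  rw [e, ← Measure.map_map (by fun_prop) (by fun_prop), map_gaussianReal_sq hv.le,
    Measure.map_map (by fun_prop) (by fun_prop)]
  congr 1
  funext q
  simp only [Function.comp_apply, id]
  field_simp

theorem tendstoInDistribution_add_sq (hv : 0 < v)
    (hA : TendstoInDistribution A atTop id (fun _ => P) (gaussianReal 0 v.toNNReal))
    (hT : TendstoInMeasure P T atTop fun _ => v) (mT : ∀ n, Measurable (T n)) :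
    TendstoInDistribution (fun n ω => T n ω + A n ω ^ 2) atTop (fun q => v * (1 + q))
      (fun _ => P) chiSqOne := by
  have h2 := hA.continuous_comp_prodMk_of_tendstoInMeasure_const
    (g := fun p : ℝ × ℝ => p.2 + p.1 ^ 2) (by fun_prop) hT fun n => (mT n).aemeasurable
  refine tendstoInDistribution_of_eventuallyEq h2
    (fun n => (mT n).aemeasurable.add ((hA.forall_aemeasurable n).pow_const 2))
    (Eventually.of_forall fun n => rfl) (by fun_prop) ?_
  have e : (fun ω : ℝ => v + id ω ^ 2) = (fun x => v + x) ∘ fun x => x ^ 2 := rfl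
  rw [e, ← Measure.map_map (by fun_prop) (by fun_prop), map_gaussianReal_sq hv.le,
    Measure.map_map (by fun_prop) (by fun_prop)]
  congr 1
  funext q
  simp only [Function.comp_apply]
  ring

end Slutsky

theorem sum_sq_eq_sumSqDev_add (x : ℕ → ℝ) (n : ℕ) :
    ∑ k ∈ Finset.Icc 1 n, x k ^ 2 = sumSqDev x n + n * sampleMean x n ^ 2 := by
  rcases eq_or_ne n 0 with rfl | hn
  · simp [sumSqDev]
  have h0 : (n : ℝ) ≠ 0 := by exact_mod_cast hn
  have h1 : ∑ k ∈ Finset.Icc 1 n, x k = n * sampleMean x n := by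
    rw [sampleMean, mul_div_cancel₀ _ h0]
  have h2 : ∀ k, (x k - sampleMean x n) ^ 2 =
      x k ^ 2 - 2 * sampleMean x n * x k + sampleMean x n ^ 2 := fun k => by ring
  simp only [sumSqDev, h2, Finset.sum_add_distrib, Finset.sum_sub_distrib, ← Finset.mul_sum, h1,
    Finset.sum_const, Nat.card_Icc, Nat.add_sub_cancel, nsmul_eq_mul]
  ring

/-- The same normalisation serves the variance, which converges to a constant, and the squared mean,
which converges to that constant times χ²(1). This is the source of the limit 1 + χ²(1). -/
theorem sum_sq_div_eq (x : ℕ → ℝ) (n : ℕ) :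
    (∑ k ∈ Finset.Icc 1 n, x k ^ 2) / (n * Real.log n) =
      sumSqDev x n / (n * Real.log n) + (sampleMean x n / √(Real.log n)) ^ 2 := by
  rw [sum_sq_eq_sumSqDev_add, add_div, div_pow, Real.sq_sqrt (Real.log_natCast_nonneg n)]
  rcases eq_or_ne n 0 with rfl | hn
  · simp
  have h0 : (n : ℝ) ≠ 0 := by exact_mod_cast hn
  rw [mul_div_mul_left _ _ h0]

theorem sq_div_sumSqDev_eq {n : ℕ} (hl : 0 < Real.log n) (x : ℕ → ℝ) (y : ℝ) :
    y ^ 2 / (sumSqDev x n / n) = (y / √(Real.log n)) ^ 2 / (sumSqDev x n / (n * Real.log n)) := by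
  rw [div_pow, Real.sq_sqrt hl.le]
  rcases eq_or_ne (sumSqDev x n) 0 with h | h
  · simp [h]
  rcases eq_or_ne n 0 with rfl | hn
  · simp
  have h0 : (n : ℝ) ≠ 0 := by exact_mod_cast hn
  field_simp

section Half

variable {Ω : Type*} [MeasurableSpace Ω] {P : Measure Ω}
  {ε : ℤ → Ω → ℝ} {X : ℕ → Ω → ℝ} {d c : ℝ} {a : ℕ → ℝ}

theorem measurable_sumSqDev (hX : IsIntegrated P d c a ε X) (n : ℕ) :
    Measurable fun ω => sumSqDev (fun k => X k ω) n :=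
  Finset.measurable_fun_sum _ fun k _ =>
    ((hX.measurable k).sub (measurable_sampleMean hX n)).pow_const 2

variable [IsProbabilityMeasure P]

theorem tendstoInMeasure_sumSqDev (hX : IsIntegrated P (1 / 2) c a ε X) :
    TendstoInMeasure P (fun (n : ℕ) ω => sumSqDev (fun k => X k ω) n / (n * Real.log n)) atTop
      fun _ => innovationVariance P ε * (4 * c ^ 2) :=
  tendstoInMeasure_of_tendsto_eLpNorm (p := 2) (by norm_num)
    (fun n => ((measurable_sumSqDev hX n).div_const _).aestronglyMeasurable)
    aestronglyMeasurable_const (tendsto_eLpNorm_sumSqDev hX)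

theorem tendstoInDistribution_sq_div_sumSqDev (hX : IsIntegrated P (1 / 2) c a ε X)
    (hv : 0 < innovationVariance P ε * (4 * c ^ 2)) {D : ℕ → Ω → ℝ} (mD : ∀ n, Measurable (D n))
    (hD : TendstoInDistribution (fun n ω => D n ω / √(Real.log n)) atTop id (fun _ => P)
      (gaussianReal 0 (innovationVariance P ε * (4 * c ^ 2)).toNNReal)) :
    TendstoInDistribution (fun n ω => D n ω ^ 2 / (sumSqDev (fun k => X k ω) n / n)) atTop id
      (fun _ => P) chiSqOne := by
  refine tendstoInDistribution_of_eventuallyEq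
    (tendstoInDistribution_sq_div hv hD (tendstoInMeasure_sumSqDev hX)
      fun n => (measurable_sumSqDev hX n).div_const _)
    (fun n => (((mD n).pow_const 2).div
      ((measurable_sumSqDev hX n).div_const _)).aemeasurable) ?_ aemeasurable_id rfl
  filter_upwards [tendsto_log_natCast.eventually_gt_atTop 0] with n hn
  funext ω
  exact sq_div_sumSqDev_eq hn _ _

end Half

theorem delta_neg_half (σ2 c : ℝ) (a : ℕ → ℝ) : delta (-(1 / 2)) σ2 c a = 8 * σ2 * c ^ 2 :=
  if_pos rfl

end LongMemory

/-! ### The main theorem -/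

theorem mainTheorem2 {Ω : Type*} [MeasurableSpace Ω] (P : Measure Ω) [IsProbabilityMeasure P]
    (d c : ℝ) (a : ℕ → ℝ) (ε : ℤ → Ω → ℝ) (X : ℕ → Ω → ℝ)
    (hX : LongMemory.IsIntegrated P d c a ε X) :
    -- Part A
    TendstoInDistribution
      (fun (n : ℕ) ω => LongMemory.sampleMean (fun k => X k ω) n / LongMemory.meanNorm d n)
      atTop id (fun _ => P)
      (gaussianReal 0
        (LongMemory.delta (d - 1) (LongMemory.innovationVariance P ε) c a / (2 * d + 1)).toNNReal) ∧
    -- Part B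
    (d = 1 / 2 → ∀ δ : ℝ,
      δ = LongMemory.delta (-(1 / 2)) (LongMemory.innovationVariance P ε) c a →
      -- 1. sample variance
      ((∀ n : ℕ, MemLp
          (fun ω => LongMemory.sumSqDev (fun k => X k ω) n / (n * Real.log n)) 2 P) ∧
        Tendsto
          (fun n : ℕ => eLpNorm
            (fun ω => LongMemory.sumSqDev (fun k => X k ω) n / (n * Real.log n) - δ / 2) 2 P)
          atTop (𝓝 0)) ∧
      TendstoInDistribution
        (fun (n : ℕ) ω => (∑ k ∈ Finset.Icc 1 n, (X k ω) ^ 2) / (n * Real.log n))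
        atTop (fun q : ℝ => δ / 2 * (1 + q)) (fun _ => P) LongMemory.chiSqOne ∧
      TendstoInDistribution
        (fun (n : ℕ) ω => (LongMemory.sampleMean (fun k => X k ω) n) ^ 2 /
          (LongMemory.sumSqDev (fun k => X k ω) n / n))
        atTop id (fun _ => P) LongMemory.chiSqOne ∧
      -- 2. difference of the initial and final means
      TendstoInDistribution
        (fun (n : ℕ) ω => LongMemory.meanDiff (fun k => X k ω) n / √(Real.log n))
        atTop id (fun _ => P) (gaussianReal 0 (δ / 2).toNNReal) ∧
      TendstoInDistribution
        (fun (n : ℕ) ω => (LongMemory.meanDiff (fun k => X k ω) n) ^ 2 /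
          (LongMemory.sumSqDev (fun k => X k ω) n / n))
        atTop id (fun _ => P) LongMemory.chiSqOne ∧
      -- 3. asymptotic independence of the discrete Fourier transform
      ∀ s : ℕ, 1 ≤ s → LongMemory.AsymptoticallyIndep P
        (fun (n : ℕ) ω =>
          (LongMemory.sampleMean (fun k => X k ω) n / √(Real.log n),
            LongMemory.meanDiff (fun k => X k ω) n / √(Real.log n)))
        (fun (n : ℕ) ω => LongMemory.dftVec (1 / 2) s (fun k => X k ω) n)) := by
  refine ⟨?_, ?_⟩
  · rcases eq_or_lt_of_le hX.le_memory with hd | hd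
    · subst hd
      have h := LongMemory.tendstoInDistribution_sampleMean_half hX
      -- At d = 1/2 the factor 1/(2d+1) is 1/2, and half of δ(-1/2) is the common variance 4σ_ε²c²
      -- found for the mean, for D_n and for the sample variance.
      have e : LongMemory.delta (1 / 2 - 1) (LongMemory.innovationVariance P ε) c a /
          (2 * (1 / 2) + 1) = LongMemory.innovationVariance P ε * (4 * c ^ 2) := by
        rw [show (1 / 2 - 1 : ℝ) = -(1 / 2) by norm_num, LongMemory.delta_neg_half]
        ring
      rw [e]
      simpa only [LongMemory.meanNorm_half] using h
    · exact LongMemory.tendstoInDistribution_sampleMean_of_lt hX hd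
  · intro hd δ hδ
    subst hd
    have e : δ / 2 = LongMemory.innovationVariance P ε * (4 * c ^ 2) := by
      rw [hδ, LongMemory.delta_neg_half]
      ring
    have hv : 0 < LongMemory.innovationVariance P ε * (4 * c ^ 2) := by
      rw [← e, hδ]
      exact half_pos (LongMemory.delta_pos hX.innovation.variance_pos hX.hasMemory_half)
    rw [e]
    have hMean := LongMemory.tendstoInDistribution_sampleMean_half hX
    have hDiff := LongMemory.tendstoInDistribution_meanDiff hX
    refine ⟨⟨fun n => ?_, LongMemory.tendsto_eLpNorm_sumSqDev hX⟩, ?_,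
      LongMemory.tendstoInDistribution_sq_div_sumSqDev hX hv
        (LongMemory.measurable_sampleMean hX) hMean, hDiff,
      LongMemory.tendstoInDistribution_sq_div_sumSqDev hX hv
        (LongMemory.measurable_meanDiff hX) hDiff,
      fun s _ => LongMemory.asymptoticallyIndep_dftVec hX s⟩
    · simpa only [div_eq_mul_inv] using (LongMemory.memLp_sumSqDev hX n).mul_const _
    · have h := LongMemory.tendstoInDistribution_add_sq hv hMean
        (LongMemory.tendstoInMeasure_sumSqDev hX)
        fun n => (LongMemory.measurable_sumSqDev hX n).div_const _
      simpa only [LongMemory.sum_sq_div_eq] using h
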